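/- Let $\phi$ be the standard normal density. Let $\gamma:\mathbb R\to(0,\infty)$ be a unimodal symmetric probability density such that, for some $\Lambda$ and some $\kappa\in[1,2]$: $|\log\gamma(x)-\log\gamma(y)|\le\Lambda|x-y|$ for all $x,y\in\mathbb R$; $\gamma(y)^{-1}\int_y^\infty\gamma(u)\,du\asymp y^{\kappa-1}$ as $y\to\infty$; and $y\mapsto y^2\gamma(y)$ is bounded. Put $g(x)=\int\gamma(x-u)\phi(u)\,du$ and $\beta(x)=g(x)/\phi(x)-1$. For $\theta\in\mathbb R^n$ let $X_i=\theta_i+\varepsilon_i$, $1\le i\le n$, with $\varepsilon_i$ i.i.d. $\mathcal N(0,1)$, and let $E_\theta$ be the corresponding expectation. Let $\hat w=\hat w(X)$ be the (almost surely unique) maximiser over $w\in[1/n,1]$ of the marginal log-likelihood $L(w)=\sum_{i=1}^n\log\phi(X_i)+\sum_{i=1}^n\log(1+w\beta(X_i))$; in case of ties the largest maximiser is taken. For $w\in[0,1]$, in the Bayesian model where $\theta_1\sim(1-w)\delta_0+w\,\gamma(u)du$ and $X_1=\theta_1+\varepsilon_1$ with $\varepsilon_1\sim\mathcal N(0,1)$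 independent of $\theta_1$, let $$\ell(x;w)=\frac{(1-w)\phi(x)}{(1-w)\phi(x)+w\,g(x)}\ \bigl(=\Pi(\theta_1=0\mid X_1=x)\bigr),\qquad q(x;w)=\Pi(\theta_1=0\mid |X_1|\ge|x|).$$ For $t\in(0,1)$, the $\ell$-value and the $q$-value procedures at level $t$ are $\varphi^{\ell}_i=\mathbf 1\{\ell(X_i;\hat w)\le t\}$ and $\varphi^{q}_i=\mathbf 1\{q(X_i;\hat w)\le t\}$, $1\le i\le n$. For a procedure $\varphi=(\varphi_i(X))_{1\le i\le n}\in\{0,1\}^n$ let $$\mathrm{FDR}(\theta,\varphi)=E_\theta\left[\frac{\sum_i\mathbf 1\{\theta_i=0\}\varphi_i}{1\vee\sum_i\varphi_i}\right],\qquad \mathrm{FNR}(\theta,\varphi)=E_\theta\left[\frac{\sum_i\mathbf 1\{\theta_i\ne0\}(1-\varphi_i)}{1\vee\sum_i\mathbf 1\{\theta_i\ne0\}}\right].$$ Let $a>1$, $\upsilon\in(0,1)$, and let $(s_n)$ be a sequence of nonnegative integers with $s_n\to\infty$ and $s_n\le n^\upsilon$ for all $n\ge1$. Let $\ell_0[s_n]$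 be the set of $\theta\in\mathbb R^n$ with at most $s_n$ nonzero coordinates, and $\mathcal L_0[s_n]$ the set of $\theta\in\mathbb R^n$ with exactly $s_n$ nonzero coordinates, all of which satisfy $|\theta_i|\ge a\sqrt{2\log(n/s_n)}$. Then, for every $t\in(0,1)$, both procedures are measurable functions of $X$ and $$\lim_{n}\Bigl[\sup_{\theta\in\ell_0[s_n]}\mathrm{FDR}(\theta,\varphi^{\ell})+\sup_{\theta\in\mathcal L_0[s_n]}\mathrm{FNR}(\theta,\varphi^{\ell})\Bigr]=0,$$ $$\lim_n\sup_{\theta\in\mathcal L_0[s_n]}\mathrm{FDR}(\theta,\varphi^{q})=t,\qquad \lim_n\sup_{\theta\in\mathcal L_0[s_n]}\mathrm{FNR}(\theta,\varphi^{q})=0.$$ -/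

import Mathlib

open MeasureTheory ProbabilityTheory Filter Topology Set

namespace SpikeSlab

/-- The standard normal density `φ`. -/
noncomputable def phi (x : ℝ) : ℝ := gaussianPDFReal 0 1 x

/-- `γ` is a unimodal symmetric slab density with Lipschitz logarithm, tail index `κ ∈ [1,2]`
and `y² γ(y)` bounded. (Continuity, hence measurability, follows from
`log_lipschitz`, and integrability from `integral_eq_one`.) -/
structure IsSlab (γ : ℝ → ℝ) (κ : ℝ) : Prop where
  pos : ∀ x, 0 < γ x
  integral_eq_one : ∫ x, γ x = 1
  symm : ∀ x, γ (-x) = γ x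
  unimodal : ∃ m : ℝ, MonotoneOn γ (Iic m) ∧ AntitoneOn γ (Ici m)
  log_lipschitz : ∃ Λ : ℝ, ∀ x y, |Real.log (γ x) - Real.log (γ y)| ≤ Λ * |x - y|
  kappa_mem : κ ∈ Icc (1 : ℝ) 2
  tail : (fun y : ℝ => (γ y)⁻¹ * ∫ u in Ioi y, γ u) =Θ[atTop] fun y : ℝ => y ^ (κ - 1)
  sq_mul_bounded : ∃ B : ℝ, ∀ y, y ^ 2 * γ y ≤ B

/-- The marginal density `g = γ ⋆ φ` of an observation whose mean is drawn from the slab. -/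
noncomputable def slabMarginal (γ : ℝ → ℝ) (x : ℝ) : ℝ := ∫ u, γ (x - u) * phi u

/-- The one-coordinate spike and slab prior `(1 - w) δ₀ + w γ(u) du`. -/
noncomputable def prior (γ : ℝ → ℝ) (w : ℝ) : Measure ℝ :=
  ENNReal.ofReal (1 - w) • Measure.dirac 0 +
    ENNReal.ofReal w • volume.withDensity (fun u => ENNReal.ofReal (γ u))

/-- The joint law of `(θ₁, X₁)` in the Bayesian model: `θ₁` has the spike and slab prior and
`X₁ = θ₁ + ε₁` with an independent standard normal `ε₁`. -/
noncomputable def bayesLaw (γ : ℝ → ℝ) (w : ℝ) : Measure (ℝ × ℝ) :=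
  ((prior γ w).prod (gaussianReal 0 1)).map (fun p => (p.1, p.1 + p.2))

/-- The `ℓ`-value `ℓ(x; w, g) = Π(θ₁ = 0 | X₁ = x)`, given by Bayes' formula for densities. -/
noncomputable def ellValue (γ : ℝ → ℝ) (w x : ℝ) : ℝ :=
  (1 - w) * phi x / ((1 - w) * phi x + w * slabMarginal γ x)

/-- The `q`-value `q(x; w, g) = Π(θ₁ = 0 | |X₁| ≥ |x|)`. -/
noncomputable def qValue (γ : ℝ → ℝ) (w x : ℝ) : ℝ :=
  (ProbabilityTheory.cond (bayesLaw γ w) {p | |x| ≤ |p.2|}).real {p | p.1 = 0}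

/-- `β(x) = g(x) / φ(x) - 1`. -/
noncomputable def beta (γ : ℝ → ℝ) (x : ℝ) : ℝ := slabMarginal γ x / phi x - 1

/-- The marginal log-likelihood `L(w)` of the weight `w`, given the data `X`. -/
noncomputable def logLik (γ : ℝ → ℝ) {n : ℕ} (X : Fin n → ℝ) (w : ℝ) : ℝ :=
  ∑ i, Real.log (phi (X i)) + ∑ i, Real.log (1 + w * beta γ (X i))

/-- The marginal maximum likelihood estimator `ŵ`: the maximiser of `L` on `[1/n, 1]`.
The maximiser is almost surely unique; in case of ties (a null event) the largest one is taken. -/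
noncomputable def wHat (γ : ℝ → ℝ) {n : ℕ} (X : Fin n → ℝ) : ℝ :=
  sSup {w | w ∈ Icc (1 / (n : ℝ)) 1 ∧ IsMaxOn (logLik γ X) (Icc (1 / (n : ℝ)) 1) w}

/-- The empirical Bayes `ℓ`-value procedure at level `t` (value `1` codes rejection). -/
noncomputable def ellProc (γ : ℝ → ℝ) (t : ℝ) (n : ℕ) (X : Fin n → ℝ) (i : Fin n) : ℝ :=
  if ellValue γ (wHat γ X) (X i) ≤ t then 1 else 0

/-- The empirical Bayes `q`-value procedure at level `t` (value `1` codes rejection). -/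
noncomputable def qProc (γ : ℝ → ℝ) (t : ℝ) (n : ℕ) (X : Fin n → ℝ) (i : Fin n) : ℝ :=
  if qValue γ (wHat γ X) (X i) ≤ t then 1 else 0

/-- The law of `X = θ + ε` with `ε` standard Gaussian on `ℝⁿ`. -/
noncomputable def law {n : ℕ} (θ : Fin n → ℝ) : Measure (Fin n → ℝ) :=
  Measure.pi fun i => gaussianReal (θ i) 1

/-- The false discovery rate of the procedure `ψ` at the parameter `θ`. -/
noncomputable def FDR {n : ℕ} (θ : Fin n → ℝ) (ψ : (Fin n → ℝ) → Fin n → ℝ) : ℝ :=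
  ∫ X, (∑ i, if θ i = 0 then ψ X i else 0) / max 1 (∑ i, ψ X i) ∂(law θ)

/-- The false negative rate of the procedure `ψ` at the parameter `θ`. -/
noncomputable def FNR {n : ℕ} (θ : Fin n → ℝ) (ψ : (Fin n → ℝ) → Fin n → ℝ) : ℝ :=
  ∫ X, (∑ i, if θ i ≠ 0 then 1 - ψ X i else 0) / max 1 (∑ i, if θ i ≠ 0 then (1 : ℝ) else 0)
    ∂(law θ)

/-- The number of nonzero coordinates of `θ`. -/
noncomputable def numNonzero {n : ℕ} (θ : Fin n → ℝ) : ℕ := {i | θ i ≠ 0}.ncard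

/-- The class `ℓ₀[s]` of `s`-sparse vectors of `ℝⁿ`. -/
def sparse (n s : ℕ) : Set (Fin n → ℝ) := {θ | numNonzero θ ≤ s}

/-- The class `𝓛₀[s; a]` of large signals with exactly `s` nonzero coordinates. -/
def large (n s : ℕ) (a : ℝ) : Set (Fin n → ℝ) :=
  {θ | θ ∈ sparse n s ∧ (∀ i, θ i ≠ 0 → a * √(2 * Real.log ((n : ℝ) / s)) ≤ |θ i|) ∧
    numNonzero θ = s}

end SpikeSlab

/-! Write lr = g/φ and m = `drift`, so that -m(w) is the null mean of the score β/(1 + wβ). By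
concavity of L, the estimator ŵ is at least c exactly when the total score at c is nonnegative
(`le_wHat_iff`). Events about ŵ thus become events about sums of independent variables, and
Chebyshev's inequality suffices throughout. A null coordinate contributes -m(w) on average, with
second moment at most 2m(w)/w; a clearly visible signal contributes nearly 1/w, and no coordinate
contributes more.

Large signals. The score balances where n w m(w) = s. If wm and wp solve this equation with (1 - ε)s
and (1 + ε)s on the right, then ŵ lies between them with high probability (`lt_wHat_prob`,
`wHat_lt_prob`). Since a > 1, nearly all signals are visible at level wm (`signal_visible`) and are
rejected by both procedures, whence the FNR limits. At weight w the q-value rejects |x| ≥ χ, where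
slabTail χ / nullTail χ = (1 - w)(1 - t)/(t w), so a null is rejected with probability close to t/(1
- t) · w · slabTail χ. As w lr passes from negligible to large within a small shift of χ, the drift
m(w) is asymptotic to slabTail χ (`drift_ge_slabTail`, `drift_le_slabTail`). Hence there are about
t/(1 - t) · n w m(w), that is t/(1 - t) · s, false discoveries against s true ones: a proportion t.
Rejection is monotone in w, so counts at wm and wp control those at ŵ (`large_class_event`).

The ℓ-value FDR over all sparse vectors. The ℓ-value threshold y satisfies lr(y) of order 1/w, so a
null exceeds it with probability of order φ(y)/y, that is w g(y)/y; the factor 1/y makes this o(w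
m(w)) (`null_exceedance_le`). Conversely, ŵ ≥ w forces the signals to offset the null drift n m(w).
A signal beyond the threshold offers at most 1/w and the other signals offer little in total, so at
least of order n w m(w) signals must be detected (`signal_detection`). False discoveries are
therefore negligible when ŵ is near w. Uniformity in ŵ comes from a dyadic grid of levels: halving w
at least halves n w m(w), so the failure probabilities form a geometric sum over the levels where n
w m(w) ≥ M. Below these levels, with high probability no null is rejected at all
(`eventually_FDR_ellProc_le`). -/

namespace SpikeSlab

/-! ### The standard normal density -/

lemma phi_eq (x : ℝ) : phi x = (√(2 * Real.pi))⁻¹ * Real.exp (-x ^ 2 / 2) := by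
  simp [phi, gaussianPDFReal]

lemma phi_pos (x : ℝ) : 0 < phi x := gaussianPDFReal_pos 0 1 x one_ne_zero

lemma phi_neg (x : ℝ) : phi (-x) = phi x := by simp [phi_eq]

lemma continuous_phi : Continuous phi := by
  have : phi = fun x => (√(2 * Real.pi))⁻¹ * Real.exp (-x ^ 2 / 2) := funext phi_eq
  rw [this]; fun_prop

lemma integrable_phi : Integrable phi := integrable_gaussianPDFReal 0 1

lemma integral_phi : ∫ x, phi x = 1 := integral_gaussianPDFReal_eq_one 0 one_ne_zero

lemma phi_add (x d : ℝ) : phi (x + d) = phi x * Real.exp (-(x * d) - d ^ 2 / 2) := by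
  rw [phi_eq, phi_eq, mul_assoc, ← Real.exp_add]
  ring_nf

lemma phi_le_one (x : ℝ) : phi x ≤ 1 := by
  rw [phi_eq]
  have h1 : (√(2 * Real.pi))⁻¹ ≤ 1 := by
    apply inv_le_one_of_one_le₀
    rw [Real.one_le_sqrt]
    nlinarith [Real.pi_gt_three]
  have h2 : Real.exp (-x ^ 2 / 2) ≤ 1 := by
    rw [Real.exp_le_one_iff]; nlinarith [sq_nonneg x]
  have h3 := Real.exp_pos (-x ^ 2 / 2)
  have h4 : 0 ≤ (√(2 * Real.pi))⁻¹ := by positivity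
  nlinarith

lemma gaussianReal_eq_withDensity (m : ℝ) :
    gaussianReal m 1 = volume.withDensity (fun x => ENNReal.ofReal (phi (x - m))) := by
  rw [gaussianReal_of_var_ne_zero m one_ne_zero]
  congr 1; ext x
  rw [gaussianPDF_def]
  simp [phi, gaussianPDFReal]

lemma integral_gaussianReal (m : ℝ) (f : ℝ → ℝ) :
    ∫ x, f x ∂(gaussianReal m 1) = ∫ x, f x * phi (x - m) := by
  rw [integral_gaussianReal_eq_integral_smul one_ne_zero]
  congr 1; ext x
  simp [phi, gaussianPDFReal, mul_comm]

lemma integrable_gaussianReal_iff (m : ℝ) (f : ℝ → ℝ) :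
    Integrable f (gaussianReal m 1) ↔ Integrable (fun x => f x * phi (x - m)) := by
  rw [gaussianReal_eq_withDensity, integrable_withDensity_iff_integrable_smul']
  · refine integrable_congr (ae_of_all _ fun x => ?_)
    simp [ENNReal.toReal_ofReal (phi_pos _).le, mul_comm]
  · exact (ENNReal.measurable_ofReal.comp (continuous_phi.measurable.comp (by fun_prop)))
  · exact ae_of_all _ fun x => ENNReal.ofReal_lt_top

lemma integrable_exp_mul_phi (c : ℝ) : Integrable (fun u => Real.exp (c * u) * phi u) := by
  have := (integrable_gaussianReal_iff 0 (fun u => Real.exp (c * u))).1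
    (integrable_exp_mul_gaussianReal c)
  simpa using this

lemma integrable_exp_abs_mul_phi (c : ℝ) :
    Integrable (fun u => Real.exp (c * |u|) * phi u) := by
  refine ((integrable_exp_mul_phi c).add (integrable_exp_mul_phi (-c))).mono' ?_ ?_
  · exact ((by fun_prop : Continuous fun u : ℝ => Real.exp (c * |u|)).mul
      continuous_phi).aestronglyMeasurable
  · refine ae_of_all _ fun u => ?_
    have hp := phi_pos u
    have h1 := Real.exp_pos (c * u)
    have h2 := Real.exp_pos (-c * u)
    rw [Real.norm_of_nonneg (by positivity)]
    simp only [Pi.add_apply]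
    rcases abs_cases u with ⟨h, _⟩ | ⟨h, _⟩ <;> rw [h]
    · nlinarith
    · rw [mul_neg, ← neg_mul]; nlinarith

/-! ### Functions with Lipschitz logarithm -/

/-- Serves both γ and g = γ ⋆ φ: convolution preserves the Lipschitz constant of the logarithm. -/
lemma continuous_of_exp_lip {f : ℝ → ℝ} {Λ : ℝ} (hpos : ∀ x, 0 < f x)
    (hlip : ∀ x y, f x ≤ f y * Real.exp (Λ * |x - y|)) : Continuous f := by
  have hlog : ∀ x y, Real.log (f x) - Real.log (f y) ≤ Λ * |x - y| := by
    intro x y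
    have := Real.log_le_log (hpos x) (hlip x y)
    rw [Real.log_mul (hpos y).ne' (Real.exp_pos _).ne', Real.log_exp] at this
    linarith
  have hL : LipschitzWith (Real.toNNReal Λ) (fun x => Real.log (f x)) := by
    refine LipschitzWith.of_dist_le_mul fun x y => ?_
    rw [Real.dist_eq, Real.dist_eq]
    have h1 : Λ * |x - y| ≤ (Real.toNNReal Λ : ℝ) * |x - y| :=
      mul_le_mul_of_nonneg_right (Real.le_coe_toNNReal Λ) (abs_nonneg _)
    refine abs_le.2 ⟨?_, (hlog x y).trans h1⟩
    have := hlog y x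
    rw [abs_sub_comm] at this
    linarith
  have : f = fun x => Real.exp (Real.log (f x)) := funext fun x => (Real.exp_log (hpos x)).symm
  rw [this]
  exact Real.continuous_exp.comp hL.continuous

/-- The properties of the slab density on which the asymptotic analysis relies. -/
structure Slab (γ : ℝ → ℝ) (Λ T : ℝ) : Prop where
  pos : ∀ x, 0 < γ x
  integrable : Integrable γ
  integral_eq_one : ∫ x, γ x = 1
  symm : ∀ x, γ (-x) = γ x
  one_le : 1 ≤ Λ
  lip : ∀ x y, γ x ≤ γ y * Real.exp (Λ * |x - y|)
  one_le_T : 1 ≤ T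
  tail : ∀ y, T ≤ y → ∫ u in Ioi y, γ u ≤ T * y * γ y

/-- Since κ ≤ 2, the factor y^(κ - 1) is at most y for y ≥ 1. One number `T` serves both as the
constant and as the threshold of the tail bound. -/
lemma IsSlab.exists_slab {γ : ℝ → ℝ} {κ : ℝ} (h : IsSlab γ κ) : ∃ Λ T, Slab γ Λ T := by
  obtain ⟨Λ, hΛ⟩ := h.log_lipschitz
  obtain ⟨c, hc⟩ := h.tail.1.bound
  obtain ⟨y0, hy0⟩ := eventually_atTop.1 hc
  refine ⟨max Λ 1, max (max c y0) 1, h.pos, ?_, h.integral_eq_one, h.symm, le_max_right _ _, ?_,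
    le_max_right _ _, ?_⟩
  -- The Bochner integral of a non-integrable function is 0, not 1.
  · by_contra hn
    have := h.integral_eq_one
    rw [integral_undef hn] at this
    exact zero_ne_one this
  · intro x y
    have h1 := (le_abs_self _).trans (hΛ x y)
    have h2 : Λ * |x - y| ≤ max Λ 1 * |x - y| :=
      mul_le_mul_of_nonneg_right (le_max_left _ _) (abs_nonneg _)
    have h3 : Real.log (γ x) ≤ Real.log (γ y) + max Λ 1 * |x - y| := by linarith
    calc γ x = Real.exp (Real.log (γ x)) := (Real.exp_log (h.pos x)).symm
      _ ≤ Real.exp (Real.log (γ y) + max Λ 1 * |x - y|) := Real.exp_le_exp.2 h3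
      _ = _ := by rw [Real.exp_add, Real.exp_log (h.pos y)]
  · intro y hy
    set T := max (max c y0) 1
    have hy1 : 1 ≤ y := (le_max_right _ _).trans hy
    have hyy : y0 ≤ y := ((le_max_right _ _).trans (le_max_left _ _)).trans hy
    have hcT : c ≤ T := (le_max_left _ _).trans (le_max_left _ _)
    have hT1 : 1 ≤ T := le_max_right _ _
    have hγ := h.pos y
    have hI : 0 ≤ ∫ u in Ioi y, γ u := integral_nonneg fun u => (h.pos u).le
    have := hy0 y hyy
    rw [Real.norm_of_nonneg (by positivity), Real.norm_of_nonneg (by positivity)] at this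
    have hk : y ^ (κ - 1) ≤ y := by
      calc y ^ (κ - 1) ≤ y ^ (1 : ℝ) :=
            Real.rpow_le_rpow_of_exponent_le hy1 (by linarith [h.kappa_mem.2])
        _ = y := Real.rpow_one y
    have hk0 : 0 ≤ y ^ (κ - 1) := by positivity
    have h5 : (γ y)⁻¹ * ∫ u in Ioi y, γ u ≤ T * y := by
      refine this.trans ?_
      calc c * y ^ (κ - 1) ≤ T * y ^ (κ - 1) := mul_le_mul_of_nonneg_right hcT hk0
        _ ≤ T * y := mul_le_mul_of_nonneg_left hk (by linarith)
    calc ∫ u in Ioi y, γ u = γ y * ((γ y)⁻¹ * ∫ u in Ioi y, γ u) := by field_simp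
      _ ≤ γ y * (T * y) := mul_le_mul_of_nonneg_left h5 hγ.le
      _ = T * y * γ y := by ring

namespace Slab

variable {γ : ℝ → ℝ} {Λ T : ℝ}

lemma continuous (h : Slab γ Λ T) : Continuous γ := continuous_of_exp_lip h.pos h.lip

/-! ### The marginal density -/

lemma integrable_conv (h : Slab γ Λ T) (x : ℝ) : Integrable (fun u => γ (x - u) * phi u) := by
  refine ((integrable_exp_abs_mul_phi Λ).const_mul (γ x)).mono' ?_ ?_
  · exact ((h.continuous.comp (by fun_prop)).mul continuous_phi).aestronglyMeasurable
  · refine ae_of_all _ fun u => ?_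
    rw [Real.norm_of_nonneg (mul_nonneg (h.pos _).le (phi_pos _).le), ← mul_assoc]
    refine mul_le_mul_of_nonneg_right ?_ (phi_pos _).le
    simpa using h.lip (x - u) x

lemma g_pos (h : Slab γ Λ T) (x : ℝ) : 0 < slabMarginal γ x := by
  unfold slabMarginal
  rw [integral_pos_iff_support_of_nonneg (fun u => (mul_pos (h.pos _) (phi_pos _)).le)
    (h.integrable_conv x)]
  have : Function.support (fun u => γ (x - u) * phi u) = univ := by
    ext u; simp [(h.pos (x - u)).ne', (phi_pos u).ne']
  rw [this]; simp

lemma g_lip (h : Slab γ Λ T) (x y : ℝ) :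
    slabMarginal γ x ≤ slabMarginal γ y * Real.exp (Λ * |x - y|) := by
  unfold slabMarginal
  rw [← integral_mul_const]
  refine integral_mono (h.integrable_conv x) ((h.integrable_conv y).mul_const _) fun u => ?_
  have := h.lip (x - u) (y - u)
  rw [sub_sub_sub_cancel_right] at this
  nlinarith [phi_pos u]

lemma continuous_g (h : Slab γ Λ T) : Continuous (slabMarginal γ) :=
  continuous_of_exp_lip h.g_pos h.g_lip

/-- A shift by u changes γ by a factor between exp(-Λ|u|) and exp(Λ|u|). With `mul_gamma_le_g` this
makes g and γ comparable, and carries the tail bound from γ to g. -/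
lemma g_le_mul_gamma (h : Slab γ Λ T) (x : ℝ) :
    slabMarginal γ x ≤ (∫ u, Real.exp (Λ * |u|) * phi u) * γ x := by
  unfold slabMarginal
  rw [← integral_mul_const]
  refine integral_mono (h.integrable_conv x) ((integrable_exp_abs_mul_phi Λ).mul_const _)
    fun u => ?_
  have := h.lip (x - u) x
  simp only [sub_sub_cancel_left, abs_neg] at this
  nlinarith [phi_pos u]

lemma mul_gamma_le_g (h : Slab γ Λ T) (x : ℝ) :
    (∫ u, Real.exp (-Λ * |u|) * phi u) * γ x ≤ slabMarginal γ x := by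
  unfold slabMarginal
  rw [← integral_mul_const]
  refine integral_mono ((integrable_exp_abs_mul_phi (-Λ)).mul_const _) (h.integrable_conv x)
    fun u => ?_
  have h1 := h.lip x (x - u)
  simp only [sub_sub_cancel] at h1
  have h2 : Real.exp (-Λ * |u|) * Real.exp (Λ * |u|) = 1 := by
    rw [← Real.exp_add]; simp
  have h3 : Real.exp (-Λ * |u|) * γ x ≤ γ (x - u) := by
    calc _ ≤ Real.exp (-Λ * |u|) * (γ (x - u) * Real.exp (Λ * |u|)) :=
          mul_le_mul_of_nonneg_left h1 (Real.exp_pos _).le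
      _ = γ (x - u) * (Real.exp (-Λ * |u|) * Real.exp (Λ * |u|)) := by ring
      _ = _ := by rw [h2, mul_one]
  show Real.exp (-Λ * |u|) * phi u * γ x ≤ γ (x - u) * phi u
  nlinarith [phi_pos u]

lemma integral_exp_abs_mul_phi_pos (c : ℝ) : 0 < ∫ u, Real.exp (c * |u|) * phi u := by
  rw [integral_pos_iff_support_of_nonneg (fun u => (mul_pos (Real.exp_pos _) (phi_pos _)).le)
    (integrable_exp_abs_mul_phi c)]
  have : Function.support (fun u => Real.exp (c * |u|) * phi u) = univ := by
    ext u; simp [(Real.exp_pos _).ne', (phi_pos u).ne']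
  rw [this]; simp

lemma g_eq_convolution (γ : ℝ → ℝ) :
    slabMarginal γ = convolution phi γ (ContinuousLinearMap.mul ℝ ℝ) volume := by
  ext x
  simp [slabMarginal, convolution, mul_comm]

lemma integrable_g (h : Slab γ Λ T) : Integrable (slabMarginal γ) := by
  rw [g_eq_convolution]
  exact integrable_phi.integrable_convolution _ h.integrable

lemma integral_g (h : Slab γ Λ T) : ∫ x, slabMarginal γ x = 1 := by
  rw [g_eq_convolution, integral_convolution _ integrable_phi h.integrable]
  simp [integral_phi, h.integral_eq_one]

lemma g_eq' (γ : ℝ → ℝ) (x : ℝ) : slabMarginal γ x = ∫ u, γ u * phi (x - u) := by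
  unfold slabMarginal
  rw [← integral_sub_left_eq_self (fun u => γ u * phi (x - u)) volume x]
  simp

lemma g_neg (h : Slab γ Λ T) (x : ℝ) : slabMarginal γ (-x) = slabMarginal γ x := by
  unfold slabMarginal
  rw [← integral_neg_eq_self (fun u => γ (-x - u) * phi u)]
  congr 1; ext u
  rw [phi_neg, ← h.symm (x - u)]
  congr 2; ring

end Slab

/-! ### The likelihood ratio `g / φ` -/

/-- The likelihood ratio `g / φ = 1 + β`. -/
noncomputable def lr (γ : ℝ → ℝ) (x : ℝ) : ℝ := slabMarginal γ x / phi x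

lemma beta_eq (γ : ℝ → ℝ) (x : ℝ) : beta γ x = lr γ x - 1 := rfl

lemma lr_mul_phi (γ : ℝ → ℝ) (x : ℝ) : lr γ x * phi x = slabMarginal γ x :=
  div_mul_cancel₀ _ (phi_pos x).ne'

namespace Slab

variable {γ : ℝ → ℝ} {Λ T : ℝ}

lemma lr_pos (h : Slab γ Λ T) (x : ℝ) : 0 < lr γ x := div_pos (h.g_pos x) (phi_pos x)

lemma continuous_lr (h : Slab γ Λ T) : Continuous (lr γ) :=
  h.continuous_g.div continuous_phi fun x => (phi_pos x).ne'

lemma lr_neg (h : Slab γ Λ T) (x : ℝ) : lr γ (-x) = lr γ x := by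
  rw [lr, lr, h.g_neg, phi_neg]

lemma lr_eq_integral (γ : ℝ → ℝ) (x : ℝ) :
    lr γ x = ∫ u, γ u * (Real.exp (x * u) * Real.exp (-(u ^ 2) / 2)) := by
  rw [lr, g_eq', ← integral_div]
  congr 1; ext u
  have : phi (x - u) = phi x * (Real.exp (x * u) * Real.exp (-(u ^ 2) / 2)) := by
    rw [sub_eq_add_neg, phi_add, ← Real.exp_add]; ring_nf
  rw [this]
  field_simp [(phi_pos x).ne']

lemma integrable_lr_integrand (h : Slab γ Λ T) (x : ℝ) :
    Integrable (fun u => γ u * (Real.exp (x * u) * Real.exp (-(u ^ 2) / 2))) := by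
  have h1 : Integrable (fun u => γ (x - (x - u)) * phi (x - u)) :=
    (h.integrable_conv x).comp_sub_left x
  have := h1.div_const (phi x)
  refine this.congr (ae_of_all _ fun u => ?_)
  have h2 : phi (x - u) = phi x * (Real.exp (x * u) * Real.exp (-(u ^ 2) / 2)) := by
    rw [sub_eq_add_neg, phi_add, ← Real.exp_add]; ring_nf
  simp only [sub_sub_cancel, h2]
  field_simp [(phi_pos x).ne']

lemma integrable_lr_cosh (h : Slab γ Λ T) (x : ℝ) :
    Integrable (fun u => γ u * (Real.cosh (x * u) * Real.exp (-(u ^ 2) / 2))) := by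
  refine (((h.integrable_lr_integrand x).add (h.integrable_lr_integrand (-x))).div_const 2).congr
    (ae_of_all _ fun u => ?_)
  simp only [Pi.add_apply, Real.cosh_eq, neg_mul]
  ring

lemma lr_eq_integral_cosh (h : Slab γ Λ T) (x : ℝ) :
    lr γ x = ∫ u, γ u * (Real.cosh (x * u) * Real.exp (-(u ^ 2) / 2)) := by
  have h1 : lr γ x = (lr γ x + lr γ (-x)) / 2 := by rw [h.lr_neg]; ring
  rw [h1, lr_eq_integral, lr_eq_integral, ← integral_add (h.integrable_lr_integrand x)
    (h.integrable_lr_integrand (-x)), ← integral_div]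
  congr 1; ext u
  simp only [Real.cosh_eq, neg_mul]
  ring

/-- By evenness, lr is the average of its values at x and -x, a positive mixture of the functions
cosh(xu), each increasing in |x|. -/
lemma lr_le_lr (h : Slab γ Λ T) {x y : ℝ} (hxy : |x| ≤ |y|) : lr γ x ≤ lr γ y := by
  rw [h.lr_eq_integral_cosh, h.lr_eq_integral_cosh]
  refine integral_mono (h.integrable_lr_cosh x) (h.integrable_lr_cosh y) fun u => ?_
  refine mul_le_mul_of_nonneg_left (mul_le_mul_of_nonneg_right ?_ (Real.exp_pos _).le) (h.pos u).le
  rw [Real.cosh_le_cosh, abs_mul, abs_mul]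
  exact mul_le_mul_of_nonneg_right hxy (abs_nonneg u)

/-- Exponential growth of the likelihood ratio. -/
lemma lr_mul_exp_le (h : Slab γ Λ T) {x d : ℝ} (hd : 0 ≤ d) :
    lr γ x * Real.exp (x * d - Λ * d) ≤ lr γ (x + d) := by
  unfold lr
  rw [phi_add, div_mul_eq_mul_div, div_le_div_iff₀ (phi_pos x) (by have := phi_pos x; positivity)]
  have h1 := h.g_lip x (x + d)
  rw [show x - (x + d) = -d by ring, abs_neg, abs_of_nonneg hd] at h1
  have e1 : Real.exp (x * d - Λ * d) * Real.exp (Λ * d) * Real.exp (-(x * d) - d ^ 2 / 2) ≤ 1 := by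
    rw [← Real.exp_add, ← Real.exp_add, Real.exp_le_one_iff]
    nlinarith [sq_nonneg d]
  calc slabMarginal γ x * Real.exp (x * d - Λ * d) * (phi x * Real.exp (-(x * d) - d ^ 2 / 2))
      = slabMarginal γ x * (Real.exp (x * d - Λ * d) * Real.exp (-(x * d) - d ^ 2 / 2)
          * phi x) := by ring
    _ ≤ slabMarginal γ (x + d) * Real.exp (Λ * d) * (Real.exp (x * d - Λ * d) *
          Real.exp (-(x * d) - d ^ 2 / 2) * phi x) := by
        refine mul_le_mul_of_nonneg_right h1 ?_
        have := phi_pos x; positivity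
    _ = slabMarginal γ (x + d) * phi x * (Real.exp (x * d - Λ * d) * Real.exp (Λ * d) *
          Real.exp (-(x * d) - d ^ 2 / 2)) := by ring
    _ ≤ slabMarginal γ (x + d) * phi x * 1 := by
        refine mul_le_mul_of_nonneg_left e1 ?_
        have := phi_pos x; have := h.g_pos (x + d); positivity
    _ = _ := mul_one _

/-- φ(x) is at most exp(-x²/2), while g loses at most a factor exp(Λ|x|) between 0 and x. -/
lemma le_lr (h : Slab γ Λ T) (x : ℝ) :
    slabMarginal γ 0 * Real.exp (x ^ 2 / 2 - Λ * |x|) ≤ lr γ x := by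
  unfold lr
  rw [le_div_iff₀ (phi_pos x)]
  have h1 := h.g_lip 0 x
  rw [zero_sub, abs_neg] at h1
  have h2 : phi x ≤ Real.exp (-x ^ 2 / 2) := by
    have := phi_add 0 x
    rw [zero_add] at this
    rw [this]
    have h3 := phi_le_one 0
    have h4 : Real.exp (-(0 * x) - x ^ 2 / 2) = Real.exp (-x ^ 2 / 2) := by ring_nf
    rw [h4]
    nlinarith [Real.exp_pos (-x ^ 2 / 2)]
  calc slabMarginal γ 0 * Real.exp (x ^ 2 / 2 - Λ * |x|) * phi x
      ≤ (slabMarginal γ x * Real.exp (Λ * |x|)) * Real.exp (x ^ 2 / 2 - Λ * |x|) *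
          Real.exp (-x ^ 2 / 2) := by
        have := phi_pos x; have := h.g_pos x
        gcongr
    _ = slabMarginal γ x * (Real.exp (Λ * |x|) * Real.exp (x ^ 2 / 2 - Λ * |x|) *
          Real.exp (-x ^ 2 / 2)) := by ring
    _ = slabMarginal γ x := by
        rw [← Real.exp_add, ← Real.exp_add]; ring_nf; simp

lemma tendsto_lr (h : Slab γ Λ T) : Tendsto (lr γ) atTop atTop := by
  have h1 : Tendsto (fun x : ℝ => slabMarginal γ 0 * Real.exp (x ^ 2 / 2 - Λ * x)) atTop atTop := by
    refine Tendsto.const_mul_atTop (h.g_pos 0) (Real.tendsto_exp_atTop.comp ?_)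
    have : (fun x : ℝ => x ^ 2 / 2 - Λ * x) = fun x => x * (x / 2 - Λ) := by ext; ring
    rw [this]
    refine tendsto_id.atTop_mul_atTop₀ (tendsto_atTop_add_const_right _ _ ?_)
    exact tendsto_id.atTop_div_const (by norm_num)
  refine tendsto_atTop_mono' _ ?_ h1
  filter_upwards [eventually_ge_atTop 0] with x hx
  simpa [abs_of_nonneg hx] using h.le_lr x

lemma exists_lr_eq (h : Slab γ Λ T) {y : ℝ} (hy : lr γ 0 ≤ y) : ∃ z, 0 ≤ z ∧ lr γ z = y := by
  obtain ⟨x, hx0, hx⟩ := ((eventually_ge_atTop 0).and (h.tendsto_lr.eventually_ge_atTop y)).exists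
  obtain ⟨z, hz, hzy⟩ := intermediate_value_Icc hx0 h.continuous_lr.continuousOn ⟨hy, hx⟩
  exact ⟨z, hz.1, hzy⟩

end Slab

/-- The score contribution `β(x) / (1 + w β(x))` of an observation. -/
noncomputable def score (γ : ℝ → ℝ) (w x : ℝ) : ℝ := beta γ x / (1 + w * beta γ x)

/-- Minus the expected score contribution of a null observation. -/
noncomputable def drift (γ : ℝ → ℝ) (w : ℝ) : ℝ := -∫ x, score γ w x ∂(gaussianReal 0 1)

/-- Two-sided tail mass of the marginal density. -/
noncomputable def slabTail (γ : ℝ → ℝ) (y : ℝ) : ℝ := ∫ x in {x | y ≤ |x|}, slabMarginal γ x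

/-- Two-sided Gaussian tail mass. -/
noncomputable def nullTail (y : ℝ) : ℝ := ∫ x in {x | y ≤ |x|}, phi x

/-! ### Tails of the Gaussian and of the marginal density -/

lemma measurableSet_tail (y : ℝ) : MeasurableSet {x : ℝ | y ≤ |x|} :=
  measurableSet_le measurable_const continuous_abs.measurable

lemma gaussianReal_real_eq_integral (m : ℝ) {A : Set ℝ} (hA : MeasurableSet A) :
    (gaussianReal m 1).real A = ∫ x in A, phi (x - m) := by
  rw [← integral_indicator_one hA, integral_gaussianReal, ← integral_indicator hA]
  congr 1; ext x
  by_cases hx : x ∈ A <;> simp [hx]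

lemma nullTail_eq (y : ℝ) : nullTail y = (gaussianReal 0 1).real {x | y ≤ |x|} := by
  rw [gaussianReal_real_eq_integral 0 (measurableSet_tail y)]
  simp [nullTail]

lemma setIntegral_tail_even {f : ℝ → ℝ} (hf : Integrable f) (heven : ∀ x, f (-x) = f x) {y : ℝ}
    (hy : 0 < y) : ∫ x in {x | y ≤ |x|}, f x = 2 * ∫ x in Ioi y, f x := by
  have h1 : {x : ℝ | y ≤ |x|} = Ici y ∪ Iic (-y) := by
    ext x; simp only [mem_ofPred_eq, mem_union, mem_Ici, mem_Iic, le_abs]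
    constructor <;> rintro (h | h) <;> [left; right; left; right] <;> linarith
  rw [h1, setIntegral_union _ measurableSet_Iic hf.integrableOn hf.integrableOn,
    integral_Ici_eq_integral_Ioi, ← integral_comp_neg_Ioi]
  · simp only [heven]; ring
  · rw [Set.disjoint_left]; intro x hx hx'
    simp only [mem_Ici, mem_Iic] at hx hx'; linarith

lemma phi_le_mul_exp {y x : ℝ} : phi x ≤ phi y * Real.exp (-(y * (x - y))) := by
  have := phi_add y (x - y)
  rw [add_sub_cancel] at this
  rw [this]
  refine mul_le_mul_of_nonneg_left (Real.exp_le_exp.2 ?_) (phi_pos y).le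
  nlinarith [sq_nonneg (x - y)]

/-- Mills' bound: on the right of y, φ lies below the exponential that matches its value and slope
at y. -/
lemma nullTail_le {y : ℝ} (hy : 0 < y) : nullTail y ≤ 2 * (phi y / y) := by
  rw [nullTail, setIntegral_tail_even integrable_phi phi_neg hy]
  refine mul_le_mul_of_nonneg_left ?_ (by norm_num)
  have hI : IntegrableOn (fun x => phi y * Real.exp (y * y) * Real.exp (-y * x)) (Ioi y) :=
    (integrableOn_exp_mul_Ioi (by linarith) y).const_mul _
  calc ∫ x in Ioi y, phi x
      ≤ ∫ x in Ioi y, phi y * Real.exp (y * y) * Real.exp (-y * x) := by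
        refine setIntegral_mono integrable_phi.integrableOn hI fun x => ?_
        refine (phi_le_mul_exp (y := y)).trans (le_of_eq ?_)
        rw [mul_assoc, ← Real.exp_add]; ring_nf
    _ = phi y / y := by
        rw [integral_const_mul, integral_exp_mul_Ioi (by linarith), mul_assoc,
          neg_div_neg_eq, mul_div_assoc', ← Real.exp_add]
        ring_nf; simp

/-- Lower bound for Gaussian tails with a nonnegative mean. -/
lemma le_gaussianReal_tail {z θ : ℝ} (hz : 1 ≤ z) (hθ : 0 ≤ θ) :
    Real.exp (-(3 / 2)) * phi (z - θ) / z ≤ (gaussianReal θ 1).real {x | z ≤ |x|} := by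
  rw [gaussianReal_real_eq_integral θ (measurableSet_tail z)]
  have hI : Integrable (fun x => phi (x - θ)) := integrable_phi.comp_sub_right θ
  -- On an interval of length 1/z ≤ 1 the exponent of φ drops by at most 1 from the linear term and
  -- 1/2 from the quadratic one, hence the factor exp(-3/2); a nonnegative mean only helps.
  have hsub : Icc z (z + 1 / z) ⊆ {x | z ≤ |x|} := fun x hx => hx.1.trans (le_abs_self x)
  have hz0 : 0 < z := by linarith
  have h1 : ∫ x in Icc z (z + 1 / z), Real.exp (-(3 / 2)) * phi (z - θ)
      = Real.exp (-(3 / 2)) * phi (z - θ) / z := by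
    rw [setIntegral_const, Measure.real, Real.volume_Icc, add_sub_cancel_left,
      ENNReal.toReal_ofReal (by positivity), smul_eq_mul]
    ring
  rw [← h1]
  refine le_trans ?_ (setIntegral_mono_set hI.integrableOn
    (ae_of_all _ fun x => (phi_pos _).le) (LE.le.eventuallyLE hsub))
  refine setIntegral_mono_on (integrableOn_const (by simp)) hI.integrableOn
    measurableSet_Icc fun x hx => ?_
  have := phi_add (z - θ) (x - z)
  rw [show z - θ + (x - z) = x - θ by ring] at this
  rw [this, mul_comm]
  refine mul_le_mul_of_nonneg_left (Real.exp_le_exp.2 ?_) (phi_pos _).le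
  have hd0 : 0 ≤ x - z := by linarith [hx.1]
  have hd1 : x - z ≤ 1 / z := by linarith [hx.2]
  have hd2 : z * (x - z) ≤ 1 := by
    calc z * (x - z) ≤ z * (1 / z) := mul_le_mul_of_nonneg_left hd1 hz0.le
      _ = 1 := by field_simp
  have hd3 : x - z ≤ 1 := by nlinarith
  nlinarith [mul_nonneg hθ hd0]

namespace Slab

variable {γ : ℝ → ℝ} {Λ T : ℝ}

/-- Only [y, y + 1] is kept, where g loses at most a factor exp Λ. -/
lemma slabTail_pos_bound (h : Slab γ Λ T) (y : ℝ) :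
    Real.exp (-Λ) * slabMarginal γ y ≤ slabTail γ y := by
  wlog hy : 0 ≤ y generalizing y with H
  · have h1 := H (-y) (by linarith)
    rw [h.g_neg] at h1
    refine h1.trans (setIntegral_mono_set h.integrable_g.integrableOn
      (ae_of_all _ fun x => (h.g_pos x).le) (LE.le.eventuallyLE ?_))
    intro x hx; simp only [mem_ofPred_eq] at hx ⊢; linarith
  have hsub : Icc y (y + 1) ⊆ {x | y ≤ |x|} := fun x hx => hx.1.trans (le_abs_self x)
  have h1 : ∫ x in Icc y (y + 1), Real.exp (-Λ) * slabMarginal γ y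
      = Real.exp (-Λ) * slabMarginal γ y := by
    rw [setIntegral_const, Measure.real, Real.volume_Icc]; simp
  rw [← h1]
  refine le_trans ?_ (setIntegral_mono_set h.integrable_g.integrableOn
    (ae_of_all _ fun x => (h.g_pos _).le) (LE.le.eventuallyLE hsub))
  refine setIntegral_mono_on (integrableOn_const (by simp)) h.integrable_g.integrableOn
    measurableSet_Icc fun x hx => ?_
  have h2 := h.g_lip y x
  have h3 : |y - x| ≤ 1 := by rw [abs_le]; constructor <;> linarith [hx.1, hx.2]
  have h4 : Real.exp (Λ * |y - x|) ≤ Real.exp Λ :=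
    Real.exp_le_exp.2 (by nlinarith [h.one_le])
  calc Real.exp (-Λ) * slabMarginal γ y ≤ Real.exp (-Λ) * (slabMarginal γ x * Real.exp Λ) := by
        refine mul_le_mul_of_nonneg_left (h2.trans ?_) (Real.exp_pos _).le
        exact mul_le_mul_of_nonneg_left h4 (h.g_pos x).le
    _ = slabMarginal γ x * (Real.exp (-Λ) * Real.exp Λ) := by ring
    _ = _ := by rw [← Real.exp_add]; simp

lemma slabTail_anti (h : Slab γ Λ T) {x y : ℝ} (hxy : x ≤ y) : slabTail γ y ≤ slabTail γ x :=
  setIntegral_mono_set h.integrable_g.integrableOn (ae_of_all _ fun x => (h.g_pos x).le)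
    (LE.le.eventuallyLE fun _ hu => hxy.trans hu)

/-- Local stability of the marginal tail. -/
lemma slabTail_le_mul_exp (h : Slab γ Λ T) {y d : ℝ} (hy : 0 < y) (hd : 0 ≤ d) :
    slabTail γ y ≤ slabTail γ (y + d) * Real.exp (Λ * d) := by
  rw [slabTail, slabTail, setIntegral_tail_even h.integrable_g h.g_neg hy,
    setIntegral_tail_even h.integrable_g h.g_neg (by linarith : 0 < y + d), mul_assoc,
    ← integral_mul_const]
  refine mul_le_mul_of_nonneg_left ?_ (by norm_num)
  have hpre : (fun x : ℝ => x + d) ⁻¹' Ioi (y + d) = Ioi y := by ext x; simp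
  rw [← (measurePreserving_add_right volume d).setIntegral_preimage_emb
    (measurableEmbedding_addRight d) (fun x => slabMarginal γ x * Real.exp (Λ * d)), hpre]
  refine setIntegral_mono h.integrable_g.integrableOn
    ((h.integrable_g.comp_add_right d).mul_const _).integrableOn fun x => ?_
  have := h.g_lip x (x + d)
  rwa [show x - (x + d) = -d by ring, abs_neg, abs_of_nonneg hd] at this

/-- The tail of the marginal density is at most `y g(y)`, up to a constant. -/
lemma exists_slabTail_le (h : Slab γ Λ T) :
    ∃ C, 1 ≤ C ∧ ∀ y, T ≤ y → slabTail γ y ≤ C * y * slabMarginal γ y := by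
  set A := ∫ u, Real.exp (Λ * |u|) * phi u
  set a := ∫ u, Real.exp (-Λ * |u|) * phi u
  have hA : 0 < A := integral_exp_abs_mul_phi_pos Λ
  have ha : 0 < a := integral_exp_abs_mul_phi_pos (-Λ)
  refine ⟨max 1 (2 * A * T / a), le_max_left _ _, fun y hy => ?_⟩
  have hy0 : 0 < y := by linarith [h.one_le_T]
  have hg := h.g_pos y
  have hγ := h.pos y
  rw [slabTail, setIntegral_tail_even h.integrable_g h.g_neg hy0]
  calc 2 * ∫ x in Ioi y, slabMarginal γ x ≤ 2 * ∫ x in Ioi y, A * γ x := by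
        refine mul_le_mul_of_nonneg_left ?_ (by norm_num)
        exact setIntegral_mono h.integrable_g.integrableOn (h.integrable.const_mul A).integrableOn
          fun x => h.g_le_mul_gamma x
    _ = 2 * A * ∫ x in Ioi y, γ x := by rw [integral_const_mul]; ring
    _ ≤ 2 * A * (T * y * γ y) := mul_le_mul_of_nonneg_left (h.tail y hy) (by positivity)
    _ = 2 * A * T / a * y * (a * γ y) := by field_simp
    _ ≤ 2 * A * T / a * y * slabMarginal γ y := by
        refine mul_le_mul_of_nonneg_left (h.mul_gamma_le_g y) ?_
        have := h.one_le_T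
        positivity
    _ ≤ _ := by
        have hyg : 0 ≤ y * slabMarginal γ y := by positivity
        rw [mul_assoc, mul_assoc (max 1 (2 * A * T / a))]
        exact mul_le_mul_of_nonneg_right (le_max_right _ _) hyg

/-- Beyond Λ the growth factor exp((x - Λ)d) of `lr_mul_exp_le` exceeds 1. Strictness lets
`lr_le_lr_iff` turn level sets of lr into tails {y ≤ |x|}. -/
lemma lr_lt_lr (h : Slab γ Λ T) {x y : ℝ} (hy : Λ < y) (hxy : |x| < y) : lr γ x < lr γ y := by
  have hlt : max |x| Λ < y := max_lt hxy hy
  obtain ⟨x1, hx1, hx2⟩ := exists_between hlt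
  have hx3 : |x| ≤ |x1| := ((le_max_left _ _).trans hx1.le).trans (le_abs_self _)
  refine (h.lr_le_lr hx3).trans_lt ?_
  have h1 := h.lr_mul_exp_le (x := x1) (sub_nonneg.2 hx2.le)
  rw [add_sub_cancel] at h1
  refine lt_of_lt_of_le ?_ h1
  have h2 : 1 < Real.exp (x1 * (y - x1) - Λ * (y - x1)) := by
    rw [Real.one_lt_exp_iff]
    have : Λ < x1 := (le_max_right _ _).trans_lt hx1
    nlinarith
  nlinarith [h.lr_pos x1]

lemma lr_le_lr_iff (h : Slab γ Λ T) {x y : ℝ} (hy : Λ < y) : lr γ y ≤ lr γ x ↔ y ≤ |x| := by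
  constructor
  · intro hle
    by_contra hn
    exact absurd (h.lr_lt_lr hy (not_le.1 hn)) (not_lt.2 hle)
  · intro hle
    exact h.lr_le_lr ((abs_of_pos (by linarith [h.one_le] : 0 < y)).le.trans hle)

/-- Large values of the likelihood ratio are attained at large arguments. -/
lemma exists_threshold (h : Slab γ Λ T) (Y : ℝ) :
    ∃ R, 0 < R ∧ ∀ r, R ≤ r → ∃ z, Y ≤ z ∧ lr γ z = r := by
  refine ⟨lr γ (max Y 0) + 1, by linarith [h.lr_pos (max Y 0)], fun r hr => ?_⟩
  have h0 : lr γ 0 ≤ lr γ (max Y 0) := h.lr_le_lr (by simp)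
  obtain ⟨z, hz0, hz⟩ := h.exists_lr_eq (y := r) (by linarith)
  refine ⟨z, ?_, hz⟩
  by_contra hn
  have : lr γ z ≤ lr γ (max Y 0) := h.lr_le_lr (by
    rw [abs_of_nonneg hz0, abs_of_nonneg (le_max_right _ _)]
    exact (not_le.1 hn).le.trans (le_max_left _ _))
  linarith

/-! ### The score -/

lemma neg_one_lt_beta (h : Slab γ Λ T) (x : ℝ) : -1 < beta γ x := by
  rw [beta_eq]; linarith [h.lr_pos x]

lemma one_add_pos (h : Slab γ Λ T) {w : ℝ} (h0 : 0 ≤ w) (h1 : w ≤ 1) (x : ℝ) :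
    0 < 1 + w * beta γ x := by
  have := h.neg_one_lt_beta x
  rcases h0.eq_or_lt with rfl | h0
  · simp
  · nlinarith

lemma continuous_beta (h : Slab γ Λ T) : Continuous (beta γ) := by
  have : beta γ = fun x => lr γ x - 1 := funext (beta_eq γ)
  rw [this]; exact h.continuous_lr.sub continuous_const

lemma continuous_score (h : Slab γ Λ T) {w : ℝ} (h0 : 0 ≤ w) (h1 : w ≤ 1) :
    Continuous (score γ w) :=
  h.continuous_beta.div (continuous_const.add (continuous_const.mul h.continuous_beta))
    fun x => (h.one_add_pos h0 h1 x).ne'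

lemma score_le_inv (h : Slab γ Λ T) {w : ℝ} (h0 : 0 < w) (h1 : w ≤ 1) (x : ℝ) :
    score γ w x ≤ 1 / w := by
  rw [score, div_le_div_iff₀ (h.one_add_pos h0.le h1 x) h0]
  linarith

lemma neg_two_le_score (h : Slab γ Λ T) {w : ℝ} (h0 : 0 ≤ w) (h1 : w ≤ 1 / 2) (x : ℝ) :
    -2 ≤ score γ w x := by
  rw [score, le_div_iff₀ (h.one_add_pos h0 (by linarith) x)]
  nlinarith [h.neg_one_lt_beta x]

lemma abs_score_le (h : Slab γ Λ T) {w : ℝ} (h0 : 0 < w) (h1 : w ≤ 1 / 2) (x : ℝ) :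
    |score γ w x| ≤ 1 / w := by
  rw [abs_le]
  refine ⟨?_, h.score_le_inv h0 (by linarith) x⟩
  have : 2 ≤ 1 / w := by rw [le_div_iff₀ h0]; linarith
  linarith [h.neg_two_le_score h0.le h1 x]

lemma score_le_lr (h : Slab γ Λ T) {w : ℝ} (h0 : 0 ≤ w) (h1 : w ≤ 1) (x : ℝ) :
    score γ w x ≤ lr γ x := by
  rw [score, div_le_iff₀ (h.one_add_pos h0 h1 x), beta_eq]
  have := h.lr_pos x
  nlinarith [mul_nonneg h0 (sq_nonneg (lr γ x)), mul_nonneg h0 this.le]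

lemma score_anti (h : Slab γ Λ T) {w w' : ℝ} (h0 : 0 ≤ w) (hw : w ≤ w') (h1 : w' ≤ 1) (x : ℝ) :
    score γ w' x ≤ score γ w x := by
  rw [score, score, div_le_div_iff₀ (h.one_add_pos (h0.trans hw) h1 x)
    (h.one_add_pos h0 (hw.trans h1) x)]
  nlinarith [mul_nonneg (sub_nonneg.2 hw) (sq_nonneg (beta γ x))]

lemma integrable_score (h : Slab γ Λ T) {w : ℝ} (h0 : 0 < w) (h1 : w ≤ 1 / 2) (m : ℝ) :
    Integrable (score γ w) (gaussianReal m 1) :=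
  Integrable.of_bound (h.continuous_score h0.le (by linarith)).aestronglyMeasurable (1 / w)
    (ae_of_all _ fun x => h.abs_score_le h0 h1 x)

lemma integrable_beta (h : Slab γ Λ T) : Integrable (beta γ) (gaussianReal 0 1) := by
  rw [integrable_gaussianReal_iff]
  refine (h.integrable_g.sub integrable_phi).congr (ae_of_all _ fun x => ?_)
  simp [beta_eq, sub_mul, lr_mul_phi]

lemma integral_beta (h : Slab γ Λ T) : ∫ x, beta γ x ∂(gaussianReal 0 1) = 0 := by
  rw [integral_gaussianReal]
  have : ∀ x, beta γ x * phi (x - 0) = slabMarginal γ x - phi x := fun x => by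
    simp [beta_eq, sub_mul, lr_mul_phi]
  simp_rw [this]
  rw [integral_sub h.integrable_g integrable_phi, h.integral_g, integral_phi, sub_self]

/-- As β has null mean zero (`integral_beta`), integrating this identity writes the drift as the
integral of a nonnegative function, the form from which its bounds are derived. -/
lemma sub_score (h : Slab γ Λ T) {w : ℝ} (h0 : 0 ≤ w) (h1 : w ≤ 1) (x : ℝ) :
    beta γ x - score γ w x = w * (beta γ x ^ 2 / (1 + w * beta γ x)) := by
  have := (h.one_add_pos h0 h1 x).ne'
  rw [score, eq_comm, mul_div_assoc', eq_sub_iff_add_eq, ← add_div, div_eq_iff this]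
  ring

lemma integrable_drift (h : Slab γ Λ T) {w : ℝ} (h0 : 0 < w) (h1 : w ≤ 1 / 2) :
    Integrable (fun x => w * (beta γ x ^ 2 / (1 + w * beta γ x))) (gaussianReal 0 1) :=
  (h.integrable_beta.sub (h.integrable_score h0 h1 0)).congr
    (ae_of_all _ fun x => h.sub_score h0.le (by linarith) x)

lemma drift_eq (h : Slab γ Λ T) {w : ℝ} (h0 : 0 < w) (h1 : w ≤ 1 / 2) :
    drift γ w = ∫ x, w * (beta γ x ^ 2 / (1 + w * beta γ x)) ∂(gaussianReal 0 1) := by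
  rw [← integral_congr_ae (ae_of_all _ fun x => h.sub_score h0.le (by linarith : w ≤ 1) x),
    integral_sub h.integrable_beta (h.integrable_score h0 h1 0), h.integral_beta, drift]
  ring

lemma drift_nonneg (h : Slab γ Λ T) {w : ℝ} (h0 : 0 < w) (h1 : w ≤ 1 / 2) : 0 ≤ drift γ w := by
  rw [h.drift_eq h0 h1]
  refine integral_nonneg fun x => ?_
  have := h.one_add_pos h0.le (by linarith) x
  positivity

lemma drift_le_two (h : Slab γ Λ T) {w : ℝ} (h0 : 0 < w) (h1 : w ≤ 1 / 2) : drift γ w ≤ 2 := by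
  have h2 : ∫ x, (-2 : ℝ) ∂(gaussianReal 0 1) ≤ ∫ x, score γ w x ∂(gaussianReal 0 1) :=
    integral_mono (integrable_const _) (h.integrable_score h0 h1 0)
      fun x => h.neg_two_le_score h0.le h1 x
  simp at h2
  rw [drift]; linarith

lemma drift_mono (h : Slab γ Λ T) {w w' : ℝ} (h0 : 0 < w) (hw : w ≤ w') (h1 : w' ≤ 1 / 2) :
    drift γ w ≤ drift γ w' :=
  neg_le_neg (integral_mono (h.integrable_score (h0.trans_le hw) h1 0)
    (h.integrable_score h0 (hw.trans h1) 0) fun x => h.score_anti h0.le hw (by linarith) x)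

/-- The second moment of the null score is controlled by its drift. -/
lemma integral_score_sq_le (h : Slab γ Λ T) {w : ℝ} (h0 : 0 < w) (h1 : w ≤ 1 / 2) :
    ∫ x, score γ w x ^ 2 ∂(gaussianReal 0 1) ≤ 2 * drift γ w / w := by
  rw [h.drift_eq h0 h1, mul_comm (2 : ℝ), mul_div_assoc, ← integral_mul_const]
  refine integral_mono_of_nonneg (ae_of_all _ fun x => sq_nonneg _)
    ((h.integrable_drift h0 h1).mul_const _) (ae_of_all _ fun x => ?_)
  have hp := h.one_add_pos h0.le (by linarith) x
  have hb := h.neg_one_lt_beta x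
  have : score γ w x ^ 2 = beta γ x ^ 2 / (1 + w * beta γ x) * (1 / (1 + w * beta γ x)) := by
    rw [score]; field_simp
  simp only [this]
  -- The spare factor of score² beyond the drift integrand is bounded because β > -1 and w ≤ 1/2.
  have h3 : 1 / (1 + w * beta γ x) ≤ 2 := by
    rw [div_le_iff₀ hp]; nlinarith
  calc _ ≤ beta γ x ^ 2 / (1 + w * beta γ x) * 2 :=
        mul_le_mul_of_nonneg_left h3 (by positivity)
    _ = _ := by field_simp

lemma drift_eq_volume (h : Slab γ Λ T) {w : ℝ} (h0 : 0 < w) (h1 : w ≤ 1 / 2) :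
    drift γ w = ∫ x, w * (beta γ x ^ 2 / (1 + w * beta γ x)) * phi x := by
  rw [h.drift_eq h0 h1, integral_gaussianReal]; simp

lemma integrable_drift_volume (h : Slab γ Λ T) {w : ℝ} (h0 : 0 < w) (h1 : w ≤ 1 / 2) :
    Integrable (fun x => w * (beta γ x ^ 2 / (1 + w * beta γ x)) * phi x) := by
  have := (integrable_gaussianReal_iff 0 _).1 (h.integrable_drift h0 h1)
  simpa using this

/-- Lower bound for the drift by the tail of the marginal density. -/
lemma le_drift (h : Slab γ Λ T) {w K y : ℝ} (h0 : 0 < w) (h1 : w ≤ 1 / 2) (hK : 1 ≤ K)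
    (hy0 : 0 ≤ y) (hy : K / w ≤ beta γ y) :
    (K / (1 + K)) ^ 2 * slabTail γ y ≤ drift γ w := by
  rw [h.drift_eq_volume h0 h1, slabTail, ← integral_const_mul]
  refine le_trans ?_ (setIntegral_le_integral (s := {x | y ≤ |x|})
    (h.integrable_drift_volume h0 h1) (ae_of_all _ fun x => ?_))
  · refine setIntegral_mono_on (h.integrable_g.const_mul _).integrableOn
      (h.integrable_drift_volume h0 h1).integrableOn (measurableSet_tail y) fun x hx => ?_
    have hb : beta γ y ≤ beta γ x := by
      rw [beta_eq, beta_eq]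
      linarith [h.lr_le_lr (x := y) (y := x) (by rwa [abs_of_nonneg hy0])]
    have hwb : K ≤ w * beta γ x := by
      have := hy.trans hb
      rw [div_le_iff₀ h0] at this; linarith
    have hbK : K ≤ beta γ x := by nlinarith
    have hlr : lr γ x = beta γ x + 1 := by rw [beta_eq]; ring
    rw [← lr_mul_phi, hlr, ← mul_assoc]
    refine mul_le_mul_of_nonneg_right ?_ (phi_pos x).le
    -- The drift integrand times φ equals wβ/(1 + wβ) · β/(1 + β) · g, and both fractions are at
    -- least K/(1 + K) on the tail.
    have e1 : K / (1 + K) ≤ w * beta γ x / (1 + w * beta γ x) := by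
      rw [div_le_div_iff₀ (by linarith) (by linarith)]; nlinarith
    have e2 : K / (1 + K) ≤ beta γ x / (1 + beta γ x) := by
      rw [div_le_div_iff₀ (by linarith) (by linarith)]; nlinarith
    have e3 : 0 ≤ K / (1 + K) := by positivity
    calc (K / (1 + K)) ^ 2 * (beta γ x + 1)
        ≤ (w * beta γ x / (1 + w * beta γ x)) * (beta γ x / (1 + beta γ x)) * (beta γ x + 1) := by
          refine mul_le_mul_of_nonneg_right ?_ (by linarith)
          rw [sq]; exact mul_le_mul e1 e2 e3 (e3.trans e1)
      _ = w * (beta γ x ^ 2 / (1 + w * beta γ x)) := by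
          have : 1 + beta γ x ≠ 0 := by linarith
          have : 1 + w * beta γ x ≠ 0 := by linarith
          field_simp; ring
  · have := h.one_add_pos h0.le (by linarith) x
    have := phi_pos x
    positivity

lemma continuousOn_drift (h : Slab γ Λ T) {a : ℝ} (ha : 0 < a) :
    ContinuousOn (drift γ) (Icc a (1 / 2)) := by
  unfold drift
  refine ContinuousOn.neg ?_
  refine continuousOn_of_dominated (bound := fun _ => 1 / a) (F := fun w x => score γ w x) ?_ ?_
    (integrable_const _) ?_
  · intro w hw
    exact (h.continuous_score (ha.le.trans hw.1) (by linarith [hw.2])).aestronglyMeasurable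
  · intro w hw
    refine ae_of_all _ fun x => (h.abs_score_le (ha.trans_le hw.1) hw.2 x).trans ?_
    exact one_div_le_one_div_of_le ha hw.1
  · refine ae_of_all _ fun x => ?_
    refine continuousOn_const.div (by fun_prop) fun w hw => ?_
    exact (h.one_add_pos (ha.le.trans hw.1) (by linarith [hw.2]) x).ne'

/-- A null false positive is much rarer than its contribution to the drift. -/
lemma null_exceedance_le (h : Slab γ Λ T) {k ε : ℝ} (hk : 0 < k) (hε : 0 < ε) :
    ∃ w₀, 0 < w₀ ∧ w₀ ≤ 1 / 4 ∧ ∀ v, 0 < v → v ≤ w₀ →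
      (gaussianReal 0 1).real {x | k ≤ 2 * v * lr γ x} ≤ ε * (v * drift γ v) := by
  -- The event is {y ≤ |x|} with lr(y) = k/(2v), so its null mass is at most 2φ(y)/y = (4v/k)
  -- g(y)/y. One unit further right lr exceeds 4/v, thanks to `D`, so `le_drift` with K = 1 gives
  -- g(y) ≤ 4 exp(2Λ) drift(v). The product is (C/y) · v · drift(v), and y is large for small v.
  set C := 16 * Real.exp (2 * Λ) / k with hC
  have hCpos : 0 < C := by positivity
  set D := Real.log (8 / k + 1) with hD
  obtain ⟨R, hR, hRz⟩ := h.exists_threshold (max (max (C / ε) (2 * Λ)) (Λ + D) + 1)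
  refine ⟨min (1 / 4) (k / (2 * R)), by positivity, min_le_left _ _, fun v hv hvw => ?_⟩
  have hv1 : v ≤ 1 / 4 := hvw.trans (min_le_left _ _)
  have hv2 : R ≤ k / (2 * v) := by
    have := hvw.trans (min_le_right _ _)
    rw [le_div_iff₀ (by positivity)] at this ⊢
    linarith
  obtain ⟨y, hy, hyk⟩ := hRz _ hv2
  have hyC : C / ε ≤ y := by
    linarith [(le_max_left (C / ε) (2 * Λ)).trans (le_max_left _ (Λ + D))]
  have hyL : 2 * Λ + 1 ≤ y := by
    linarith [(le_max_right (C / ε) (2 * Λ)).trans (le_max_left _ (Λ + D))]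
  have hyD : Λ + D ≤ y := by linarith [le_max_right (max (C / ε) (2 * Λ)) (Λ + D)]
  have hΛ := h.one_le
  have hy0 : 0 < y := by linarith
  have hset : {x | k ≤ 2 * v * lr γ x} = {x | y ≤ |x|} := by
    ext x
    rw [mem_ofPred_eq, mem_ofPred_eq, ← h.lr_le_lr_iff (by linarith : Λ < y), hyk,
      div_le_iff₀ (by positivity)]
    rw [mul_comm]
  rw [hset, ← nullTail_eq]
  have hg := h.g_pos y
  -- the null tail
  have h1 : nullTail y ≤ 2 * (phi y / y) := nullTail_le hy0
  have h2 : phi y = slabMarginal γ y * (2 * v / k) := by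
    rw [← lr_mul_phi, hyk]; field_simp
  -- the drift
  have h3 : 4 / v ≤ lr γ (y + 1) := by
    have e1 := h.lr_mul_exp_le (x := y) (d := 1) zero_le_one
    rw [hyk, mul_one, mul_one] at e1
    have e2 : 8 / k ≤ Real.exp (y - Λ) := by
      calc 8 / k ≤ 8 / k + 1 := by linarith
        _ = Real.exp D := by rw [hD, Real.exp_log (by positivity)]
        _ ≤ _ := Real.exp_le_exp.2 (by linarith)
    calc 4 / v = k / (2 * v) * (8 / k) := by field_simp; norm_num
      _ ≤ k / (2 * v) * Real.exp (y - Λ) := mul_le_mul_of_nonneg_left e2 (by positivity)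
      _ ≤ _ := e1
  have h4 : 1 / v ≤ beta γ (y + 1) := by
    rw [beta_eq]
    have e1 : 4 / v = 4 * (1 / v) := by ring
    have e2 : 1 ≤ 1 / v := by rw [le_div_iff₀ hv]; linarith
    linarith
  have h5 := h.le_drift hv (by linarith) le_rfl (by linarith : 0 ≤ y + 1) h4
  have h6 := h.slabTail_pos_bound (y + 1)
  have h7 := h.g_lip y (y + 1)
  rw [show y - (y + 1) = -1 by ring, abs_neg, abs_one, mul_one] at h7
  have h8 : slabMarginal γ y ≤ 4 * Real.exp (2 * Λ) * drift γ v := by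
    have e0 : Real.exp (2 * Λ) = Real.exp Λ * Real.exp Λ := by rw [← Real.exp_add]; ring_nf
    have e1 : Real.exp Λ * Real.exp (-Λ) = 1 := by rw [← Real.exp_add]; simp
    have e2 := Real.exp_pos Λ
    calc slabMarginal γ y ≤ slabMarginal γ (y + 1) * Real.exp Λ := h7
      _ = Real.exp Λ * Real.exp Λ * (Real.exp (-Λ) * slabMarginal γ (y + 1)) := by
          linear_combination (-(slabMarginal γ (y + 1)) * Real.exp Λ) * e1
      _ ≤ Real.exp Λ * Real.exp Λ * (4 * drift γ v) := by
          refine mul_le_mul_of_nonneg_left ?_ (by positivity)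
          norm_num at h5
          linarith
      _ = _ := by rw [e0]; ring
  have hd := h.drift_nonneg hv (by linarith)
  calc nullTail y ≤ 2 * (slabMarginal γ y * (2 * v / k) / y) := by rw [← h2]; exact h1
    _ ≤ 2 * (4 * Real.exp (2 * Λ) * drift γ v * (2 * v / k) / y) := by gcongr
    _ = C / y * (v * drift γ v) := by rw [hC]; field_simp; ring
    _ ≤ ε * (v * drift γ v) := by
        refine mul_le_mul_of_nonneg_right ?_ (by positivity)
        rw [div_le_iff₀ hε] at hyC
        rw [div_le_iff₀ hy0]; linarith

end Slab

/-- The derivative of the marginal log-likelihood in the weight. -/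
noncomputable def likScore (γ : ℝ → ℝ) {n : ℕ} (X : Fin n → ℝ) (w : ℝ) : ℝ :=
  ∑ i, score γ w (X i)

namespace Slab

variable {γ : ℝ → ℝ} {Λ T : ℝ} {n : ℕ}

/-! ### The marginal maximum likelihood estimator -/

/-- The tangent inequality for the concave function L, summand by summand from log x ≤ x - 1. -/
lemma logLik_sub_le (h : Slab γ Λ T) (X : Fin n → ℝ) {w w' : ℝ} (h0 : 0 ≤ w) (h1 : w ≤ 1)
    (h0' : 0 ≤ w') (h1' : w' ≤ 1) :
    logLik γ X w' - logLik γ X w ≤ (w' - w) * likScore γ X w := by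
  rw [logLik, logLik, add_sub_add_left_eq_sub, ← Finset.sum_sub_distrib, likScore,
    Finset.mul_sum]
  refine Finset.sum_le_sum fun i _ => ?_
  have hp := h.one_add_pos h0 h1 (X i)
  have hp' := h.one_add_pos h0' h1' (X i)
  rw [← Real.log_div hp'.ne' hp.ne']
  refine (Real.log_le_sub_one_of_pos (div_pos hp' hp)).trans (le_of_eq ?_)
  rw [score, div_sub_one hp.ne', mul_div_assoc']
  ring

lemma continuousOn_logLik (h : Slab γ Λ T) (X : Fin n → ℝ) :
    ContinuousOn (logLik γ X) (Icc 0 1) := by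
  unfold logLik
  refine continuousOn_const.add (continuousOn_finsetSum _ fun i _ => ?_)
  exact ContinuousOn.log (by fun_prop) fun w hw => (h.one_add_pos hw.1 hw.2 _).ne'

lemma continuousOn_likScore (h : Slab γ Λ T) (X : Fin n → ℝ) :
    ContinuousOn (likScore γ X) (Icc 0 1) := by
  unfold likScore
  refine continuousOn_finsetSum _ fun i _ => ?_
  exact continuousOn_const.div (by fun_prop) fun w hw => (h.one_add_pos hw.1 hw.2 _).ne'

lemma one_div_natCast_mem (hn : 0 < n) : 0 < 1 / (n : ℝ) ∧ 1 / (n : ℝ) ≤ 1 := by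
  have : (1 : ℝ) ≤ n := by exact_mod_cast hn
  exact ⟨by positivity, by rw [div_le_one (by linarith)]; exact this⟩

lemma bddAbove_maximisers (X : Fin n → ℝ) :
    BddAbove {w | w ∈ Icc (1 / (n : ℝ)) 1 ∧ IsMaxOn (logLik γ X) (Icc (1 / (n : ℝ)) 1) w} :=
  ⟨1, fun _ hw => hw.1.2⟩

lemma exists_maximiser (h : Slab γ Λ T) (X : Fin n → ℝ) {c : ℝ} (h0 : 0 ≤ c) (h1 : c ≤ 1) :
    ∃ w ∈ Icc c 1, ∀ w' ∈ Icc c 1, logLik γ X w' ≤ logLik γ X w := by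
  obtain ⟨w, hw, hmax⟩ := isCompact_Icc.exists_isMaxOn (nonempty_Icc.2 h1)
    ((h.continuousOn_logLik X).mono (Icc_subset_Icc_left h0))
  exact ⟨w, hw, fun w' hw' => hmax hw'⟩

lemma wHat_mem (h : Slab γ Λ T) (hn : 0 < n) (X : Fin n → ℝ) :
    wHat γ X ∈ Icc (1 / (n : ℝ)) 1 := by
  obtain ⟨hn0, hn1⟩ := one_div_natCast_mem hn
  obtain ⟨w, hw, hmax⟩ := h.exists_maximiser X hn0.le hn1
  have hmem : w ∈ {w | w ∈ Icc (1 / (n : ℝ)) 1 ∧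
      IsMaxOn (logLik γ X) (Icc (1 / (n : ℝ)) 1) w} := ⟨hw, hmax⟩
  exact ⟨hw.1.trans (le_csSup (bddAbove_maximisers X) hmem),
    csSup_le ⟨w, hmem⟩ fun w' hw' => hw'.1.2⟩

/-- The estimator exceeds a level if and only if the score is nonnegative there. -/
lemma le_wHat_iff (h : Slab γ Λ T) (hn : 0 < n) (X : Fin n → ℝ) {c : ℝ} (hc : 1 / (n : ℝ) < c)
    (hc1 : c ≤ 1) : c ≤ wHat γ X ↔ 0 ≤ likScore γ X c := by
  obtain ⟨hn0, hn1⟩ := one_div_natCast_mem hn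
  have hc0 : 0 < c := hn0.trans hc
  constructor
  · intro hle
    -- The tangent bound at c does not exclude a maximiser at c itself, so it is applied at some c'
    -- < c where, by continuity, the score is still negative.
    by_contra! hneg
    have hcont := (h.continuousOn_likScore X) c ⟨hc0.le, hc1⟩
    have hev : ∀ᶠ w in 𝓝[Icc 0 1] c, likScore γ X w < 0 := hcont.eventually_lt_const hneg
    have hle' : 𝓝[Ioo (1 / (n : ℝ)) c] c ≤ 𝓝[Icc 0 1] c :=
      nhdsWithin_mono _ fun w hw => ⟨(hn0.trans hw.1).le, hw.2.le.trans hc1⟩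
    have : (𝓝[Ioo (1 / (n : ℝ)) c] c).NeBot := right_nhdsWithin_Ioo_neBot hc
    have hev' : ∀ᶠ w in 𝓝[Ioo (1 / (n : ℝ)) c] c, likScore γ X w < 0 := hle' hev
    obtain ⟨c', hc'neg, hc'⟩ := (hev'.and self_mem_nhdsWithin).exists
    have hc'0 : 0 < c' := hn0.trans hc'.1
    have hub : wHat γ X ≤ c' := by
      obtain ⟨w, hw, hmax⟩ := h.exists_maximiser X hn0.le hn1
      refine csSup_le ⟨w, hw, hmax⟩ fun w' hw' => ?_
      by_contra! hlt
      have h1 := h.logLik_sub_le X hc'0.le (hc'.2.le.trans hc1) (hn0.le.trans hw'.1.1) hw'.1.2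
      have h2 : logLik γ X c' ≤ logLik γ X w' := hw'.2 ⟨hc'.1.le, hc'.2.le.trans hc1⟩
      nlinarith
    linarith [hc'.2]
  · intro hS
    -- A maximiser over [c, 1] is global: by the tangent bound at c, no point on the left of c does
    -- better than c.
    obtain ⟨w, hw, hmax⟩ := h.exists_maximiser X hc0.le hc1
    refine hw.1.trans (le_csSup (bddAbove_maximisers X) ⟨⟨hc.le.trans hw.1, hw.2⟩, ?_⟩)
    intro w' hw'
    rcases le_total c w' with hcw | hcw
    · exact hmax w' ⟨hcw, hw'.2⟩
    · have h1 := h.logLik_sub_le X hc0.le hc1 (hn0.le.trans hw'.1) hw'.2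
      have h2 : logLik γ X c ≤ logLik γ X w := hmax c ⟨le_rfl, hc1⟩
      show logLik γ X w' ≤ logLik γ X w
      nlinarith

lemma measurable_likScore (h : Slab γ Λ T) {w : ℝ} (h0 : 0 ≤ w) (h1 : w ≤ 1) :
    Measurable (fun X : Fin n → ℝ => likScore γ X w) :=
  Finset.measurable_fun_sum _ fun i _ =>
    (h.continuous_score h0 h1).measurable.comp (measurable_pi_apply i)

lemma measurable_wHat (h : Slab γ Λ T) (hn : 0 < n) :
    Measurable (fun X : Fin n → ℝ => wHat γ X) := by
  obtain ⟨hn0, hn1⟩ := one_div_natCast_mem hn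
  refine measurable_of_Ici fun c => ?_
  rcases le_or_gt c (1 / (n : ℝ)) with hc | hc
  · have : (fun X : Fin n → ℝ => wHat γ X) ⁻¹' Ici c = univ :=
      eq_univ_of_forall fun X => hc.trans (h.wHat_mem hn X).1
    rw [this]; exact MeasurableSet.univ
  rcases le_or_gt c 1 with hc1 | hc1
  · have : (fun X : Fin n → ℝ => wHat γ X) ⁻¹' Ici c = {X | 0 ≤ likScore γ X c} := by
      ext X; exact h.le_wHat_iff hn X hc hc1
    rw [this]
    exact measurableSet_le measurable_const (h.measurable_likScore (hn0.trans hc).le hc1)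
  · have : (fun X : Fin n → ℝ => wHat γ X) ⁻¹' Ici c = ∅ :=
      eq_empty_of_forall_notMem fun X hX => absurd (hX.trans (h.wHat_mem hn X).2) (not_le.2 hc1)
    rw [this]; exact MeasurableSet.empty

/-! ### The `ℓ`-values and `q`-values -/

lemma ellValue_eq (γ : ℝ → ℝ) (w x : ℝ) :
    ellValue γ w x = (1 - w) / ((1 - w) + w * lr γ x) := by
  rw [ellValue, ← lr_mul_phi, ← mul_assoc, ← add_mul, mul_div_mul_right _ _ (phi_pos x).ne']

lemma denom_pos {w L : ℝ} (h0 : 0 < w) (h1 : w ≤ 1) (hL : 0 < L) : 0 < (1 - w) + w * L := by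
  nlinarith [mul_pos h0 hL]

lemma ellValue_le_iff (h : Slab γ Λ T) {w t : ℝ} (h0 : 0 < w) (h1 : w ≤ 1) (x : ℝ) :
    ellValue γ w x ≤ t ↔ (1 - w) * (1 - t) ≤ t * (w * lr γ x) := by
  rw [ellValue_eq, div_le_iff₀ (denom_pos h0 h1 (h.lr_pos x))]
  constructor <;> intro hh <;> linarith

lemma nullTail_pos (y : ℝ) : 0 < nullTail y := by
  have hsub : Ici |y| ⊆ {x | y ≤ |x|} := fun x hx =>
    (le_abs_self y).trans ((show |y| ≤ x from hx).trans (le_abs_self x))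
  rw [nullTail, setIntegral_pos_iff_support_of_nonneg_ae
    (ae_of_all _ fun x => (phi_pos x).le) integrable_phi.integrableOn]
  have : Function.support phi = univ := by ext u; simp [(phi_pos u).ne']
  rw [this, univ_inter]
  refine lt_of_lt_of_le ?_ (measure_mono hsub)
  simp

lemma slabTail_pos (h : Slab γ Λ T) (y : ℝ) : 0 < slabTail γ y :=
  (mul_pos (Real.exp_pos _) (h.g_pos y)).trans_le (h.slabTail_pos_bound y)

lemma drift_pos (h : Slab γ Λ T) {w : ℝ} (h0 : 0 < w) (h1 : w ≤ 1 / 2) : 0 < drift γ w := by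
  obtain ⟨y, hy0, hy⟩ :=
    ((eventually_ge_atTop 0).and (h.tendsto_lr.eventually_ge_atTop (1 / w + 1))).exists
  refine lt_of_lt_of_le ?_ (h.le_drift h0 h1 le_rfl hy0 (by rw [beta_eq]; linarith))
  have := h.slabTail_pos y
  positivity

lemma lintegral_slabMarginal (h : Slab γ Λ T) (y : ℝ) :
    ∫⁻ u, ENNReal.ofReal (γ u) * gaussianReal u 1 {x | y ≤ |x|} =
      ENNReal.ofReal (slabTail γ y) := by
  have hA := measurableSet_tail y
  have hm : Measurable (Function.uncurry fun u x : ℝ =>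
      ENNReal.ofReal (γ u) * ENNReal.ofReal (phi (x - u))) := by
    have h1 := h.continuous
    have h2 := continuous_phi
    exact Continuous.measurable (by
      unfold Function.uncurry
      exact ENNReal.continuous_ofReal.comp (h1.comp continuous_fst) |>.ennreal_mul
        (ENNReal.continuous_ofReal.comp (h2.comp (continuous_snd.sub continuous_fst)))
        (by simp) (by simp))
  calc ∫⁻ u, ENNReal.ofReal (γ u) * gaussianReal u 1 {x | y ≤ |x|}
      = ∫⁻ u, ∫⁻ x in {x | y ≤ |x|}, ENNReal.ofReal (γ u) * ENNReal.ofReal (phi (x - u)) := by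
        refine lintegral_congr fun u => ?_
        rw [gaussianReal_eq_withDensity, withDensity_apply _ hA, lintegral_const_mul]
        exact ENNReal.measurable_ofReal.comp (continuous_phi.measurable.comp (by fun_prop))
    _ = ∫⁻ x in {x | y ≤ |x|}, ∫⁻ u, ENNReal.ofReal (γ u) * ENNReal.ofReal (phi (x - u)) :=
        lintegral_lintegral_swap hm.aemeasurable
    _ = ∫⁻ x in {x | y ≤ |x|}, ENNReal.ofReal (slabMarginal γ x) := by
        refine lintegral_congr fun x => ?_
        rw [g_eq', ofReal_integral_eq_lintegral_ofReal]
        · exact lintegral_congr fun u => (ENNReal.ofReal_mul (h.pos u).le).symm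
        · have := (h.integrable_conv x).comp_sub_left x
          simpa using this
        · exact ae_of_all _ fun u => (mul_pos (h.pos u) (phi_pos _)).le
    _ = ENNReal.ofReal (slabTail γ y) := by
        rw [slabTail, ofReal_integral_eq_lintegral_ofReal h.integrable_g.integrableOn
          (ae_of_all _ fun x => (h.g_pos x).le)]

lemma lintegral_prior (h : Slab γ Λ T) (w : ℝ) {F : ℝ → ENNReal} (hF : Measurable F) :
    ∫⁻ u, F u ∂(prior γ w) =
      ENNReal.ofReal (1 - w) * F 0 + ENNReal.ofReal w * ∫⁻ u, ENNReal.ofReal (γ u) * F u := by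
  rw [prior, lintegral_add_measure, lintegral_smul_measure, lintegral_smul_measure,
    lintegral_dirac, lintegral_withDensity_eq_lintegral_mul _
      (show Measurable fun u => ENNReal.ofReal (γ u) from
        ENNReal.measurable_ofReal.comp h.continuous.measurable) hF]
  rfl

lemma measurable_gaussianReal_apply {A : Set ℝ} (hA : MeasurableSet A) :
    Measurable (fun u : ℝ => gaussianReal u 1 A) := by
  have : (fun u : ℝ => gaussianReal u 1 A) = fun u =>
      gaussianReal 0 1 (Prod.mk u ⁻¹' ((fun p : ℝ × ℝ => p.1 + p.2) ⁻¹' A)) := by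
    ext u
    have h1 := gaussianReal_map_const_add (μ := 0) (v := 1) u
    rw [zero_add] at h1
    rw [← h1, Measure.map_apply (by fun_prop) hA]
    rfl
  rw [this]
  exact measurable_measure_prodMk_left ((by fun_prop : Measurable fun p : ℝ × ℝ => p.1 + p.2) hA)

/-- For a tail A, the choices B = ℝ and B = {0} give the denominator and the numerator of the
q-value. -/
lemma bayesLaw_apply (h : Slab γ Λ T) (w : ℝ) {A B : Set ℝ} (hA : MeasurableSet A)
    (hB : MeasurableSet B) :
    bayesLaw γ w {p | p.1 ∈ B ∧ p.2 ∈ A} =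
      ENNReal.ofReal (1 - w) * B.indicator (fun u => gaussianReal u 1 A) 0 +
      ENNReal.ofReal w *
        ∫⁻ u, ENNReal.ofReal (γ u) * B.indicator (fun u => gaussianReal u 1 A) u := by
  rw [← h.lintegral_prior w ((measurable_gaussianReal_apply hA).indicator hB)]
  have hmeas : Measurable fun p : ℝ × ℝ => (p.1, p.1 + p.2) := by fun_prop
  have hS : MeasurableSet {p : ℝ × ℝ | p.1 ∈ B ∧ p.2 ∈ A} :=
    (measurable_fst hB).inter (measurable_snd hA)
  rw [bayesLaw, Measure.map_apply hmeas hS, Measure.prod_apply (hmeas hS)]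
  refine lintegral_congr fun u => ?_
  by_cases hu : u ∈ B
  · rw [indicator_of_mem hu]
    have h1 := gaussianReal_map_const_add (μ := 0) (v := 1) u
    rw [zero_add] at h1
    rw [← h1, Measure.map_apply (by fun_prop) hA]
    congr 1; ext e
    simp [hu]
  · rw [indicator_of_notMem hu]
    convert measure_empty (μ := gaussianReal 0 1)
    ext e; simp [hu]

lemma qValue_eq (h : Slab γ Λ T) {w : ℝ} (h0 : 0 ≤ w) (h1 : w ≤ 1) (x : ℝ) :
    qValue γ w x = (1 - w) * nullTail |x| / ((1 - w) * nullTail |x| + w * slabTail γ |x|) := by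
  have hA := measurableSet_tail |x|
  have hN : gaussianReal 0 1 {u | |x| ≤ |u|} = ENNReal.ofReal (nullTail |x|) := by
    rw [nullTail_eq, Measure.real, ENNReal.ofReal_toReal (measure_ne_top _ _)]
  have e1 : bayesLaw γ w {p | |x| ≤ |p.2|} =
      ENNReal.ofReal ((1 - w) * nullTail |x| + w * slabTail γ |x|) := by
    have := h.bayesLaw_apply w hA MeasurableSet.univ
    simp only [mem_univ, true_and, indicator_univ, mem_ofPred_eq] at this
    rw [this, h.lintegral_slabMarginal, hN,
      ENNReal.ofReal_add (mul_nonneg (by linarith) (nullTail_pos _).le)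
        (mul_nonneg h0 (h.slabTail_pos _).le), ENNReal.ofReal_mul (by linarith),
      ENNReal.ofReal_mul h0]
  have e2 : bayesLaw γ w ({p | |x| ≤ |p.2|} ∩ {p | p.1 = 0}) =
      ENNReal.ofReal ((1 - w) * nullTail |x|) := by
    have := h.bayesLaw_apply w hA (MeasurableSet.singleton 0)
    have hset : {p : ℝ × ℝ | |x| ≤ |p.2|} ∩ {p | p.1 = 0} =
        {p | p.1 ∈ ({0} : Set ℝ) ∧ p.2 ∈ {u | |x| ≤ |u|}} := by
      ext p; simp [and_comm]
    rw [hset, this, indicator_of_mem (mem_singleton 0), hN, ENNReal.ofReal_mul (by linarith)]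
    -- The slab has a density, hence no mass at 0.
    have hz : ∫⁻ u, ENNReal.ofReal (γ u) *
        ({0} : Set ℝ).indicator (fun u => gaussianReal u 1 {u | |x| ≤ |u|}) u = 0 := by
      rw [lintegral_eq_zero_iff']
      · filter_upwards [compl_mem_ae_iff.2 (measure_singleton (μ := volume) (0 : ℝ))] with u hu
        rw [indicator_of_notMem hu]; simp
      · exact ((ENNReal.measurable_ofReal.comp h.continuous.measurable).mul
          ((measurable_gaussianReal_apply hA).indicator (MeasurableSet.singleton 0))).aemeasurable
    rw [hz]; simp
  have hS : MeasurableSet {p : ℝ × ℝ | |x| ≤ |p.2|} := measurable_snd hA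
  have hpos : 0 ≤ (1 - w) * nullTail |x| := mul_nonneg (by linarith) (nullTail_pos _).le
  have hpos' : 0 ≤ w * slabTail γ |x| := mul_nonneg h0 (h.slabTail_pos _).le
  rw [qValue, Measure.real, cond_apply hS, e1, e2, ENNReal.toReal_mul, ENNReal.toReal_inv,
    ENNReal.toReal_ofReal (by linarith), ENNReal.toReal_ofReal hpos]
  rw [div_eq_inv_mul]

lemma qValue_le_iff (h : Slab γ Λ T) {w t : ℝ} (h0 : 0 < w) (h1 : w ≤ 1) (x : ℝ) :
    qValue γ w x ≤ t ↔
      (1 - w) * (1 - t) * nullTail |x| ≤ t * (w * slabTail γ |x|) := by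
  have hN := nullTail_pos |x|
  have hG := h.slabTail_pos |x|
  have : 0 < (1 - w) * nullTail |x| + w * slabTail γ |x| := by
    have := mul_pos h0 hG
    nlinarith
  rw [h.qValue_eq h0.le h1, div_le_iff₀ this]
  constructor <;> intro hh <;> linarith

lemma nullTail_anti {x y : ℝ} (hxy : x ≤ y) : nullTail y ≤ nullTail x :=
  setIntegral_mono_set integrable_phi.integrableOn (ae_of_all _ fun x => (phi_pos x).le)
    (LE.le.eventuallyLE fun _ hu => hxy.trans hu)

lemma measurable_ellProc (h : Slab γ Λ T) (t : ℝ) (n : ℕ) : Measurable (ellProc γ t n) := by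
  rcases Nat.eq_zero_or_pos n with rfl | hn
  · exact measurable_of_subsingleton_codomain _
  refine measurable_pi_lambda _ fun i => Measurable.ite (measurableSet_le ?_ measurable_const)
    measurable_const measurable_const
  simp_rw [ellValue_eq]
  have h1 := h.measurable_wHat hn
  have h2 : Measurable fun X : Fin n → ℝ => lr γ (X i) :=
    h.continuous_lr.measurable.comp (measurable_pi_apply i)
  fun_prop

lemma measurable_qProc (h : Slab γ Λ T) (t : ℝ) (n : ℕ) : Measurable (qProc γ t n) := by
  rcases Nat.eq_zero_or_pos n with rfl | hn
  · exact measurable_of_subsingleton_codomain _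
  obtain ⟨hn0, hn1⟩ := one_div_natCast_mem hn
  refine measurable_pi_lambda _ fun i => Measurable.ite (measurableSet_le ?_ measurable_const)
    measurable_const measurable_const
  have hq : (fun X : Fin n → ℝ => qValue γ (wHat γ X) (X i)) = fun X =>
      (1 - wHat γ X) * nullTail |X i| /
        ((1 - wHat γ X) * nullTail |X i| + wHat γ X * slabTail γ |X i|) := by
    ext X
    have := h.wHat_mem hn X
    exact h.qValue_eq (hn0.le.trans this.1) this.2 _
  rw [hq]
  have h1 := h.measurable_wHat hn
  have h2 : Measurable fun X : Fin n → ℝ => |X i| :=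
    continuous_abs.measurable.comp (measurable_pi_apply i)
  have h3 : Measurable fun X : Fin n → ℝ => nullTail |X i| :=
    (show Antitone nullTail from fun _ _ hxy => nullTail_anti hxy).measurable.comp h2
  have h4 : Measurable fun X : Fin n → ℝ => slabTail γ |X i| :=
    (show Antitone (slabTail γ) from fun _ _ hxy => h.slabTail_anti hxy).measurable.comp h2
  fun_prop

end Slab

/-! ### Concentration for sums of functions of the coordinates -/

instance {n : ℕ} (θ : Fin n → ℝ) : IsProbabilityMeasure (law θ) := by
  unfold law; infer_instance

lemma measurePreserving_coord {n : ℕ} (θ : Fin n → ℝ) (i : Fin n) :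
    MeasurePreserving (fun X : Fin n → ℝ => X i) (law θ) (gaussianReal (θ i) 1) :=
  measurePreserving_eval (fun i => gaussianReal (θ i) 1) i

lemma law_real_coord {n : ℕ} (θ : Fin n → ℝ) (i : Fin n) {A : Set ℝ} (hA : MeasurableSet A) :
    (law θ).real {X | X i ∈ A} = (gaussianReal (θ i) 1).real A := by
  rw [Measure.real, Measure.real, ← (measurePreserving_coord θ i).measure_preimage
    hA.nullMeasurableSet]
  rfl

lemma law_real_exists_le {n : ℕ} (θ : Fin n → ℝ) (s : Finset (Fin n)) {A : Set ℝ}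
    (hA : MeasurableSet A) :
    (law θ).real {X | ∃ i ∈ s, X i ∈ A} ≤ ∑ i ∈ s, (gaussianReal (θ i) 1).real A := by
  have : {X : Fin n → ℝ | ∃ i ∈ s, X i ∈ A} = ⋃ i ∈ s, {X | X i ∈ A} := by ext X; simp
  rw [this]
  refine (measureReal_biUnion_finset_le _ _).trans (le_of_eq ?_)
  exact Finset.sum_congr rfl fun i _ => law_real_coord θ i hA

/-- By independence the variances add up, and each is at most a second moment. The bound `b` only
supplies square integrability and does not enter the estimate. -/
lemma law_chebyshev {n : ℕ} (θ : Fin n → ℝ) (s : Finset (Fin n)) {f : ℝ → ℝ} {b : ℝ}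
    (hf : Measurable f) (hb : ∀ x, |f x| ≤ b) {c : ℝ} (hc : 0 < c) :
    (law θ).real {X | c ≤ |∑ i ∈ s, f (X i) - ∑ i ∈ s, ∫ x, f x ∂(gaussianReal (θ i) 1)|} ≤
      (∑ i ∈ s, ∫ x, f x ^ 2 ∂(gaussianReal (θ i) 1)) / c ^ 2 := by
  classical
  set F : Fin n → ℝ → ℝ := fun i x => if i ∈ s then f x else 0
  have hLp : ∀ i, MemLp (F i) 2 (gaussianReal (θ i) 1) := by
    intro i
    by_cases hi : i ∈ s
    · simp only [F, hi, if_true]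
      exact MemLp.of_bound hf.aestronglyMeasurable b (ae_of_all _ hb)
    · simp only [F, hi, if_false]; exact MemLp.zero
  have hLp' : ∀ i, MemLp (fun X : Fin n → ℝ => F i (X i)) 2 (law θ) := fun i =>
    (hLp i).comp_measurePreserving (measurePreserving_coord θ i)
  have hsum : ∀ X : Fin n → ℝ, (∑ i, fun X : Fin n → ℝ => F i (X i)) X = ∑ i ∈ s, f (X i) := by
    intro X
    simp [F, Finset.sum_apply, Finset.sum_ite_mem]
  have hmean : ∫ X, (∑ i, fun X : Fin n → ℝ => F i (X i)) X ∂(law θ) =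
      ∑ i ∈ s, ∫ x, f x ∂(gaussianReal (θ i) 1) := by
    simp only [Finset.sum_apply]
    rw [integral_finsetSum _ fun i _ => (hLp' i).integrable (by norm_num)]
    have : ∀ i, ∫ X, F i (X i) ∂(law θ) = if i ∈ s then ∫ x, f x ∂(gaussianReal (θ i) 1) else 0 := by
      intro i
      have hmp := measurePreserving_coord θ i
      have he : ∫ x, f x ∂(gaussianReal (θ i) 1) = ∫ X, f (X i) ∂(law θ) := by
        rw [← hmp.map_eq, integral_map hmp.measurable.aemeasurable hf.aestronglyMeasurable]
      by_cases hi : i ∈ s <;> simp [F, hi, he]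
    simp_rw [this]
    simp [Finset.sum_ite_mem]
  have hvar : Var[∑ i, fun X : Fin n → ℝ => F i (X i); law θ] ≤
      ∑ i ∈ s, ∫ x, f x ^ 2 ∂(gaussianReal (θ i) 1) := by
    rw [law, variance_sum_pi hLp]
    have : ∑ i ∈ s, ∫ x, f x ^ 2 ∂(gaussianReal (θ i) 1) =
        ∑ i, if i ∈ s then ∫ x, f x ^ 2 ∂(gaussianReal (θ i) 1) else 0 := by
      simp [Finset.sum_ite_mem]
    rw [this]
    refine Finset.sum_le_sum fun i _ => ?_
    by_cases hi : i ∈ s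
    · simp only [F, hi, if_true]
      exact variance_le_expectation_sq hf.aestronglyMeasurable
    · simp only [F, hi, if_false]
      have : (fun _ : ℝ => (0 : ℝ)) = 0 := rfl
      rw [this, variance_zero]
  have hmem : MemLp (∑ i, fun X : Fin n → ℝ => F i (X i)) 2 (law θ) :=
    memLp_finsetSum' _ fun i _ => hLp' i
  have h1 := meas_ge_le_variance_div_sq hmem hc
  rw [hmean] at h1
  simp_rw [hsum] at h1
  rw [Measure.real]
  refine (ENNReal.toReal_le_of_le_ofReal (div_nonneg (variance_nonneg _ _) (sq_nonneg c)) h1).trans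
    ?_
  gcongr

/-- Passing to the measurable hull of `bad` removes any measurability requirement on the exceptional
events; F need not be integrable either. -/
lemma integral_le_add_real {Ω : Type*} [MeasurableSpace Ω] {μ : Measure Ω} [IsProbabilityMeasure μ]
    {F : Ω → ℝ} {δ : ℝ} (hδ : 0 ≤ δ) (bad : Set Ω) (h0 : ∀ ω, 0 ≤ F ω) (h1 : ∀ ω, F ω ≤ 1)
    (hgood : ∀ ω, ω ∉ bad → F ω ≤ δ) : ∫ ω, F ω ∂μ ≤ δ + μ.real bad := by
  have hm := measurableSet_toMeasurable μ bad
  have hreal : μ.real bad = μ.real (toMeasurable μ bad) := by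
    rw [Measure.real, Measure.real, measure_toMeasurable]
  rw [hreal, ← integral_indicator_one hm]
  have hint : Integrable ((toMeasurable μ bad).indicator (1 : Ω → ℝ)) μ :=
    (integrable_const (1 : ℝ)).indicator hm
  calc ∫ ω, F ω ∂μ ≤ ∫ ω, (δ + (toMeasurable μ bad).indicator (1 : Ω → ℝ) ω) ∂μ := by
        refine integral_mono_of_nonneg (ae_of_all _ h0) ((integrable_const δ).add hint)
          (ae_of_all _ fun ω => ?_)
        by_cases hω : ω ∈ toMeasurable μ bad
        · simp only [indicator_of_mem hω, Pi.one_apply]; linarith [h1 ω]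
        · simp only [indicator_of_notMem hω, add_zero]
          exact hgood ω fun hb => hω (subset_toMeasurable μ bad hb)
    _ = _ := by rw [integral_add (integrable_const δ) hint]; simp

namespace Slab

variable {γ : ℝ → ℝ} {Λ T : ℝ}

/-! ### The score of a signal -/

lemma lr_mul_phi_sub (γ : ℝ → ℝ) (x θ : ℝ) :
    lr γ x * phi (x - θ) = slabMarginal γ x * Real.exp (x * θ - θ ^ 2 / 2) := by
  rw [sub_eq_add_neg, phi_add, ← lr_mul_phi]; ring_nf

/-- The integrand is g(x) exp(xθ - θ²/2). For θ ≤ ηz the exponential is at most exp(ηz²). For θ > ηz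
the integrand is dominated by an exponential of rate θ - Λ ≥ ηz/2, so the integral is at most its
endpoint value lr(z) φ(z - θ) divided by that rate; since φ(z - θ) is at most exp(3/2) z times the
tail probability, the factors z cancel. -/
lemma integral_lr_lt_le (h : Slab γ Λ T) {η z θ : ℝ} (hη : 0 < η) (hz : 1 ≤ z)
    (hzΛ : 2 * Λ ≤ η * z) (hθ : 0 ≤ θ) :
    ∫ x in {x | |x| < z}, lr γ x * phi (x - θ) ≤ Real.exp (η * z ^ 2) +
      lr γ z * (2 * Real.exp (3 / 2) / η) * (gaussianReal θ 1).real {x | z ≤ |x|} := by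
  have hz0 : 0 < z := by linarith
  have hms : MeasurableSet {x : ℝ | |x| < z} := measurableSet_lt (by fun_prop) measurable_const
  have hlz := h.lr_pos z
  simp_rw [lr_mul_phi_sub]
  rcases le_or_gt θ (η * z) with hle | hgt
  · have h1 : ∫ x in {x | |x| < z}, slabMarginal γ x * Real.exp (x * θ - θ ^ 2 / 2) ≤
        ∫ x in {x | |x| < z}, slabMarginal γ x * Real.exp (η * z ^ 2) := by
      refine integral_mono_of_nonneg (ae_of_all _ fun x =>
        (mul_pos (h.g_pos x) (Real.exp_pos _)).le) (h.integrable_g.mul_const _).integrableOn ?_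
      filter_upwards [ae_restrict_mem hms] with x hx
      refine mul_le_mul_of_nonneg_left (Real.exp_le_exp.2 ?_) (h.g_pos x).le
      have hx' : x ≤ z := ((le_abs_self x).trans_lt hx).le
      nlinarith [mul_le_mul_of_nonneg_right hx' hθ, sq_nonneg θ]
    have h2 : ∫ x in {x | |x| < z}, slabMarginal γ x * Real.exp (η * z ^ 2) ≤
        Real.exp (η * z ^ 2) := by
      rw [integral_mul_const]
      have := setIntegral_le_integral (s := {x : ℝ | |x| < z}) h.integrable_g
        (ae_of_all _ fun x => (h.g_pos x).le)
      rw [h.integral_g] at this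
      nlinarith [Real.exp_pos (η * z ^ 2)]
    have h3 : 0 ≤ lr γ z * (2 * Real.exp (3 / 2) / η) *
        (gaussianReal θ 1).real {x | z ≤ |x|} := by positivity
    linarith
  · have hθ0 : 0 < θ := lt_trans (by positivity) hgt
    have hΛ := h.one_le
    have hθΛ : 2 * Λ < θ := by linarith
    have hI : IntegrableOn (fun x => slabMarginal γ z * Real.exp (Λ * z - θ ^ 2 / 2) *
        Real.exp ((θ - Λ) * x)) (Iic z) :=
      (integrableOn_exp_mul_Iic (by linarith) z).const_mul _
    have h1 : ∫ x in {x | |x| < z}, slabMarginal γ x * Real.exp (x * θ - θ ^ 2 / 2) ≤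
        ∫ x in Iic z, slabMarginal γ z * Real.exp (Λ * z - θ ^ 2 / 2) *
          Real.exp ((θ - Λ) * x) := by
      refine le_trans ?_ (setIntegral_mono_set (s := {x : ℝ | |x| < z}) hI
        (ae_of_all _ fun x => by have := h.g_pos z; positivity)
        (LE.le.eventuallyLE fun x hx => ((le_abs_self x).trans_lt hx).le))
      refine integral_mono_of_nonneg (ae_of_all _ fun x =>
        (mul_pos (h.g_pos x) (Real.exp_pos _)).le)
        (hI.mono_set fun x hx => ((le_abs_self x).trans_lt hx).le) ?_
      filter_upwards [ae_restrict_mem hms] with x hx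
      have hx' : x ≤ z := ((le_abs_self x).trans_lt hx).le
      have h2 := h.g_lip x z
      rw [abs_sub_comm, abs_of_nonneg (by linarith : 0 ≤ z - x)] at h2
      calc slabMarginal γ x * Real.exp (x * θ - θ ^ 2 / 2)
          ≤ slabMarginal γ z * Real.exp (Λ * (z - x)) * Real.exp (x * θ - θ ^ 2 / 2) :=
            mul_le_mul_of_nonneg_right h2 (Real.exp_pos _).le
        _ = slabMarginal γ z * Real.exp (Λ * z - θ ^ 2 / 2) * Real.exp ((θ - Λ) * x) := by
            rw [mul_assoc, mul_assoc, ← Real.exp_add, ← Real.exp_add]; ring_nf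
    have h2 : ∫ x in Iic z, slabMarginal γ z * Real.exp (Λ * z - θ ^ 2 / 2) *
          Real.exp ((θ - Λ) * x) = lr γ z * phi (z - θ) / (θ - Λ) := by
      rw [integral_const_mul, integral_exp_mul_Iic (by linarith), lr_mul_phi_sub,
        mul_div_assoc', mul_assoc, ← Real.exp_add]
      ring_nf
    have h3 := le_gaussianReal_tail hz hθ
    rw [div_le_iff₀ hz0] at h3
    set P := (gaussianReal θ 1).real {x | z ≤ |x|}
    have hP : 0 ≤ P := measureReal_nonneg
    have h4 : phi (z - θ) ≤ Real.exp (3 / 2) * (P * z) := by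
      calc phi (z - θ) = Real.exp (3 / 2) * (Real.exp (-(3 / 2)) * phi (z - θ)) := by
            rw [← mul_assoc, ← Real.exp_add]; simp
        _ ≤ _ := mul_le_mul_of_nonneg_left h3 (Real.exp_pos _).le
    have h5 : 1 / (θ - Λ) ≤ 2 / (η * z) := by
      rw [div_le_div_iff₀ (by linarith) (by positivity)]
      linarith
    have h6 : lr γ z * phi (z - θ) / (θ - Λ) ≤ lr γ z * (2 * Real.exp (3 / 2) / η) * P := by
      calc lr γ z * phi (z - θ) / (θ - Λ) = lr γ z * phi (z - θ) * (1 / (θ - Λ)) := by ring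
        _ ≤ lr γ z * (Real.exp (3 / 2) * (P * z)) * (2 / (η * z)) := by
            refine mul_le_mul (mul_le_mul_of_nonneg_left h4 hlz.le) h5 ?_ (by positivity)
            exact div_nonneg zero_le_one (by linarith)
        _ = _ := by field_simp
    have := Real.exp_pos (η * z ^ 2)
    linarith

lemma gaussianReal_tail_neg (θ z : ℝ) :
    (gaussianReal (-θ) 1).real {x | z ≤ |x|} = (gaussianReal θ 1).real {x | z ≤ |x|} := by
  rw [← gaussianReal_map_neg, map_measureReal_apply (by fun_prop) (measurableSet_tail z)]
  simp

lemma integral_even_neg {f : ℝ → ℝ} (hf : ∀ x, f (-x) = f x) (hc : Measurable f) (θ : ℝ) :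
    ∫ x, f x ∂(gaussianReal (-θ) 1) = ∫ x, f x ∂(gaussianReal θ 1) := by
  rw [← gaussianReal_map_neg, integral_map (by fun_prop) hc.aestronglyMeasurable]
  simp [hf]

/-- The positive part of the score of one signal is controlled by its rejection probability. -/
lemma integral_score_pos_le (h : Slab γ Λ T) {η z v K : ℝ} (hη : 0 < η) (hz : 1 ≤ z)
    (hzΛ : 2 * Λ ≤ η * z) (hv : 0 < v) (hv1 : v ≤ 1 / 2) (hK : 1 ≤ K) (hzK : lr γ z = K / v)
    (θ : ℝ) :
    ∫ x, max 0 (score γ v x) ∂(gaussianReal θ 1) ≤ Real.exp (η * z ^ 2) +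
      K * (1 + 2 * Real.exp (3 / 2) / η) / v * (gaussianReal θ 1).real {x | z ≤ |x|} := by
  have hcont : Continuous fun x => max 0 (score γ v x) :=
    continuous_const.max (h.continuous_score hv.le (by linarith))
  wlog hθ : 0 ≤ θ generalizing θ with H
  · have h1 := H (-θ) (by linarith)
    rw [gaussianReal_tail_neg, integral_even_neg _ hcont.measurable] at h1
    · exact h1
    · intro x; simp only [score, beta_eq, h.lr_neg]
  have hms : MeasurableSet {x : ℝ | |x| < z} := measurableSet_lt (by fun_prop) measurable_const
  have hcompl : {x : ℝ | |x| < z}ᶜ = {x | z ≤ |x|} := by ext x; simp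
  have hbd : ∀ x, max 0 (score γ v x) ≤ 1 / v := fun x =>
    max_le (by positivity) (h.score_le_inv hv (by linarith) x)
  have hint : Integrable (fun x => max 0 (score γ v x)) (gaussianReal θ 1) :=
    Integrable.of_bound hcont.aestronglyMeasurable (1 / v) (ae_of_all _ fun x => by
      rw [Real.norm_of_nonneg (le_max_left _ _)]; exact hbd x)
  have hint' := (integrable_gaussianReal_iff θ _).1 hint
  have hphi : Integrable (fun x => phi (x - θ)) := integrable_phi.comp_sub_right θ
  rw [integral_gaussianReal, ← integral_add_compl hms hint', hcompl]
  -- The score is bounded by lr below the threshold z and by 1/v beyond it.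
  have hA : ∫ x in {x | |x| < z}, max 0 (score γ v x) * phi (x - θ) ≤
      ∫ x in {x | |x| < z}, lr γ x * phi (x - θ) := by
    refine integral_mono_of_nonneg (ae_of_all _ fun x =>
      mul_nonneg (le_max_left _ _) (phi_pos _).le) ?_ (ae_of_all _ fun x => ?_)
    · have : IntegrableOn (fun x => lr γ x * phi (x - θ)) (Icc (-z) z) :=
        (h.continuous_lr.mul (continuous_phi.comp (by fun_prop))).continuousOn.integrableOn_Icc
      exact this.mono_set fun x hx => abs_le.1 (show |x| < z from hx).le
    · exact mul_le_mul_of_nonneg_right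
        (max_le (h.lr_pos x).le (h.score_le_lr hv.le (by linarith) x)) (phi_pos _).le
  have hB : ∫ x in {x | z ≤ |x|}, max 0 (score γ v x) * phi (x - θ) ≤
      K / v * (gaussianReal θ 1).real {x | z ≤ |x|} := by
    rw [gaussianReal_real_eq_integral θ (measurableSet_tail z), ← integral_const_mul]
    refine integral_mono hint'.integrableOn (hphi.const_mul _).integrableOn fun x => ?_
    refine mul_le_mul_of_nonneg_right ((hbd x).trans ?_) (phi_pos _).le
    gcongr
  have hC := h.integral_lr_lt_le hη hz hzΛ hθ
  rw [hzK] at hC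
  calc _ ≤ _ := add_le_add (hA.trans hC) hB
    _ = _ := by ring

/-- The drift decays slower than every power of the weight. -/
lemma exists_exp_sq_le (h : Slab γ Λ T) {η K : ℝ} (hη : 0 < η) (hK : 2 ≤ K) :
    ∃ C, 0 < C ∧ ∀ v z, 0 < v → v ≤ 1 / 2 → 0 ≤ z → lr γ z = K / v →
      Real.exp (η * z ^ 2) ≤ C * (1 / v) ^ (8 * η) * drift γ v := by
  have hg0 := h.g_pos 0
  have hΛ := h.one_le
  set A := Real.exp (Λ ^ 2) * K / slabMarginal γ 0 with hA
  have hApos : 0 < A := by positivity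
  refine ⟨4 * Real.exp Λ / slabMarginal γ 0 * Real.exp (Λ ^ 2 / (4 * η)) * A ^ (8 * η),
    by positivity, fun v z hv hv1 hz hzK => ?_⟩
  -- From `le_lr`, since z²/2 - Λz ≥ z²/4 - Λ². Raising to the power 8η yields the factor
  -- (1/v)^(8η).
  have h1 : Real.exp (z ^ 2 / 4) ≤ A * (1 / v) := by
    have e1 := h.le_lr z
    rw [hzK, abs_of_nonneg hz] at e1
    have e2 : Real.exp (z ^ 2 / 4) ≤ Real.exp (Λ ^ 2) * Real.exp (z ^ 2 / 2 - Λ * z) := by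
      rw [← Real.exp_add]
      exact Real.exp_le_exp.2 (by nlinarith [sq_nonneg (z / 2 - Λ)])
    have e3 : Real.exp (z ^ 2 / 2 - Λ * z) ≤ K / v / slabMarginal γ 0 := by
      rw [le_div_iff₀ hg0]; linarith
    calc _ ≤ Real.exp (Λ ^ 2) * (K / v / slabMarginal γ 0) :=
          e2.trans (mul_le_mul_of_nonneg_left e3 (Real.exp_pos _).le)
      _ = _ := by rw [hA]; field_simp
  have h2 : Real.exp (2 * η * z ^ 2) ≤ A ^ (8 * η) * (1 / v) ^ (8 * η) := by
    rw [← Real.mul_rpow hApos.le (by positivity)]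
    calc Real.exp (2 * η * z ^ 2) = Real.exp (z ^ 2 / 4) ^ (8 * η) := by
          rw [← Real.exp_mul]; ring_nf
      _ ≤ _ := Real.rpow_le_rpow (Real.exp_pos _).le h1 (by positivity)
  have h3 : slabMarginal γ 0 * Real.exp (-(Λ * z)) ≤ 4 * Real.exp Λ * drift γ v := by
    have e1 : 1 / v ≤ beta γ z := by
      rw [beta_eq, hzK]
      have : 1 ≤ 1 / v := by rw [le_div_iff₀ hv]; linarith
      have : 2 / v ≤ K / v := by gcongr
      have : 2 / v = 2 * (1 / v) := by ring
      linarith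
    have e2 := h.le_drift hv hv1 le_rfl hz e1
    have e3 := h.slabTail_pos_bound z
    have e4 := h.g_lip 0 z
    rw [zero_sub, abs_neg, abs_of_nonneg hz] at e4
    norm_num at e2
    have e5 : Real.exp Λ * Real.exp (-Λ) = 1 := by rw [← Real.exp_add]; simp
    have e6 : Real.exp (Λ * z) * Real.exp (-(Λ * z)) = 1 := by rw [← Real.exp_add]; simp
    calc slabMarginal γ 0 * Real.exp (-(Λ * z))
        ≤ slabMarginal γ z * Real.exp (Λ * z) * Real.exp (-(Λ * z)) :=
          mul_le_mul_of_nonneg_right e4 (Real.exp_pos _).le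
      _ = Real.exp Λ * (Real.exp (-Λ) * slabMarginal γ z) := by
          rw [mul_assoc, e6, ← mul_assoc, e5]; ring
      _ ≤ Real.exp Λ * (4 * drift γ v) := by
          refine mul_le_mul_of_nonneg_left ?_ (Real.exp_pos _).le
          linarith
      _ = _ := by ring
  -- Completing the square: the surplus exp(ηz²) pays for the factor exp(-Λz) that bounds the drift
  -- from below.
  have h4 : Real.exp (η * z ^ 2) ≤
      Real.exp (2 * η * z ^ 2) * Real.exp (Λ ^ 2 / (4 * η)) * Real.exp (-(Λ * z)) := by
    rw [← Real.exp_add, ← Real.exp_add]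
    refine Real.exp_le_exp.2 ?_
    have : Λ ^ 2 / (4 * η) - Λ * z + η * z ^ 2 = (2 * η * z - Λ) ^ 2 / (4 * η) := by
      field_simp; ring
    have : 0 ≤ (2 * η * z - Λ) ^ 2 / (4 * η) := by positivity
    linarith
  have h5 : Real.exp (-(Λ * z)) ≤ 4 * Real.exp Λ / slabMarginal γ 0 * drift γ v := by
    rw [div_mul_eq_mul_div, le_div_iff₀ hg0]; linarith
  have hd := h.drift_nonneg hv hv1
  calc Real.exp (η * z ^ 2) ≤ A ^ (8 * η) * (1 / v) ^ (8 * η) * Real.exp (Λ ^ 2 / (4 * η)) *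
        (4 * Real.exp Λ / slabMarginal γ 0 * drift γ v) := by
        refine h4.trans (mul_le_mul ?_ h5 (Real.exp_pos _).le (by positivity))
        exact mul_le_mul_of_nonneg_right h2 (Real.exp_pos _).le
    _ = _ := by ring

end Slab

/-! ### Nulls, signals, false discovery proportion and exceedance counts -/

open scoped Classical in
/-- The null coordinates of `θ`. -/
noncomputable def nulls {n : ℕ} (θ : Fin n → ℝ) : Finset (Fin n) := {i | θ i = 0}

open scoped Classical in
/-- The nonzero coordinates of `θ`. -/
noncomputable def signals {n : ℕ} (θ : Fin n → ℝ) : Finset (Fin n) := {i | θ i ≠ 0}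

lemma mem_nulls {n : ℕ} {θ : Fin n → ℝ} {i : Fin n} : i ∈ nulls θ ↔ θ i = 0 := by
  simp [nulls]

lemma mem_signals {n : ℕ} {θ : Fin n → ℝ} {i : Fin n} : i ∈ signals θ ↔ θ i ≠ 0 := by
  simp [signals]

lemma card_signals {n : ℕ} (θ : Fin n → ℝ) : (signals θ).card = numNonzero θ := by
  classical
  rw [numNonzero, ncard_eq_toFinset_card']
  congr 1; ext i; simp [signals]

lemma sum_nulls_add_sum_signals {n : ℕ} (θ : Fin n → ℝ) (f : Fin n → ℝ) :
    ∑ i ∈ nulls θ, f i + ∑ i ∈ signals θ, f i = ∑ i, f i := by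
  classical
  exact Finset.sum_filter_add_sum_filter_not _ _ _

lemma card_nulls_add {n : ℕ} (θ : Fin n → ℝ) :
    ((nulls θ).card : ℝ) + (signals θ).card = n := by
  have := sum_nulls_add_sum_signals θ (fun _ => (1 : ℝ))
  simpa using this

/-- The false discovery proportion. -/
noncomputable def fdp {n : ℕ} (θ : Fin n → ℝ) (ψ : Fin n → ℝ) : ℝ :=
  (∑ i ∈ nulls θ, ψ i) / max 1 (∑ i, ψ i)

lemma FDR_eq {n : ℕ} (θ : Fin n → ℝ) (ψ : (Fin n → ℝ) → Fin n → ℝ) :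
    FDR θ ψ = ∫ X, fdp θ (ψ X) ∂(law θ) := by
  rw [FDR]
  congr 1; ext X
  rw [fdp, nulls, Finset.sum_filter]

lemma fdp_nonneg {n : ℕ} (θ : Fin n → ℝ) {ψ : Fin n → ℝ} (h0 : ∀ i, 0 ≤ ψ i) : 0 ≤ fdp θ ψ :=
  div_nonneg (Finset.sum_nonneg fun i _ => h0 i) (zero_le_one.trans (le_max_left _ _))

lemma fdp_le_one {n : ℕ} (θ : Fin n → ℝ) {ψ : Fin n → ℝ} (h0 : ∀ i, 0 ≤ ψ i) : fdp θ ψ ≤ 1 := by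
  rw [fdp, div_le_one (zero_lt_one.trans_le (le_max_left _ _))]
  exact (Finset.sum_le_sum_of_subset_of_nonneg (Finset.subset_univ _)
    fun i _ _ => h0 i).trans (le_max_right _ _)

lemma ellProc_nonneg (γ : ℝ → ℝ) (t : ℝ) {n : ℕ} (X : Fin n → ℝ) (i : Fin n) :
    0 ≤ ellProc γ t n X i := by
  unfold ellProc; split_ifs <;> norm_num

lemma qProc_nonneg (γ : ℝ → ℝ) (t : ℝ) {n : ℕ} (X : Fin n → ℝ) (i : Fin n) :
    0 ≤ qProc γ t n X i := by
  unfold qProc; split_ifs <;> norm_num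

/-- The exceedance count of the coordinates in `s`. -/
noncomputable def exceed {n : ℕ} (s : Finset (Fin n)) (A : Set ℝ) (X : Fin n → ℝ) : ℝ :=
  ∑ i ∈ s, A.indicator (fun _ => (1 : ℝ)) (X i)

lemma exceed_le_card {n : ℕ} (s : Finset (Fin n)) (A : Set ℝ) (X : Fin n → ℝ) :
    exceed s A X ≤ s.card := by
  rw [exceed, Finset.card_eq_sum_ones, Nat.cast_sum]
  refine Finset.sum_le_sum fun i _ => ?_
  by_cases hi : X i ∈ A <;> simp [hi]

/-- Chebyshev's inequality for exceedance counts. -/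
lemma exceed_chebyshev {n : ℕ} (θ : Fin n → ℝ) (s : Finset (Fin n)) {A : Set ℝ}
    (hA : MeasurableSet A) {c : ℝ} (hc : 0 < c) :
    (law θ).real {X | c ≤ |exceed s A X - ∑ i ∈ s, (gaussianReal (θ i) 1).real A|} ≤
      (∑ i ∈ s, (gaussianReal (θ i) 1).real A) / c ^ 2 := by
  have h1 : ∀ m, ∫ x, A.indicator (fun _ => (1 : ℝ)) x ∂(gaussianReal m 1) =
      (gaussianReal m 1).real A := fun m => integral_indicator_one hA
  have h2 : ∀ x, A.indicator (fun _ => (1 : ℝ)) x ^ 2 = A.indicator (fun _ => (1 : ℝ)) x := by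
    intro x; by_cases hx : x ∈ A <;> simp [hx]
  have := law_chebyshev θ s (f := A.indicator fun _ => (1 : ℝ)) (b := 1)
    (measurable_const.indicator hA)
    (fun x => by by_cases hx : x ∈ A <;> simp [hx]) hc
  simp only [h2, h1] at this
  exact this

/-! ### Detected signals and false positives at a fixed level -/

namespace Slab

variable {γ : ℝ → ℝ} {Λ T : ℝ} {n : ℕ}

/-- If the estimator exceeds a level `v`, then with high probability the number of detected
signals is of the order of the drift at `v`. -/
lemma signal_detection (h : Slab γ Λ T) (hn : 0 < n) (θ : Fin n → ℝ) {η z v K C : ℝ}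
    (hη : 0 < η) (hz : 1 ≤ z) (hzΛ : 2 * Λ ≤ η * z) (hv : 1 / (n : ℝ) < v) (hv1 : v ≤ 1 / 2)
    (hK : 1 ≤ K) (hzK : lr γ z = K / v) (hC : C = K * (1 + 2 * Real.exp (3 / 2) / η))
    (hcard : 4 * ((signals θ).card : ℝ) ≤ n) (hd : 0 < drift γ v)
    (hsmall : (signals θ).card * Real.exp (η * z ^ 2) ≤ n * drift γ v / 8) :
    (law θ).real {X | v ≤ wHat γ X ∧
      exceed (signals θ) {x | z ≤ |x|} X < n * (v * drift γ v) / (16 * C)} ≤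
      64 * C / (n * (v * drift γ v)) := by
  have hn0 : (0 : ℝ) < n := by exact_mod_cast hn
  have hv0 : 0 < v := lt_trans (by positivity) hv
  have hC1 : 1 ≤ C := by
    have : 0 ≤ 2 * Real.exp (3 / 2) / η := by positivity
    rw [hC]; nlinarith
  set d := drift γ v with hd'
  set S := signals θ
  set N := nulls θ
  have hNn : (N.card : ℝ) ≤ n := by
    have := card_nulls_add θ
    have : (0 : ℝ) ≤ (signals θ).card := by positivity
    linarith
  have hN34 : 3 / 4 * (n : ℝ) ≤ N.card := by
    have := card_nulls_add θ; linarith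
  have hcs := h.continuous_score hv0.le (by linarith : v ≤ 1)
  -- the null part
  set E1 := {X : Fin n → ℝ | n * d / 4 ≤ |∑ i ∈ N, score γ v (X i) -
    ∑ i ∈ N, ∫ x, score γ v x ∂(gaussianReal (θ i) 1)|} with hE1
  have hmeanN : ∑ i ∈ N, ∫ x, score γ v x ∂(gaussianReal (θ i) 1) = -(N.card * d) := by
    have : ∀ i ∈ N, ∫ x, score γ v x ∂(gaussianReal (θ i) 1) = -d := by
      intro i hi
      rw [mem_nulls.1 hi, hd', drift, neg_neg]
    rw [Finset.sum_congr rfl this]; simp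
  have hP1 : (law θ).real E1 ≤ 32 / (n * (v * d)) := by
    refine (law_chebyshev θ N hcs.measurable (h.abs_score_le hv0 hv1) (by positivity)).trans ?_
    have : ∑ i ∈ N, ∫ x, score γ v x ^ 2 ∂(gaussianReal (θ i) 1) ≤ n * (2 * d / v) := by
      calc ∑ i ∈ N, ∫ x, score γ v x ^ 2 ∂(gaussianReal (θ i) 1) ≤ ∑ i ∈ N, 2 * d / v := by
            refine Finset.sum_le_sum fun i hi => ?_
            rw [mem_nulls.1 hi]; exact h.integral_score_sq_le hv0 hv1
        _ = N.card * (2 * d / v) := by simp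
        _ ≤ _ := mul_le_mul_of_nonneg_right hNn (by positivity)
    calc _ ≤ n * (2 * d / v) / (n * d / 4) ^ 2 := by gcongr
      _ = _ := by field_simp; norm_num
  have hN1 : ∀ X, X ∉ E1 → ∑ i ∈ N, score γ v (X i) ≤ -(n * d / 2) := by
    intro X hX
    simp only [hE1, mem_ofPred_eq, not_le, hmeanN] at hX
    have := (abs_lt.1 hX).2
    nlinarith [mul_le_mul_of_nonneg_right hN34 hd.le]
  have hS1 : ∀ X, X ∉ E1 → v ≤ wHat γ X →
      n * d / 2 ≤ ∑ i ∈ S, max 0 (score γ v (X i)) := by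
    intro X hX hw
    have h1 := (h.le_wHat_iff hn X hv (by linarith)).1 hw
    rw [likScore, ← sum_nulls_add_sum_signals θ] at h1
    have h2 := hN1 X hX
    have h3 : ∑ i ∈ S, score γ v (X i) ≤ ∑ i ∈ S, max 0 (score γ v (X i)) :=
      Finset.sum_le_sum fun i _ => le_max_right _ _
    linarith
  set μ := ∑ i ∈ S, (gaussianReal (θ i) 1).real {x | z ≤ |x|} with hμ
  have hμ0 : 0 ≤ μ := Finset.sum_nonneg fun i _ => measureReal_nonneg
  have hnvd : 0 < n * (v * d) := by positivity
  -- Here μ is the expected number of detected signals. If it is small, the positive signal scores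
  -- have mean at most nd/4 and cannot reach nd/2, so already ŵ ≥ v is unlikely. If it is large, the
  -- number of detected signals concentrates around μ.
  rcases le_or_gt (C / v * μ) (n * d / 8) with hcase | hcase
  · have hbd : ∀ x, max 0 (score γ v x) ≤ 1 / v := fun x =>
      max_le (by positivity) (h.score_le_inv hv0 (by linarith) x)
    have hcont : Continuous fun x => max 0 (score γ v x) := continuous_const.max hcs
    set E2 := {X : Fin n → ℝ | n * d / 4 ≤ |∑ i ∈ S, max 0 (score γ v (X i)) -
      ∑ i ∈ S, ∫ x, max 0 (score γ v x) ∂(gaussianReal (θ i) 1)|} with hE2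
    have hmean : ∑ i ∈ S, ∫ x, max 0 (score γ v x) ∂(gaussianReal (θ i) 1) ≤ n * d / 4 := by
      calc _ ≤ ∑ i ∈ S, (Real.exp (η * z ^ 2) +
            C / v * (gaussianReal (θ i) 1).real {x | z ≤ |x|}) := by
            refine Finset.sum_le_sum fun i _ => ?_
            rw [hC]
            exact h.integral_score_pos_le hη hz hzΛ hv0 hv1 hK hzK (θ i)
        _ = S.card * Real.exp (η * z ^ 2) + C / v * μ := by
            rw [Finset.sum_add_distrib, ← Finset.mul_sum, Finset.sum_const, nsmul_eq_mul]
        _ ≤ _ := by linarith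
    have hP2 : (law θ).real E2 ≤ 4 / (n * (v * d)) := by
      refine (law_chebyshev θ S hcont.measurable (b := 1 / v) (fun x => by
        rw [abs_of_nonneg (le_max_left _ _)]; exact hbd x) (by positivity)).trans ?_
      have : ∑ i ∈ S, ∫ x, max 0 (score γ v x) ^ 2 ∂(gaussianReal (θ i) 1) ≤
          1 / v * (n * d / 4) := by
        refine le_trans ?_ (mul_le_mul_of_nonneg_left hmean (by positivity))
        rw [Finset.mul_sum]
        refine Finset.sum_le_sum fun i _ => ?_
        rw [← integral_const_mul]
        refine integral_mono_of_nonneg (ae_of_all _ fun x => sq_nonneg _) ?_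
          (ae_of_all _ fun x => ?_)
        · exact (Integrable.of_bound hcont.aestronglyMeasurable (1 / v) (ae_of_all _ fun x => by
            rw [Real.norm_of_nonneg (le_max_left _ _)]; exact hbd x)).const_mul _
        · show max 0 (score γ v x) ^ 2 ≤ 1 / v * max 0 (score γ v x)
          rw [sq]; exact mul_le_mul_of_nonneg_right (hbd x) (le_max_left _ _)
      calc _ ≤ 1 / v * (n * d / 4) / (n * d / 4) ^ 2 := by gcongr
        _ = _ := by field_simp
    have hsub : {X | v ≤ wHat γ X ∧ exceed S {x | z ≤ |x|} X < n * (v * d) / (16 * C)} ⊆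
        E1 ∪ E2 := by
      rintro X ⟨hw, -⟩
      by_contra hX
      rw [mem_union, not_or] at hX
      have h1 := hS1 X hX.1 hw
      have h2 := hX.2
      simp only [hE2, mem_ofPred_eq, not_le] at h2
      linarith [(abs_lt.1 h2).2]
    calc _ ≤ (law θ).real E1 + (law θ).real E2 :=
          (measureReal_mono hsub).trans (measureReal_union_le _ _)
      _ ≤ 32 / (n * (v * d)) + 4 / (n * (v * d)) := add_le_add hP1 hP2
      _ = 36 / (n * (v * d)) := by rw [← add_div]; norm_num
      _ ≤ _ := by gcongr; linarith
  · have hμlow : n * (v * d) / (8 * C) < μ := by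
      rw [div_mul_eq_mul_div, lt_div_iff₀ hv0] at hcase
      rw [div_lt_iff₀ (by positivity)]
      nlinarith
    have hμpos : 0 < μ := lt_trans (by positivity) hμlow
    have hP3 := exceed_chebyshev θ S (measurableSet_tail z) (c := μ / 2) (by positivity)
    rw [← hμ] at hP3
    have hsub : {X | v ≤ wHat γ X ∧ exceed S {x | z ≤ |x|} X < n * (v * d) / (16 * C)} ⊆
        {X | μ / 2 ≤ |exceed S {x | z ≤ |x|} X - μ|} := by
      rintro X ⟨-, hX⟩
      have e1 : n * (v * d) / (16 * C) = n * (v * d) / (8 * C) / 2 := by field_simp; norm_num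
      rw [mem_ofPred_eq, abs_sub_comm]
      refine le_trans ?_ (le_abs_self _)
      linarith
    refine (measureReal_mono hsub).trans (hP3.trans ?_)
    calc μ / (μ / 2) ^ 2 = 4 / μ := by field_simp; norm_num
      _ ≤ 4 / (n * (v * d) / (8 * C)) := by gcongr
      _ = 32 * C / (n * (v * d)) := by field_simp; norm_num
      _ ≤ _ := by gcongr; norm_num

/-- Chebyshev bound for the number of false positives. -/
lemma null_count_le (θ : Fin n → ℝ) {A : Set ℝ} (hA : MeasurableSet A) {δ m : ℝ} (hδ : 0 < δ)
    (hδ1 : δ ≤ 1 / 2) (hm : 0 < m) (hr : n * (gaussianReal 0 1).real A ≤ δ ^ 2 * m) :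
    (law θ).real {X | δ * m < exceed (nulls θ) A X} ≤ 4 / m := by
  have hmean : ∑ i ∈ nulls θ, (gaussianReal (θ i) 1).real A ≤ δ ^ 2 * m := by
    refine le_trans ?_ hr
    calc ∑ i ∈ nulls θ, (gaussianReal (θ i) 1).real A
        = ∑ i ∈ nulls θ, (gaussianReal 0 1).real A :=
          Finset.sum_congr rfl fun i hi => by rw [mem_nulls.1 hi]
      _ = (nulls θ).card * (gaussianReal 0 1).real A := by simp
      _ ≤ _ := by
          refine mul_le_mul_of_nonneg_right ?_ measureReal_nonneg
          have := card_nulls_add θ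
          have : (0 : ℝ) ≤ (signals θ).card := by positivity
          linarith
  have hδm : δ ^ 2 * m ≤ δ * m / 2 := by nlinarith [mul_pos hδ hm]
  have hsub : {X | δ * m < exceed (nulls θ) A X} ⊆
      {X | δ * m / 2 ≤ |exceed (nulls θ) A X - ∑ i ∈ nulls θ, (gaussianReal (θ i) 1).real A|} := by
    intro X hX
    rw [mem_ofPred_eq]
    refine le_trans ?_ (le_abs_self _)
    have : δ * m < exceed (nulls θ) A X := hX
    linarith
  refine (measureReal_mono hsub).trans
    ((exceed_chebyshev θ (nulls θ) hA (c := δ * m / 2) (by positivity)).trans ?_)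
  calc _ ≤ δ ^ 2 * m / (δ * m / 2) ^ 2 := by gcongr
    _ = _ := by field_simp; norm_num

end Slab

/-- Makes the union bound over a dyadic grid cost no more than twice its worst level. -/
lemma sum_range_succ_le_two_mul {a : ℕ → ℝ} {k : ℕ} (ha : ∀ j, 0 ≤ a j)
    (h : ∀ j < k, 2 * a j ≤ a (j + 1)) : ∑ j ∈ Finset.range (k + 1), a j ≤ 2 * a k := by
  induction k with
  | zero => simp; linarith [ha 0]
  | succ k ih =>
    rw [Finset.sum_range_succ]
    have := ih fun j hj => h j (by omega)
    linarith [h k (by omega)]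

lemma eventually_rpow_le_mul {p c : ℝ} (hp : p < 1) (hc : 0 < c) :
    ∀ᶠ n : ℕ in atTop, (n : ℝ) ^ p ≤ c * n := by
  have h1 : Tendsto (fun n : ℕ => (n : ℝ) ^ (1 - p)) atTop atTop :=
    (tendsto_rpow_atTop (by linarith)).comp tendsto_natCast_atTop_atTop
  filter_upwards [h1.eventually_ge_atTop (1 / c), eventually_gt_atTop 0] with n hn hn0
  have hn0' : (0 : ℝ) < n := by exact_mod_cast hn0
  have h2 : (n : ℝ) = n ^ p * n ^ (1 - p) := by rw [← Real.rpow_add hn0']; simp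
  have h3 : (0 : ℝ) ≤ (n : ℝ) ^ p := by positivity
  rw [div_le_iff₀ hc] at hn
  calc (n : ℝ) ^ p = n ^ p * 1 := (mul_one _).symm
    _ ≤ n ^ p * (n ^ (1 - p) * c) := mul_le_mul_of_nonneg_left hn h3
    _ = c * (n ^ p * n ^ (1 - p)) := by ring
    _ = c * n := by rw [← h2]

/-! ### Vanishing false discovery rate of the ℓ-values -/

namespace Slab

variable {γ : ℝ → ℝ} {Λ T : ℝ} {n : ℕ}

/-- Replaces the random ŵ by a fixed level: ŵ < 2u ≤ 1/2 leaves 1 - ŵ ≥ 1/2 in the rejection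
criterion. -/
lemma lr_of_ellProc_ne_zero (h : Slab γ Λ T) (hn : 0 < n) {t u : ℝ} (ht : t ∈ Ioo (0 : ℝ) 1)
    (hu : u ≤ 1 / 4) (X : Fin n → ℝ) (hw : wHat γ X < 2 * u) {i : Fin n}
    (hi : ellProc γ t n X i ≠ 0) : (1 - t) / (2 * t) ≤ 2 * u * lr γ (X i) := by
  have hle : ellValue γ (wHat γ X) (X i) ≤ t := by
    by_contra hcon
    exact hi (by rw [ellProc, if_neg hcon])
  have hwm := h.wHat_mem hn X
  have hw0 : 0 < wHat γ X := (one_div_natCast_mem hn).1.trans_le hwm.1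
  rw [h.ellValue_le_iff hw0 hwm.2] at hle
  have hl := h.lr_pos (X i)
  rw [div_le_iff₀ (by linarith [ht.1])]
  have h1 : (1 - t) / 2 ≤ (1 - wHat γ X) * (1 - t) := by nlinarith [ht.2]
  have h2 : t * (wHat γ X * lr γ (X i)) ≤ t * (2 * u * lr γ (X i)) :=
    mul_le_mul_of_nonneg_left (mul_le_mul_of_nonneg_right hw.le hl.le) ht.1.le
  linarith

lemma ellProc_eq_one (h : Slab γ Λ T) (hn : 0 < n) {t v z K : ℝ} (ht : t ∈ Ioo (0 : ℝ) 1)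
    (hv : 0 < v) (hz : 0 ≤ z) (hK : 1 ≤ t * K) (hzK : K / v ≤ lr γ z) (X : Fin n → ℝ)
    (hw : v ≤ wHat γ X) {i : Fin n} (hi : z ≤ |X i|) : ellProc γ t n X i = 1 := by
  rw [ellProc, if_pos]
  have hwm := h.wHat_mem hn X
  rw [h.ellValue_le_iff (hv.trans_le hw) hwm.2]
  have h1 : K / v ≤ lr γ (X i) := hzK.trans (h.lr_le_lr (by rwa [abs_of_nonneg hz]))
  have h2 : K ≤ wHat γ X * lr γ (X i) := by
    rw [div_le_iff₀ hv] at h1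
    have := h.lr_pos (X i)
    nlinarith
  have h3 : t * K ≤ t * (wHat γ X * lr γ (X i)) := mul_le_mul_of_nonneg_left h2 ht.1.le
  nlinarith [ht.1, ht.2, (hv.trans_le hw), hwm.2]

/-- If the estimator is below `2 u` and no null coordinate is extreme at that level, there is no
false discovery. -/
lemma fdp_ellProc_eq_zero (h : Slab γ Λ T) (hn : 0 < n) {t u : ℝ} (ht : t ∈ Ioo (0 : ℝ) 1)
    (hu : u ≤ 1 / 4) (θ X : Fin n → ℝ) (hw : wHat γ X < 2 * u)
    (hX : ¬ ∃ i ∈ nulls θ, X i ∈ {x | (1 - t) / (2 * t) ≤ 2 * u * lr γ x}) :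
    fdp θ (ellProc γ t n X) = 0 := by
  rw [fdp, Finset.sum_eq_zero, zero_div]
  intro i hi
  by_contra hne
  exact hX ⟨i, hi, h.lr_of_ellProc_ne_zero hn ht hu X hw hne⟩

lemma fdp_ellProc_le (h : Slab γ Λ T) (hn : 0 < n) {t v z K a b : ℝ} (ht : t ∈ Ioo (0 : ℝ) 1)
    (hv : 0 < v) (hv1 : v ≤ 1 / 4) (hz : 0 ≤ z) (hK : 1 ≤ t * K) (hzK : K / v ≤ lr γ z)
    (hb : 0 < b) (θ X : Fin n → ℝ) (hw : v ≤ wHat γ X) (hw2 : wHat γ X < 2 * v)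
    (hV : exceed (nulls θ) {x | (1 - t) / (2 * t) ≤ 2 * v * lr γ x} X ≤ a)
    (hN : b ≤ exceed (signals θ) {x | z ≤ |x|} X) :
    fdp θ (ellProc γ t n X) ≤ a / b := by
  have h1 : ∑ i ∈ nulls θ, ellProc γ t n X i ≤ a := by
    refine le_trans (Finset.sum_le_sum fun i _ => ?_) hV
    by_cases hi : ellProc γ t n X i = 0
    · rw [hi]; exact indicator_nonneg (fun _ _ => zero_le_one) _
    · rw [indicator_of_mem (show X i ∈ {x | (1 - t) / (2 * t) ≤ 2 * v * lr γ x} from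
        h.lr_of_ellProc_ne_zero hn ht hv1 X hw2 hi)]
      unfold ellProc; split_ifs <;> norm_num
  have h2 : b ≤ ∑ i, ellProc γ t n X i := by
    rw [← sum_nulls_add_sum_signals θ]
    have h3 : exceed (signals θ) {x | z ≤ |x|} X ≤ ∑ i ∈ signals θ, ellProc γ t n X i := by
      refine Finset.sum_le_sum fun i _ => ?_
      by_cases hi : z ≤ |X i|
      · rw [h.ellProc_eq_one hn ht hv hz hK hzK X hw hi]
        exact indicator_le_self' (fun _ _ => zero_le_one) _
      · rw [indicator_of_notMem (show X i ∉ {x | z ≤ |x|} from hi)]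
        exact ellProc_nonneg γ t X i
    have h4 : 0 ≤ ∑ i ∈ nulls θ, ellProc γ t n X i :=
      Finset.sum_nonneg fun i _ => ellProc_nonneg γ t X i
    linarith
  have h0 : 0 ≤ ∑ i ∈ nulls θ, ellProc γ t n X i :=
    Finset.sum_nonneg fun i _ => ellProc_nonneg γ t X i
  rw [fdp]
  exact div_le_div₀ (h0.trans h1) h1 hb (h2.trans (le_max_right _ _))

set_option maxHeartbeats 2000000 in
/-- The `ℓ`-value procedure has vanishing false discovery rate, uniformly over sparse vectors. -/
theorem eventually_FDR_ellProc_le (h : Slab γ Λ T) {t υ : ℝ} (ht : t ∈ Ioo (0 : ℝ) 1)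
    (hυ : υ ∈ Ioo (0 : ℝ) 1) {s : ℕ → ℕ} (hsn : ∀ n : ℕ, 1 ≤ n → (s n : ℝ) ≤ (n : ℝ) ^ υ)
    {ρ : ℝ} (hρ : 0 < ρ) :
    ∀ᶠ n : ℕ in atTop, ∀ θ ∈ sparse n (s n), FDR θ (ellProc γ t n) ≤ ρ := by
  obtain ⟨ht0, ht1⟩ := ht
  set k := (1 - t) / (2 * t) with hk
  have hk0 : 0 < k := div_pos (by linarith) (by linarith)
  -- Large enough that lr ≥ K/v entails rejection as soon as ŵ ≥ v, and K ≥ 2 as `exists_exp_sq_le`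
  -- requires.
  set K := 1 / t + 1 with hKdef
  have hK2 : 2 ≤ K := by
    have : 1 ≤ 1 / t := by rw [le_div_iff₀ ht0]; linarith
    linarith
  have htK : 1 ≤ t * K := by
    have : t * K = 1 + t := by rw [hKdef]; field_simp
    linarith
  -- Makes υ + 8η = (1 + υ)/2 < 1, so that n^υ signals times (1/v)^(8η) ≤ n^(8η) stay below a small
  -- multiple of n.
  set η := (1 - υ) / 16 with hη
  have hη0 : 0 < η := by rw [hη]; linarith [hυ.2]
  set C := K * (1 + 2 * Real.exp (3 / 2) / η) with hC
  have hC0 : 0 < C := by positivity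
  obtain ⟨C3, hC3, hexp⟩ := h.exists_exp_sq_le hη0 hK2
  -- constants
  set M := max 4 (8 * (64 * C + 4) / ρ) with hM
  have hM4 : 4 ≤ M := le_max_left _ _
  have hMρ : 2 * (64 * C + 4) / M ≤ ρ / 4 := by
    have : 8 * (64 * C + 4) / ρ ≤ M := le_max_right _ _
    rw [div_le_iff₀ hρ] at this
    rw [div_le_iff₀ (by linarith)]
    linarith
  -- δ² M bounds the probability of any false positive below the grid, and 16 C δ the false
  -- discovery proportion on the grid.
  set δ := min (1 / 2) (min (ρ / (4 * M)) (ρ / (4 * (16 * C)))) with hδ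
  have hδ0 : 0 < δ := by positivity
  have hδ1 : δ ≤ 1 / 2 := min_le_left _ _
  have hδM : δ ^ 2 * M ≤ ρ / 4 := by
    have h1 : δ ≤ ρ / (4 * M) := (min_le_right _ _).trans (min_le_left _ _)
    rw [le_div_iff₀ (by positivity)] at h1
    have h2 : δ ^ 2 * M ≤ δ * M := by
      refine mul_le_mul_of_nonneg_right ?_ (by linarith)
      rw [sq]; exact mul_le_of_le_one_right hδ0.le (by linarith)
    linarith
  have hδC : δ * (16 * C) ≤ ρ / 4 := by
    have h1 : δ ≤ ρ / (4 * (16 * C)) := (min_le_right _ _).trans (min_le_right _ _)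
    rw [le_div_iff₀ (by positivity)] at h1
    linarith
  obtain ⟨w₀, hw0, hw1, hnull⟩ := h.null_exceedance_le hk0 (by positivity : 0 < δ ^ 2)
  obtain ⟨R, hR, hRz⟩ := h.exists_threshold (max 1 (2 * Λ / η))
  set v₀ := min w₀ (K / R) with hv₀
  have hv₀0 : 0 < v₀ := lt_min hw0 (by positivity)
  have hv₀w : v₀ ≤ w₀ := min_le_left _ _
  -- The conditions on v stand inside the existential so that `choose` yields a function of v alone;
  -- outside the range its value 0 is irrelevant.
  have hz : ∀ v, ∃ z, 0 < v → v ≤ v₀ → 1 ≤ z ∧ 2 * Λ ≤ η * z ∧ lr γ z = K / v := by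
    intro v
    by_cases hv : 0 < v ∧ v ≤ v₀
    · have hRv : R ≤ K / v := by
        have := hv.2.trans (min_le_right _ _)
        rw [le_div_iff₀ hR] at this
        rw [le_div_iff₀ hv.1]; linarith
      obtain ⟨z, hz, hzl⟩ := hRz _ hRv
      refine ⟨z, fun _ _ => ⟨(le_max_left _ _).trans hz, ?_, hzl⟩⟩
      have := (le_max_right _ _).trans hz
      rw [div_le_iff₀ hη0] at this
      linarith
    · exact ⟨0, fun h1 h2 => absurd ⟨h1, h2⟩ hv⟩
  choose z hz using hz
  have hdpos : ∀ v, 0 < v → v ≤ v₀ → 0 < drift γ v :=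
    fun v hv hvv => h.drift_pos hv (by linarith)
  have hd₀ := hdpos v₀ hv₀0 le_rfl
  -- large `n`
  have hp : υ + 8 * η < 1 := by rw [hη]; linarith [hυ.2]
  filter_upwards [eventually_gt_atTop 0, eventually_rpow_le_mul hυ.2 (by norm_num : (0 : ℝ) < 1 / 4),
    eventually_rpow_le_mul hp (by positivity : 0 < 1 / (8 * C3)),
    eventually_rpow_le_mul hυ.2 (by positivity : 0 < v₀ * drift γ v₀ / (32 * C)),
    tendsto_natCast_atTop_atTop.eventually_ge_atTop (M / (v₀ * drift γ v₀))]
    with n hn hn1 hn2 hn3 hn4 θ hθ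
  have hn0 : (0 : ℝ) < n := by exact_mod_cast hn
  have hS : ((signals θ).card : ℝ) ≤ (n : ℝ) ^ υ := by
    rw [card_signals]
    exact (Nat.cast_le.2 hθ).trans (hsn n hn)
  have hcard : 4 * ((signals θ).card : ℝ) ≤ n := by linarith
  set A : ℝ → ℝ := fun v => n * (v * drift γ v) with hA
  have hA0 : M ≤ A v₀ := by
    have := hn4
    rw [div_le_iff₀ (by positivity)] at this
    exact this
  -- the dyadic grid
  set V : ℕ → ℝ := fun j => v₀ / 2 ^ j with hV
  have hVpos : ∀ j, 0 < V j := fun j => by positivity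
  have hVle : ∀ j, V j ≤ v₀ := fun j =>
    div_le_self hv₀0.le (one_le_pow₀ (by norm_num))
  have hVsucc : ∀ j, V j = 2 * V (j + 1) := fun j => by
    simp only [hV, pow_succ]; field_simp
  have hV4 : ∀ j, V j ≤ 1 / 4 := fun j => (hVle j).trans (hv₀w.trans hw1)
  have hVA : ∀ j, 2 * A (V (j + 1)) ≤ A (V j) := by
    intro j
    have h1 : drift γ (V (j + 1)) ≤ drift γ (V j) :=
      h.drift_mono (hVpos _) (by rw [hVsucc j]; linarith [hVpos (j + 1)]) (by linarith [hV4 j])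
    have h2 := hVpos (j + 1)
    simp only [hA]
    rw [show V j * drift γ (V j) = 2 * (V (j + 1) * drift γ (V j)) by rw [hVsucc j]; ring]
    have h3 : V (j + 1) * drift γ (V (j + 1)) ≤ V (j + 1) * drift γ (V j) :=
      mul_le_mul_of_nonneg_left h1 h2.le
    linarith [mul_le_mul_of_nonneg_left h3 hn0.le]
  have hApos : ∀ j, 0 < A (V j) := fun j =>
    mul_pos hn0 (mul_pos (hVpos j) (hdpos _ (hVpos j) (hVle j)))
  have hex : ∃ j, A (V j) < M := by
    have h1 : Tendsto (fun j : ℕ => A v₀ * (1 / 2) ^ j) atTop (𝓝 (A v₀ * 0)) :=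
      (tendsto_pow_atTop_nhds_zero_of_lt_one (by norm_num) (by norm_num)).const_mul _
    rw [mul_zero] at h1
    obtain ⟨j, hj⟩ := (h1.eventually_lt_const (by linarith : (0 : ℝ) < M)).exists
    refine ⟨j, lt_of_le_of_lt ?_ hj⟩
    clear hj
    induction j with
    | zero => simp [hV]
    | succ j ih => rw [pow_succ]; linarith [hVA j]
  classical
  -- The last level with A ≥ M; it exists because A ≥ M at the top level V 0 = v₀.
  obtain ⟨j₀, hj₀⟩ : ∃ j₀, Nat.find hex = j₀ + 1 := by
    refine Nat.exists_eq_succ_of_ne_zero fun h0 => ?_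
    have := Nat.find_spec hex
    rw [h0] at this
    simp only [hV, pow_zero, div_one] at this
    linarith
  have hlast : A (V (j₀ + 1)) < M := hj₀ ▸ Nat.find_spec hex
  have hge : ∀ j ≤ j₀, M ≤ A (V j) := fun j hj =>
    not_lt.1 (Nat.find_min hex (by omega))
  have hVn : ∀ j ≤ j₀, 1 / (n : ℝ) < V j := by
    intro j hj
    have h1 := hge j hj
    have h2 := h.drift_le_two (hVpos j) (by linarith [hV4 j])
    have h3 : A (V j) ≤ n * (V j * 2) :=
      mul_le_mul_of_nonneg_left (mul_le_mul_of_nonneg_left h2 (hVpos j).le) hn0.le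
    rw [div_lt_iff₀ hn0]
    linarith
  -- the exceptional events
  set bad1 : ℕ → Set (Fin n → ℝ) := fun j => {X | V j ≤ wHat γ X ∧
    exceed (signals θ) {x | z (V j) ≤ |x|} X < A (V j) / (16 * C)} with hbad1
  set bad2 : ℕ → Set (Fin n → ℝ) := fun j =>
    {X | δ * A (V j) < exceed (nulls θ) {x | k ≤ 2 * V j * lr γ x} X} with hbad2
  set bad3 : Set (Fin n → ℝ) :=
    {X | ∃ i ∈ nulls θ, X i ∈ {x | k ≤ 2 * V (j₀ + 1) * lr γ x}} with hbad3
  have hmeas : ∀ v, MeasurableSet {x | k ≤ 2 * v * lr γ x} := fun v =>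
    measurableSet_le measurable_const (measurable_const.mul h.continuous_lr.measurable)
  have hP1 : ∀ j ≤ j₀, (law θ).real (bad1 j) ≤ 64 * C / A (V j) := by
    intro j hj
    obtain ⟨hz1, hz2, hz3⟩ := hz (V j) (hVpos j) (hVle j)
    refine h.signal_detection hn θ hη0 hz1 hz2 (hVn j hj) (by linarith [hV4 j]) (by linarith) hz3 hC
      hcard (hdpos _ (hVpos j) (hVle j)) ?_
    have hd := hdpos _ (hVpos j) (hVle j)
    have h1 := hexp (V j) (z (V j)) (hVpos j) (by linarith [hV4 j]) (by linarith) hz3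
    have h2 : (1 / V j) ^ (8 * η) ≤ (n : ℝ) ^ (8 * η) := by
      refine Real.rpow_le_rpow (one_div_pos.2 (hVpos j)).le ?_ (by positivity)
      rw [div_le_iff₀ (hVpos j)]
      have := hVn j hj
      rw [div_lt_iff₀ hn0] at this
      linarith
    have h3 : Real.exp (η * z (V j) ^ 2) ≤ C3 * (n : ℝ) ^ (8 * η) * drift γ (V j) :=
      h1.trans (by gcongr)
    calc (signals θ).card * Real.exp (η * z (V j) ^ 2)
        ≤ (n : ℝ) ^ υ * (C3 * (n : ℝ) ^ (8 * η) * drift γ (V j)) :=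
          mul_le_mul hS h3 (Real.exp_pos _).le (by positivity)
      _ = C3 * (n : ℝ) ^ (υ + 8 * η) * drift γ (V j) := by rw [Real.rpow_add hn0]; ring
      _ ≤ C3 * (1 / (8 * C3) * n) * drift γ (V j) := by gcongr
      _ = _ := by field_simp
  have hP2 : ∀ j, (law θ).real (bad2 j) ≤ 4 / A (V j) := by
    intro j
    refine null_count_le θ (hmeas (V j)) hδ0 hδ1 (hApos j) ?_
    have := hnull (V j) (hVpos j) ((hVle j).trans hv₀w)
    simp only [hA]
    calc n * (gaussianReal 0 1).real {x | k ≤ 2 * V j * lr γ x}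
        ≤ n * (δ ^ 2 * (V j * drift γ (V j))) := mul_le_mul_of_nonneg_left this hn0.le
      _ = _ := by ring
  have hP3 : (law θ).real bad3 ≤ δ ^ 2 * M := by
    refine (law_real_exists_le θ _ (hmeas _)).trans ?_
    have := hnull (V (j₀ + 1)) (hVpos _) ((hVle _).trans hv₀w)
    calc ∑ i ∈ nulls θ, (gaussianReal (θ i) 1).real {x | k ≤ 2 * V (j₀ + 1) * lr γ x}
        = (nulls θ).card * (gaussianReal 0 1).real {x | k ≤ 2 * V (j₀ + 1) * lr γ x} := by
          rw [← nsmul_eq_mul, ← Finset.sum_const]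
          exact Finset.sum_congr rfl fun i hi => by rw [mem_nulls.1 hi]
      _ ≤ n * (δ ^ 2 * (V (j₀ + 1) * drift γ (V (j₀ + 1)))) := by
          refine mul_le_mul ?_ this measureReal_nonneg hn0.le
          have := card_nulls_add θ
          have : (0 : ℝ) ≤ (signals θ).card := Nat.cast_nonneg _
          linarith
      _ = δ ^ 2 * A (V (j₀ + 1)) := by
          show _ = δ ^ 2 * (n * (V (j₀ + 1) * drift γ (V (j₀ + 1))))
          ring
      _ ≤ _ := mul_le_mul_of_nonneg_left hlast.le (by positivity)
  set bad := bad3 ∪ ⋃ j ∈ Finset.range (j₀ + 1), (bad1 j ∪ bad2 j) with hbad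
  have hPbad : (law θ).real bad ≤ ρ / 2 := by
    have h1 : (law θ).real (⋃ j ∈ Finset.range (j₀ + 1), (bad1 j ∪ bad2 j)) ≤ ρ / 4 := by
      refine (measureReal_biUnion_finset_le _ _).trans ?_
      calc ∑ j ∈ Finset.range (j₀ + 1), (law θ).real (bad1 j ∪ bad2 j)
          ≤ ∑ j ∈ Finset.range (j₀ + 1), (64 * C + 4) / A (V j) := by
            refine Finset.sum_le_sum fun j hj => (measureReal_union_le _ _).trans ?_
            rw [add_div]
            exact add_le_add (hP1 j (by have := Finset.mem_range.1 hj; omega)) (hP2 j)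
        _ ≤ 2 * ((64 * C + 4) / A (V j₀)) := by
            refine sum_range_succ_le_two_mul (fun j => ?_) fun j _ => ?_
            · have := hApos j; positivity
            · have h2 := hVA j
              have h3 := hApos j
              have h4 := hApos (j + 1)
              rw [mul_div_assoc', div_le_div_iff₀ h3 h4]
              linarith [mul_le_mul_of_nonneg_left h2 (by positivity : 0 ≤ 64 * C + 4)]
        _ ≤ 2 * ((64 * C + 4) / M) := by
            have := hge j₀ le_rfl
            gcongr
        _ ≤ ρ / 4 := by rw [← mul_div_assoc]; exact hMρ
    refine (measureReal_union_le _ _).trans ?_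
    linarith
  rw [FDR_eq]
  refine (integral_le_add_real (δ := ρ / 4) (by positivity) bad
    (fun X => fdp_nonneg θ (ellProc_nonneg γ t X)) (fun X => fdp_le_one θ (ellProc_nonneg γ t X))
    fun X hX => ?_).trans (by linarith)
  rw [hbad, mem_union, not_or] at hX
  obtain ⟨hX3, hX⟩ := hX
  simp only [mem_iUnion, Finset.mem_range, not_exists, mem_union, not_or] at hX
  rcases lt_or_ge (wHat γ X) (V j₀) with hlt | hge'
  -- Here ŵ < V j₀ = 2 V (j₀ + 1), and A (V (j₀ + 1)) < M made a false positive at that level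
  -- unlikely.
  · rw [h.fdp_ellProc_eq_zero hn ⟨ht0, ht1⟩ (hV4 (j₀ + 1)) θ X (by rwa [← hVsucc]) hX3]
    positivity
  · have hexj : ∃ j, V j ≤ wHat γ X := ⟨j₀, hge'⟩
    -- The first grid level not exceeding ŵ, so that V j ≤ ŵ < 2 V j unless j = 0.
    set j := Nat.find hexj
    have hjle : j ≤ j₀ := Nat.find_min' hexj hge'
    have hjw : V j ≤ wHat γ X := Nat.find_spec hexj
    obtain ⟨hb1, hb2⟩ := hX j (by omega)
    have hN : A (V j) / (16 * C) ≤ exceed (signals θ) {x | z (V j) ≤ |x|} X := by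
      by_contra hcon
      exact hb1 ⟨hjw, not_le.1 hcon⟩
    rcases Nat.eq_zero_or_pos j with hj0 | hjpos
    -- ŵ ≥ v₀ would require A v₀ / (16 C) detected signals, a multiple of n, whereas there are at
    -- most n^υ.
    · exfalso
      have h1 := exceed_le_card (signals θ) {x | z (V j) ≤ |x|} X
      have h2 : A (V j) = A v₀ := by rw [hj0]; simp [hV]
      rw [h2] at hN
      have h3 : (n : ℝ) ^ υ ≤ A v₀ / (32 * C) := by
        calc (n : ℝ) ^ υ ≤ v₀ * drift γ v₀ / (32 * C) * n := hn3
          _ = _ := by simp only [hA]; ring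
      have h4 : A v₀ / (32 * C) < A v₀ / (16 * C) := by
        have : 0 < A v₀ := by linarith
        gcongr; norm_num
      linarith
    · have hw2 : wHat γ X < 2 * V j := by
        have h1 := Nat.find_min hexj (show j - 1 < Nat.find hexj from by omega)
        rw [hVsucc (j - 1), show j - 1 + 1 = j by omega] at h1
        exact not_le.1 h1
      obtain ⟨hz1, hz2, hz3⟩ := hz (V j) (hVpos j) (hVle j)
      refine (h.fdp_ellProc_le hn ⟨ht0, ht1⟩ (hVpos j) (hV4 j) (by linarith) htK hz3.ge
        (by have := hApos j; positivity) θ X hjw hw2 (not_lt.1 hb2) hN).trans ?_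
      have := (hApos j).ne'
      calc δ * A (V j) / (A (V j) / (16 * C)) = δ * (16 * C) := by field_simp
        _ ≤ _ := hδC

end Slab

/-! ### Tail ratios and the rejection threshold of the q-value -/

lemma setIntegral_tail_eq {f : ℝ → ℝ} (hf : Integrable f) {y : ℝ} (hy : 0 ≤ y) :
    ∫ x in {x | y ≤ |x|}, f x = (∫ x, f x) - ∫ x in (-y)..y, f x := by
  have h1 : {x : ℝ | y ≤ |x|}ᶜ = Ioo (-y) y := by
    ext x; simp [abs_lt]
  rw [← integral_add_compl (measurableSet_tail y) hf, h1,
    intervalIntegral.integral_of_le (by linarith), integral_Ioc_eq_integral_Ioo]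
  ring

lemma continuousOn_setIntegral_tail {f : ℝ → ℝ} (hf : Integrable f) :
    ContinuousOn (fun y : ℝ => ∫ x in {x | y ≤ |x|}, f x) (Ici 0) := by
  have h1 : Continuous fun y : ℝ => (∫ x, f x) - ∫ x in (-y)..y, f x := by
    have h2 : ∀ y : ℝ, ∫ x in (-y)..y, f x =
        (∫ x in 0..y, f x) - ∫ x in 0..(-y), f x := by
      intro y
      rw [intervalIntegral.integral_interval_sub_left hf.intervalIntegrable hf.intervalIntegrable]
    have h3 : Continuous fun y : ℝ => ∫ x in 0..y, f x :=
      intervalIntegral.continuous_primitive (fun _ _ => hf.intervalIntegrable) 0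
    simp only [h2]
    exact continuous_const.sub (h3.sub (h3.comp continuous_neg))
  exact h1.continuousOn.congr fun y hy => setIntegral_tail_eq hf hy

lemma tail_diff {f : ℝ → ℝ} (hf : Integrable f) {x y : ℝ} (hxy : x ≤ y) :
    (∫ u in {u | x ≤ |u|}, f u) - ∫ u in {u | y ≤ |u|}, f u =
      ∫ u in {u | x ≤ |u| ∧ |u| < y}, f u := by
  have h1 : {u : ℝ | x ≤ |u| ∧ |u| < y} = {u | x ≤ |u|} \ {u | y ≤ |u|} := by ext u; simp
  have h2 : {u : ℝ | y ≤ |u|} ⊆ {u | x ≤ |u|} := fun u hu => hxy.trans hu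
  rw [h1, setIntegral_sdiff (measurableSet_tail y) hf.integrableOn h2]

lemma measurableSet_band (x y : ℝ) : MeasurableSet {u : ℝ | x ≤ |u| ∧ |u| < y} :=
  (measurableSet_tail x).inter (measurableSet_lt continuous_abs.measurable measurable_const)

lemma nullTail_lt {x y : ℝ} (hx : 0 ≤ x) (hxy : x < y) : nullTail y < nullTail x := by
  have h1 := tail_diff integrable_phi hxy.le
  have h2 : 0 < ∫ u in {u | x ≤ |u| ∧ |u| < y}, phi u := by
    rw [setIntegral_pos_iff_support_of_nonneg_ae
      (ae_of_all _ fun x => (phi_pos x).le) integrable_phi.integrableOn]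
    have : Function.support phi = univ := by ext u; simp [(phi_pos u).ne']
    rw [this, univ_inter]
    have hsub : Ioo x y ⊆ {u | x ≤ |u| ∧ |u| < y} := fun u hu =>
      ⟨hu.1.le.trans (le_abs_self u), by rw [abs_of_pos (hx.trans_lt hu.1)]; exact hu.2⟩
    refine lt_of_lt_of_le ?_ (measure_mono hsub)
    rw [Real.volume_Ioo]; simp [hxy]
  unfold nullTail
  linarith

lemma le_nullTail {x : ℝ} (hx : 1 ≤ x) : Real.exp (-(3 / 2)) * phi x / x ≤ nullTail x := by
  have := le_gaussianReal_tail hx le_rfl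
  rwa [sub_zero, ← nullTail_eq] at this

namespace Slab

variable {γ : ℝ → ℝ} {Λ T : ℝ}

/-- g = lr · φ with lr at least lr(x) on the tail; this is why q-values do not exceed ℓ-values. -/
lemma lr_mul_nullTail_le (h : Slab γ Λ T) (x : ℝ) : lr γ x * nullTail |x| ≤ slabTail γ |x| := by
  rw [nullTail, slabTail, ← integral_const_mul]
  refine setIntegral_mono_on (integrable_phi.const_mul _).integrableOn h.integrable_g.integrableOn
    (measurableSet_tail _) fun u hu => ?_
  rw [← lr_mul_phi γ u]
  exact mul_le_mul_of_nonneg_right (h.lr_le_lr hu) (phi_pos u).le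

lemma slabTail_diff_le (h : Slab γ Λ T) {x y : ℝ} (hxy : x ≤ y) :
    slabTail γ x - slabTail γ y ≤ lr γ y * (nullTail x - nullTail y) := by
  rw [slabTail, slabTail, nullTail, nullTail, tail_diff h.integrable_g hxy,
    tail_diff integrable_phi hxy, ← integral_const_mul]
  refine setIntegral_mono_on h.integrable_g.integrableOn
    (integrable_phi.const_mul _).integrableOn (measurableSet_band x y) fun u hu => ?_
  rw [← lr_mul_phi γ u]
  exact mul_le_mul_of_nonneg_right (h.lr_le_lr (hu.2.le.trans (le_abs_self y))) (phi_pos u).le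

lemma le_slabTail_diff (h : Slab γ Λ T) {x y : ℝ} (hx : 0 ≤ x) (hxy : x ≤ y) :
    lr γ x * (nullTail x - nullTail y) ≤ slabTail γ x - slabTail γ y := by
  rw [slabTail, slabTail, nullTail, nullTail, tail_diff h.integrable_g hxy,
    tail_diff integrable_phi hxy, ← integral_const_mul]
  refine setIntegral_mono_on (integrable_phi.const_mul _).integrableOn
    h.integrable_g.integrableOn (measurableSet_band x y) fun u hu => ?_
  rw [← lr_mul_phi γ u]
  exact mul_le_mul_of_nonneg_right (h.lr_le_lr (by rw [abs_of_nonneg hx]; exact hu.1))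
    (phi_pos u).le

lemma lr_mul_nullTail_lt (h : Slab γ Λ T) {y : ℝ} (hy : Λ < y) :
    lr γ y * nullTail y < slabTail γ y := by
  have hy0 : 0 < y := by linarith [h.one_le]
  have h1 := h.le_slabTail_diff hy0.le (by linarith : y ≤ y + 1)
  have h2 := h.lr_mul_nullTail_le (y + 1)
  rw [abs_of_pos (by linarith : 0 < y + 1)] at h2
  have h3 : lr γ y < lr γ (y + 1) :=
    h.lr_lt_lr (by linarith) (by rw [abs_of_pos hy0]; linarith)
  nlinarith [nullTail_pos (y + 1)]

/-- The tail ratio crosses a level only once. -/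
lemma tail_ratio_iff (h : Slab γ Λ T) {r χ : ℝ} (hχ : Λ < χ)
    (hr : slabTail γ χ = r * nullTail χ) {x : ℝ} (hx : 0 ≤ x) :
    r * nullTail x ≤ slabTail γ x ↔ χ ≤ x := by
  have hχ0 : 0 < χ := by linarith [h.one_le]
  -- The tail ratio at χ averages values of lr beyond χ, so it exceeds lr(χ). On the left of χ, the
  -- added band has ratio at most lr(χ) < r and pulls the tail ratio below r.
  have hlr : lr γ χ < r := by
    have := h.lr_mul_nullTail_lt hχ
    rw [hr] at this
    exact lt_of_mul_lt_mul_right this (nullTail_pos χ).le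
  constructor
  · intro hle
    by_contra! hlt
    have h1 := h.slabTail_diff_le hlt.le
    have h2 := nullTail_lt hx hlt
    nlinarith
  · intro hle
    have h1 := h.slabTail_diff_le hle
    have h3 := h.lr_mul_nullTail_le x
    rw [abs_of_nonneg hx] at h3
    have h4 : nullTail x ≤ nullTail χ := nullTail_anti hle
    -- If lr(x) ≥ r, the whole tail beyond x has ratio at least r. Otherwise the band removed
    -- between χ and x has ratio below r, which raises the ratio of what remains.
    rcases le_or_gt r (lr γ x) with hrx | hrx
    · exact (mul_le_mul_of_nonneg_right hrx (nullTail_pos x).le).trans h3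
    · nlinarith

lemma exists_tail_ratio_eq (h : Slab γ Λ T) (Y : ℝ) :
    ∃ R, 0 < R ∧ ∀ r, R ≤ r → ∃ χ, Y ≤ χ ∧ slabTail γ χ = r * nullTail χ := by
  set Y' := max Y 0
  have hY' : 0 ≤ Y' := le_max_right _ _
  refine ⟨slabTail γ Y' / nullTail Y', div_pos (h.slabTail_pos _) (nullTail_pos _),
    fun r hr => ?_⟩
  rw [div_le_iff₀ (nullTail_pos _)] at hr
  obtain ⟨x, hxY, hx⟩ :=
    ((eventually_ge_atTop Y').and (h.tendsto_lr.eventually_ge_atTop r)).exists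
  have h1 := h.lr_mul_nullTail_le x
  rw [abs_of_nonneg (hY'.trans hxY)] at h1
  have h2 : r * nullTail x ≤ slabTail γ x :=
    (mul_le_mul_of_nonneg_right hx (nullTail_pos x).le).trans h1
  have hcont : ContinuousOn (fun y => slabTail γ y - r * nullTail y) (Icc Y' x) :=
    ((continuousOn_setIntegral_tail h.integrable_g).sub
      ((continuousOn_setIntegral_tail integrable_phi).const_smul r)).mono
      fun y hy => hY'.trans hy.1
  obtain ⟨χ, hχ, hχ0⟩ := intermediate_value_Icc hxY hcont
    (show (0 : ℝ) ∈ Icc _ _ from ⟨by linarith, by linarith⟩)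
  exact ⟨χ, (le_max_left _ _).trans hχ.1, by simpa [sub_eq_zero] using hχ0⟩

/-! ### The drift is asymptotically the tail of the marginal density -/

/-- The Gaussian tail is at least of order φ(x)/x and slabTail at most of order x g(x), so the
hypothesis gives w lr(x) ≥ const/x². A shift by δ gains exp(δ(x - Λ)), which outweighs x². -/
lemma le_mul_lr_add (h : Slab γ Λ T) {c δ K : ℝ} (hc : 0 < c) (hδ : 0 < δ) :
    ∃ Y, ∀ x, Y ≤ x → ∀ w, 0 < w → c * nullTail x ≤ w * slabTail γ x →
      K ≤ w * lr γ (x + δ) := by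
  obtain ⟨C, hC, hCt⟩ := h.exists_slabTail_le
  set b := c * Real.exp (-(3 / 2)) / C * Real.exp (-(Λ * δ)) with hb
  have hb0 : 0 < b := by positivity
  refine ⟨max T (|K| * 27 / (b * δ ^ 3)), fun x hx w hw hcw => ?_⟩
  have hxT : T ≤ x := (le_max_left _ _).trans hx
  have hx1 : 1 ≤ x := h.one_le_T.trans hxT
  have hx0 : 0 < x := by linarith
  have hg := h.g_pos x
  have hl := h.lr_pos x
  have hphi := phi_pos x
  have h1 : c * (Real.exp (-(3 / 2)) * phi x / x) ≤ w * (C * x * slabMarginal γ x) :=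
    (mul_le_mul_of_nonneg_left (le_nullTail hx1) hc.le).trans
      (hcw.trans (mul_le_mul_of_nonneg_left (hCt x hxT) hw.le))
  have h2 : c * Real.exp (-(3 / 2)) / (C * x ^ 2) ≤ w * lr γ x := by
    rw [← lr_mul_phi] at h1
    rw [div_le_iff₀ (by positivity)]
    rw [mul_div_assoc', div_le_iff₀ hx0] at h1
    have h1' : c * Real.exp (-(3 / 2)) * phi x ≤ w * lr γ x * (C * x ^ 2) * phi x := by
      calc _ = c * (Real.exp (-(3 / 2)) * phi x) := by ring
        _ ≤ _ := h1
        _ = _ := by ring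
    exact le_of_mul_le_mul_right h1' hphi
  -- A cubic bound is enough: it leaves one power of x against the loss x².
  have h3 : (x * δ) ^ 3 / 27 ≤ Real.exp (x * δ) := by
    have e1 : x * δ / 3 ≤ Real.exp (x * δ / 3) := by
      linarith [Real.add_one_le_exp (x * δ / 3)]
    have e2 : Real.exp (x * δ) = Real.exp (x * δ / 3) ^ 3 := by
      rw [← Real.exp_nat_mul]; congr 1; push_cast; ring
    rw [e2]
    calc (x * δ) ^ 3 / 27 = (x * δ / 3) ^ 3 := by ring
      _ ≤ _ := pow_le_pow_left₀ (by positivity) e1 3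
  have h4 : |K| * 27 / (b * δ ^ 3) ≤ x := (le_max_right _ _).trans hx
  rw [div_le_iff₀ (by positivity)] at h4
  calc K ≤ |K| := le_abs_self K
    _ ≤ x * (b * δ ^ 3) / 27 := by linarith
    _ = c * Real.exp (-(3 / 2)) / (C * x ^ 2) * ((x * δ) ^ 3 / 27 * Real.exp (-(Λ * δ))) := by
        rw [hb]; field_simp
    _ ≤ w * lr γ x * (Real.exp (x * δ) * Real.exp (-(Λ * δ))) := by gcongr
    _ = w * (lr γ x * Real.exp (x * δ - Λ * δ)) := by
        rw [← Real.exp_add, ← sub_eq_add_neg]; ring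
    _ ≤ _ := mul_le_mul_of_nonneg_left (h.lr_mul_exp_le hδ.le) hw.le

lemma drift_ge_slabTail (h : Slab γ Λ T) {c ε : ℝ} (hc : 0 < c) (hε : 0 < ε) (hε1 : ε < 1) :
    ∃ Y, ∀ x, Y ≤ x → ∀ w, 0 < w → w ≤ 1 / 2 → c * nullTail x ≤ w * slabTail γ x →
      (1 - ε) * slabTail γ x ≤ drift γ w := by
  -- The shift by δ costs exp(-Λδ) ≥ 1 - ε/2, and K = 8/ε makes (K/(1 + K))² ≥ 1 - ε/2 in
  -- `le_drift`; the product is at least 1 - ε.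
  set δ := ε / (2 * Λ) with hδ
  have hΛ := h.one_le
  have hδ0 : 0 < δ := by positivity
  set K := 8 / ε with hK
  have hK8 : 8 ≤ K := by rw [hK, le_div_iff₀ hε]; linarith
  obtain ⟨Y, hY⟩ := h.le_mul_lr_add (K := K + 1) hc hδ0
  refine ⟨max Y 1, fun x hx w hw hw1 hcw => ?_⟩
  have hx0 : 0 < x := by linarith [(le_max_right Y 1).trans hx]
  have h1 := hY x ((le_max_left _ _).trans hx) w hw hcw
  have h2 : K / w ≤ beta γ (x + δ) := by
    rw [div_le_iff₀ hw, beta_eq]; linarith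
  have h3 := h.le_drift hw hw1 (by linarith) (by positivity) h2
  have h4 := h.slabTail_le_mul_exp hx0 hδ0.le
  have h5 : (1 - ε / 2) * slabTail γ x ≤ slabTail γ (x + δ) := by
    have e1 : 1 - ε / 2 ≤ Real.exp (-(Λ * δ)) := by
      have : Λ * δ = ε / 2 := by rw [hδ]; field_simp
      rw [this]
      linarith [Real.add_one_le_exp (-(ε / 2))]
    calc (1 - ε / 2) * slabTail γ x ≤ Real.exp (-(Λ * δ)) * slabTail γ x :=
          mul_le_mul_of_nonneg_right e1 (h.slabTail_pos x).le
      _ ≤ Real.exp (-(Λ * δ)) * (slabTail γ (x + δ) * Real.exp (Λ * δ)) :=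
          mul_le_mul_of_nonneg_left h4 (Real.exp_pos _).le
      _ = slabTail γ (x + δ) * (Real.exp (-(Λ * δ)) * Real.exp (Λ * δ)) := by ring
      _ = _ := by rw [← Real.exp_add]; simp
  have h6 : 1 - ε / 2 ≤ (K / (1 + K)) ^ 2 := by
    have e1 : K / (1 + K) = 8 / (ε + 8) := by rw [hK]; field_simp
    rw [e1, div_pow, le_div_iff₀ (by positivity)]
    nlinarith [mul_pos hε hε, mul_pos (mul_pos hε hε) hε]
  calc (1 - ε) * slabTail γ x ≤ (1 - ε / 2) * ((1 - ε / 2) * slabTail γ x) := by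
        nlinarith [h.slabTail_pos x, sq_nonneg ε]
    _ ≤ (1 - ε / 2) * slabTail γ (x + δ) := mul_le_mul_of_nonneg_left h5 (by linarith)
    _ ≤ (K / (1 + K)) ^ 2 * slabTail γ (x + δ) :=
        mul_le_mul_of_nonneg_right h6 (h.slabTail_pos _).le
    _ ≤ _ := h3

lemma drift_integrand_le (h : Slab γ Λ T) {w : ℝ} (hw : 0 < w) (hw1 : w ≤ 1 / 2) (u : ℝ) :
    w * (beta γ u ^ 2 / (1 + w * beta γ u)) * phi u ≤
      2 * w * phi u + min 1 (w * lr γ u) * slabMarginal γ u := by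
  have hp := h.one_add_pos hw.le (by linarith) u
  have hphi := phi_pos u
  have hl := h.lr_pos u
  have hlr : lr γ u = beta γ u + 1 := by rw [beta_eq]; ring
  have hb := h.neg_one_lt_beta u
  rw [← lr_mul_phi, ← mul_assoc, ← add_mul]
  refine mul_le_mul_of_nonneg_right ?_ hphi.le
  rcases le_or_gt 0 (beta γ u) with hb0 | hb0
  · have h1 : w * (beta γ u ^ 2 / (1 + w * beta γ u)) ≤ lr γ u := by
      rw [mul_div_assoc', div_le_iff₀ hp, hlr]
      nlinarith [mul_nonneg hw.le hb0]
    have h2 : w * (beta γ u ^ 2 / (1 + w * beta γ u)) ≤ w * lr γ u * lr γ u := by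
      rw [mul_div_assoc', div_le_iff₀ hp]
      have e1 : 1 ≤ 1 + w * beta γ u := by nlinarith
      have e2 : w * beta γ u ^ 2 ≤ w * lr γ u * lr γ u := by
        rw [mul_assoc, ← sq]
        refine mul_le_mul_of_nonneg_left (pow_le_pow_left₀ hb0 (by linarith) 2) hw.le
      have e3 : 0 ≤ w * lr γ u * lr γ u := by positivity
      nlinarith
    have h3 : w * (beta γ u ^ 2 / (1 + w * beta γ u)) ≤ min 1 (w * lr γ u) * lr γ u := by
      rcases min_choice 1 (w * lr γ u) with hm | hm <;> rw [hm]
      · linarith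
      · exact h2
    linarith
  · have h1 : w * (beta γ u ^ 2 / (1 + w * beta γ u)) ≤ 2 * w := by
      rw [mul_div_assoc', div_le_iff₀ hp]
      have e1 : beta γ u ^ 2 ≤ 1 := by nlinarith
      have e2 : 1 / 2 ≤ 1 + w * beta γ u := by nlinarith
      nlinarith
    have h3 : 0 ≤ min 1 (w * lr γ u) * lr γ u := by positivity
    linarith

/-- The factor min(1, w lr) is replaced by 1 on |u| ≥ q, by w lr(q) on p ≤ |u| < q, and by w lr(p)
below; the term 2w covers the region where β is negative. -/
lemma drift_le_three_terms (h : Slab γ Λ T) {w p q : ℝ} (hw : 0 < w) (hw1 : w ≤ 1 / 2) :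
    drift γ w ≤ 2 * w + (slabTail γ q + w * lr γ q * slabTail γ p + w * lr γ p) := by
  have hlq := h.lr_pos q
  have hlp := h.lr_pos p
  have hI : ∀ y : ℝ, Integrable ({u : ℝ | y ≤ |u|}.indicator (slabMarginal γ)) := fun y =>
    h.integrable_g.indicator (measurableSet_tail y)
  have hval : ∀ y : ℝ, ∫ u, {u : ℝ | y ≤ |u|}.indicator (slabMarginal γ) u = slabTail γ y :=
    fun y => integral_indicator (measurableSet_tail y)
  have hF : Integrable fun u => 2 * w * phi u + ({u : ℝ | q ≤ |u|}.indicator (slabMarginal γ) u +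
      w * lr γ q * {u : ℝ | p ≤ |u|}.indicator (slabMarginal γ) u +
      w * lr γ p * slabMarginal γ u) :=
    (integrable_phi.const_mul _).add
      (((hI q).add ((hI p).const_mul _)).add (h.integrable_g.const_mul _))
  have hle : drift γ w ≤ ∫ u, 2 * w * phi u + ({u : ℝ | q ≤ |u|}.indicator (slabMarginal γ) u +
      w * lr γ q * {u : ℝ | p ≤ |u|}.indicator (slabMarginal γ) u +
      w * lr γ p * slabMarginal γ u) := by
    rw [h.drift_eq_volume hw hw1]
    refine integral_mono (h.integrable_drift_volume hw hw1) hF fun u => ?_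
    refine (h.drift_integrand_le hw hw1 u).trans ?_
    have hg := h.g_pos u
    have i1 : 0 ≤ {u : ℝ | q ≤ |u|}.indicator (slabMarginal γ) u :=
      indicator_nonneg (fun _ _ => (h.g_pos _).le) _
    have i2 : 0 ≤ {u : ℝ | p ≤ |u|}.indicator (slabMarginal γ) u :=
      indicator_nonneg (fun _ _ => (h.g_pos _).le) _
    have i3 : 0 ≤ w * lr γ q * {u : ℝ | p ≤ |u|}.indicator (slabMarginal γ) u := by positivity
    have i4 : 0 ≤ w * lr γ p * slabMarginal γ u := by positivity
    refine add_le_add le_rfl ?_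
    by_cases hq : q ≤ |u|
    · have : min 1 (w * lr γ u) * slabMarginal γ u ≤ 1 * slabMarginal γ u :=
        mul_le_mul_of_nonneg_right (min_le_left _ _) hg.le
      rw [indicator_of_mem (show u ∈ {u : ℝ | q ≤ |u|} from hq)]
      linarith
    · have h1 : lr γ u ≤ lr γ q := h.lr_le_lr ((not_le.1 hq).le.trans (le_abs_self q))
      by_cases hpu : p ≤ |u|
      · have : min 1 (w * lr γ u) * slabMarginal γ u ≤ w * lr γ q * slabMarginal γ u :=
          mul_le_mul_of_nonneg_right ((min_le_right _ _).trans
            (mul_le_mul_of_nonneg_left h1 hw.le)) hg.le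
        rw [indicator_of_mem (show u ∈ {u : ℝ | p ≤ |u|} from hpu)]
        linarith
      · have h2 : lr γ u ≤ lr γ p := h.lr_le_lr ((not_le.1 hpu).le.trans (le_abs_self p))
        have : min 1 (w * lr γ u) * slabMarginal γ u ≤ w * lr γ p * slabMarginal γ u :=
          mul_le_mul_of_nonneg_right ((min_le_right _ _).trans
            (mul_le_mul_of_nonneg_left h2 hw.le)) hg.le
        linarith
  refine hle.trans (le_of_eq ?_)
  rw [integral_add, integral_add, integral_add, integral_const_mul, integral_const_mul,
    integral_const_mul, hval, hval, integral_phi, h.integral_g]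
  · ring
  · exact hI q
  · exact (hI p).const_mul _
  · exact (hI q).add ((hI p).const_mul _)
  · exact h.integrable_g.const_mul _
  · exact integrable_phi.const_mul _
  · exact ((hI q).add ((hI p).const_mul _)).add (h.integrable_g.const_mul _)

lemma mul_lr_sub_le (h : Slab γ Λ T) {c x w d : ℝ} (hd : 0 ≤ d) (hdx : d ≤ x)
    (hw : 0 < w) (hcw : w * slabTail γ x ≤ c * nullTail x) :
    w * lr γ (x - d) ≤ c * Real.exp (-(d * (x - d - Λ))) := by
  have hx0 : 0 ≤ x := hd.trans hdx
  have h1 := h.lr_mul_nullTail_le x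
  rw [abs_of_nonneg hx0] at h1
  have h2 : w * lr γ x ≤ c := by
    have : w * lr γ x * nullTail x ≤ c * nullTail x := by
      rw [mul_assoc]; exact (mul_le_mul_of_nonneg_left h1 hw.le).trans hcw
    exact le_of_mul_le_mul_right this (nullTail_pos x)
  have h3 := h.lr_mul_exp_le (x := x - d) hd
  rw [sub_add_cancel] at h3
  calc w * lr γ (x - d) = w * (lr γ (x - d) * Real.exp ((x - d) * d - Λ * d)) *
        Real.exp (-(d * (x - d - Λ))) := by
        rw [mul_assoc, mul_assoc, ← Real.exp_add]; ring_nf; simp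
    _ ≤ w * lr γ x * Real.exp (-(d * (x - d - Λ))) := by gcongr
    _ ≤ _ := mul_le_mul_of_nonneg_right h2 (Real.exp_pos _).le

/-- The three terms are cut at x - D and x - δ. The tail of g barely changes between x - δ and x; in
the middle band w lr is of order exp(-δx), while slabTail grows only by the constant exp(ΛD). -/
lemma drift_le_slabTail (h : Slab γ Λ T) {c ε : ℝ} (hc : 0 < c) (hε : 0 < ε) (hε1 : ε < 1) :
    ∃ Y, ∀ x, Y ≤ x → ∀ w, 0 < w → w ≤ 1 / 2 → w * slabTail γ x ≤ c * nullTail x →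
      drift γ w ≤ (1 + ε) * slabTail γ x := by
  have hΛ := h.one_le
  have hg0 := h.g_pos 0
  set δ := ε / (4 * Λ) with hδ
  have hδ0 : 0 < δ := by positivity
  have hΛδ : Λ * δ = ε / 4 := by rw [hδ]; field_simp
  have hδ1 : δ ≤ 1 := by nlinarith
  -- w lr(x - D) is at most of order exp(-Dx), that is exp(-x) times the lower bound exp(-Λx) for
  -- slabTail, up to constants.
  set D := Λ + 1 with hD
  have t1 : Tendsto (fun x : ℝ => c * Real.exp (-(δ * (x - δ - Λ))) * Real.exp (Λ * D)) atTop
      (𝓝 (c * 0 * Real.exp (Λ * D))) := by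
    refine ((Real.tendsto_exp_neg_atTop_nhds_zero.comp ?_).const_mul c).mul_const _
    refine Tendsto.const_mul_atTop hδ0 ?_
    simp_rw [sub_eq_add_neg]
    exact tendsto_atTop_add_const_right _ _ (tendsto_atTop_add_const_right _ _ tendsto_id)
  have t2 : Tendsto (fun x : ℝ => 3 * c * Real.exp (D * (D + Λ) + Λ) / slabMarginal γ 0 *
      Real.exp (-x)) atTop
      (𝓝 (3 * c * Real.exp (D * (D + Λ) + Λ) / slabMarginal γ 0 * 0)) :=
    Real.tendsto_exp_neg_atTop_nhds_zero.const_mul _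
  rw [mul_zero, zero_mul] at t1
  rw [mul_zero] at t2
  have ev : ∀ᶠ x : ℝ in atTop, c * Real.exp (-(δ * (x - δ - Λ))) * Real.exp (Λ * D) ≤ ε / 4 ∧
      3 * c * Real.exp (D * (D + Λ) + Λ) / slabMarginal γ 0 * Real.exp (-x) ≤ ε / 4 ∧
      1 ≤ lr γ (x - D) ∧ D + 1 ≤ x := by
    have e3 : Tendsto (fun x : ℝ => lr γ (x - D)) atTop atTop := by
      refine h.tendsto_lr.comp ?_
      simp_rw [sub_eq_add_neg]
      exact tendsto_atTop_add_const_right _ _ tendsto_id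
    filter_upwards [t1.eventually_le_const (by positivity : (0 : ℝ) < ε / 4),
      t2.eventually_le_const (by positivity : (0 : ℝ) < ε / 4), e3.eventually_ge_atTop 1,
      eventually_ge_atTop (D + 1)] with x a1 a2 a3 a4
    exact ⟨a1, a2, a3, a4⟩
  obtain ⟨Y, hY⟩ := eventually_atTop.1 ev
  refine ⟨Y, fun x hx w hw hw1 hcw => ?_⟩
  obtain ⟨a1, a2, a3, a4⟩ := hY x hx
  have hx0 : 0 < x := by linarith
  have hS := h.slabTail_pos x
  have b0 := h.drift_le_three_terms hw hw1 (p := x - D) (q := x - δ)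
  have b1 := h.mul_lr_sub_le hδ0.le (by linarith) hw hcw
  have b2 := h.mul_lr_sub_le (by linarith : 0 ≤ D) (by linarith) hw hcw
  have b3 := h.slabTail_le_mul_exp (y := x - δ) (by linarith) hδ0.le
  have b4 := h.slabTail_le_mul_exp (y := x - D) (by linarith) (by linarith : 0 ≤ D)
  rw [sub_add_cancel] at b3 b4
  have c1 : slabTail γ (x - δ) ≤ (1 + ε / 2) * slabTail γ x := by
    have e1 : Real.exp (Λ * δ) ≤ 1 + ε / 2 := by
      rw [hΛδ]
      have e2 := Real.add_one_le_exp (-(ε / 4))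
      have e3 : Real.exp (ε / 4) * Real.exp (-(ε / 4)) = 1 := by rw [← Real.exp_add]; simp
      have e4 := Real.exp_pos (ε / 4)
      nlinarith
    calc _ ≤ _ := b3
      _ ≤ slabTail γ x * (1 + ε / 2) := mul_le_mul_of_nonneg_left e1 hS.le
      _ = _ := mul_comm _ _
  have c2 : w * lr γ (x - δ) * slabTail γ (x - D) ≤ ε / 4 * slabTail γ x := by
    calc w * lr γ (x - δ) * slabTail γ (x - D)
        ≤ c * Real.exp (-(δ * (x - δ - Λ))) * (slabTail γ x * Real.exp (Λ * D)) :=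
          mul_le_mul b1 b4 (h.slabTail_pos _).le (by positivity)
      _ = c * Real.exp (-(δ * (x - δ - Λ))) * Real.exp (Λ * D) * slabTail γ x := by ring
      _ ≤ _ := mul_le_mul_of_nonneg_right a1 hS.le
  have c3 : 2 * w + w * lr γ (x - D) ≤ ε / 4 * slabTail γ x := by
    have e1 : 2 * w ≤ 2 * (w * lr γ (x - D)) := by nlinarith
    have e2 := h.slabTail_pos_bound x
    have e3 := h.g_lip 0 x
    rw [zero_sub, abs_neg, abs_of_pos hx0] at e3
    have e4 : slabMarginal γ 0 * Real.exp (-(Λ * x + Λ)) ≤ slabTail γ x := by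
      calc slabMarginal γ 0 * Real.exp (-(Λ * x + Λ))
          ≤ slabMarginal γ x * Real.exp (Λ * x) * Real.exp (-(Λ * x + Λ)) :=
            mul_le_mul_of_nonneg_right e3 (Real.exp_pos _).le
        _ = Real.exp (-Λ) * slabMarginal γ x := by
            rw [mul_assoc, ← Real.exp_add]; ring_nf
        _ ≤ _ := e2
    have e5 : c * Real.exp (-(D * (x - D - Λ))) =
        c * Real.exp (D * (D + Λ) + Λ) / slabMarginal γ 0 * Real.exp (-x) *
          (slabMarginal γ 0 * Real.exp (-(Λ * x + Λ))) := by
      have : Real.exp (-(D * (x - D - Λ))) =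
          Real.exp (D * (D + Λ) + Λ) * Real.exp (-x) * Real.exp (-(Λ * x + Λ)) := by
        rw [← Real.exp_add, ← Real.exp_add]; congr 1; rw [hD]; ring
      rw [this]; field_simp
    calc 2 * w + w * lr γ (x - D) ≤ 3 * (c * Real.exp (-(D * (x - D - Λ)))) := by linarith
      _ = 3 * c * Real.exp (D * (D + Λ) + Λ) / slabMarginal γ 0 * Real.exp (-x) *
          (slabMarginal γ 0 * Real.exp (-(Λ * x + Λ))) := by rw [e5]; ring
      _ ≤ ε / 4 * slabTail γ x := mul_le_mul a2 e4 (by positivity) (by positivity)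
  nlinarith

/-- The null rejection probability of the `q`-value procedure is asymptotically proportional to
`w · drift w`. -/
lemma null_qValue_prob (h : Slab γ Λ T) {t ε : ℝ} (ht : t ∈ Ioo (0 : ℝ) 1) (hε : 0 < ε) :
    ∃ w₀, 0 < w₀ ∧ w₀ ≤ 1 / 2 ∧ ∀ w, 0 < w → w ≤ w₀ →
      MeasurableSet {x | qValue γ w x ≤ t} ∧
      |(gaussianReal 0 1).real {x | qValue γ w x ≤ t} - t / (1 - t) * (w * drift γ w)| ≤
        ε * (w * drift γ w) := by
  obtain ⟨ht0, ht1⟩ := ht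
  have h1t : 0 < 1 - t := by linarith
  set c := t / (1 - t) with hc
  have hc0 : 0 < c := by positivity
  set ε₁ := min (1 / 2) (ε / (4 * c)) with hε₁
  have hε₁0 : 0 < ε₁ := by positivity
  have hε₁2 : ε₁ ≤ 1 / 2 := min_le_left _ _
  have hε₁c : 2 * c * ε₁ ≤ ε / 2 := by
    have : ε₁ ≤ ε / (4 * c) := min_le_right _ _
    rw [le_div_iff₀ (by positivity)] at this
    linarith
  obtain ⟨Y1, hY1⟩ := h.drift_ge_slabTail (c := (1 - t) / (2 * t)) (by positivity) hε₁0
    (by linarith)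
  obtain ⟨Y2, hY2⟩ := h.drift_le_slabTail (c := (1 - t) / t) (by positivity) hε₁0 (by linarith)
  obtain ⟨R, hR, hRχ⟩ := h.exists_tail_ratio_eq (max (max Y1 Y2) (Λ + 1))
  refine ⟨min (1 / 2) (min ((1 - t) / (2 * t * R)) (ε / (8 * c))), by positivity,
    min_le_left _ _, fun w hw hww => ?_⟩
  have hw2 : w ≤ 1 / 2 := hww.trans (min_le_left _ _)
  have hwR : w ≤ (1 - t) / (2 * t * R) := hww.trans ((min_le_right _ _).trans (min_le_left _ _))
  have hwc : 4 * c * w ≤ ε / 2 := by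
    have : w ≤ ε / (8 * c) := hww.trans ((min_le_right _ _).trans (min_le_right _ _))
    rw [le_div_iff₀ (by positivity)] at this
    linarith
  set r := (1 - w) * (1 - t) / (t * w) with hr
  have hRr : R ≤ r := by
    rw [le_div_iff₀ (by positivity)] at hwR
    rw [hr, le_div_iff₀ (by positivity)]
    nlinarith
  obtain ⟨χ, hχ, hχr⟩ := hRχ r hRr
  have hχΛ : Λ < χ := by linarith [(le_max_right (max Y1 Y2) (Λ + 1)).trans hχ]
  have hset : {x | qValue γ w x ≤ t} = {x | χ ≤ |x|} := by
    ext x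
    rw [mem_ofPred_eq, mem_ofPred_eq, h.qValue_le_iff hw (by linarith),
      ← h.tail_ratio_iff hχΛ hχr (abs_nonneg x), hr, div_mul_eq_mul_div,
      div_le_iff₀ (by positivity)]
    constructor <;> intro hh <;> linarith
  rw [hset, ← nullTail_eq]
  refine ⟨measurableSet_tail χ, ?_⟩
  set S := slabTail γ χ with hSdef
  have hS : 0 < S := h.slabTail_pos χ
  set N := nullTail χ with hNdef
  have hN : 0 < N := nullTail_pos χ
  have hwS : w * S = (1 - w) * ((1 - t) / t) * N := by
    rw [hχr, hr]; field_simp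
  -- Thus N - c w d = c w (S - d) + w N: the first term is small because the drift d is asymptotic
  -- to S, the second because w is small.
  have hNS : (1 - w) * N = c * (w * S) := by
    rw [hwS, hc]; field_simp
  have d1 := hY1 χ (((le_max_left _ _).trans (le_max_left _ _)).trans hχ) w hw hw2 (by
    rw [← hSdef, ← hNdef, hwS]
    refine mul_le_mul_of_nonneg_right ?_ hN.le
    have : 0 < (1 - t) / t := by positivity
    have e : (1 - t) / (2 * t) = (1 - t) / t / 2 := by field_simp
    rw [e]; nlinarith)
  have d2 := hY2 χ (((le_max_right _ _).trans (le_max_left _ _)).trans hχ) w hw hw2 (by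
    rw [← hSdef, ← hNdef, hwS]
    refine mul_le_mul_of_nonneg_right ?_ hN.le
    have : 0 < (1 - t) / t := by positivity
    nlinarith)
  rw [← hSdef] at d1 d2
  set d := drift γ w with hd
  have hSd : S ≤ 2 * d := by nlinarith
  have hd0 : 0 < d := by linarith
  have hN4 : N ≤ 4 * c * (w * d) := by
    have e1 : N ≤ 2 * ((1 - w) * N) := by nlinarith
    have e2 : c * (w * S) ≤ c * (w * (2 * d)) := by gcongr
    linarith
  have hA : |c * (w * S) - c * (w * d)| ≤ 2 * c * ε₁ * (w * d) := by
    have e1 : |S - d| ≤ ε₁ * S := by rw [abs_le]; constructor <;> linarith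
    have e2 : ε₁ * S ≤ ε₁ * (2 * d) := mul_le_mul_of_nonneg_left hSd hε₁0.le
    calc |c * (w * S) - c * (w * d)| = c * w * |S - d| := by
          rw [← mul_sub, ← mul_sub, abs_mul, abs_mul, abs_of_pos hc0, abs_of_pos hw]; ring
      _ ≤ c * w * (ε₁ * (2 * d)) := mul_le_mul_of_nonneg_left (e1.trans e2) (by positivity)
      _ = _ := by ring
  have hwd : 0 < w * d := mul_pos hw hd0
  have hB : w * N ≤ ε / 2 * (w * d) := by
    calc w * N ≤ w * (4 * c * (w * d)) := mul_le_mul_of_nonneg_left hN4 hw.le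
      _ = 4 * c * w * (w * d) := by ring
      _ ≤ _ := mul_le_mul_of_nonneg_right hwc hwd.le
  have hA' : 2 * c * ε₁ * (w * d) ≤ ε / 2 * (w * d) := mul_le_mul_of_nonneg_right hε₁c hwd.le
  have hA1 := abs_le.1 (hA.trans hA')
  have hwN : 0 < w * N := mul_pos hw hN
  rw [abs_le]
  constructor <;> nlinarith [hA1.1, hA1.2]

end Slab

/-- The false negative proportion. -/
noncomputable def fnp {n : ℕ} (θ : Fin n → ℝ) (ψ : Fin n → ℝ) : ℝ :=
  (∑ i ∈ signals θ, (1 - ψ i)) / max 1 ((signals θ).card : ℝ)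

lemma FNR_eq {n : ℕ} (θ : Fin n → ℝ) (ψ : (Fin n → ℝ) → Fin n → ℝ) :
    FNR θ ψ = ∫ X, fnp θ (ψ X) ∂(law θ) := by
  rw [FNR]
  congr 1; ext X
  rw [fnp, signals, Finset.sum_filter, Finset.card_filter, Nat.cast_sum]
  congr 2
  exact Finset.sum_congr rfl fun i _ => by split_ifs <;> simp

lemma fnp_nonneg {n : ℕ} (θ : Fin n → ℝ) {ψ : Fin n → ℝ} (h1 : ∀ i, ψ i ≤ 1) : 0 ≤ fnp θ ψ :=
  div_nonneg (Finset.sum_nonneg fun i _ => by linarith [h1 i])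
    (zero_le_one.trans (le_max_left _ _))

lemma fnp_le_one {n : ℕ} (θ : Fin n → ℝ) {ψ : Fin n → ℝ} (h0 : ∀ i, 0 ≤ ψ i) : fnp θ ψ ≤ 1 := by
  rw [fnp, div_le_one (zero_lt_one.trans_le (le_max_left _ _))]
  refine le_trans ?_ (le_max_right _ _)
  calc ∑ i ∈ signals θ, (1 - ψ i) ≤ ∑ i ∈ signals θ, (1 : ℝ) :=
        Finset.sum_le_sum fun i _ => by linarith [h0 i]
    _ = _ := by simp

lemma ellProc_le_one (γ : ℝ → ℝ) (t : ℝ) {n : ℕ} (X : Fin n → ℝ) (i : Fin n) :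
    ellProc γ t n X i ≤ 1 := by
  unfold ellProc; split_ifs <;> norm_num

lemma qProc_le_one (γ : ℝ → ℝ) (t : ℝ) {n : ℕ} (X : Fin n → ℝ) (i : Fin n) :
    qProc γ t n X i ≤ 1 := by
  unfold qProc; split_ifs <;> norm_num

/-! ### Large signals: detection, and localisation of the estimator -/

lemma exceed_compl {n : ℕ} (s : Finset (Fin n)) (A : Set ℝ) (X : Fin n → ℝ) :
    exceed s Aᶜ X = s.card - exceed s A X := by
  rw [exceed, exceed, eq_sub_iff_add_eq, ← Finset.sum_add_distrib, Finset.card_eq_sum_ones,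
    Nat.cast_sum]
  refine Finset.sum_congr rfl fun i _ => ?_
  by_cases hi : X i ∈ A <;> simp [hi]

lemma card_nulls_le {n : ℕ} (θ : Fin n → ℝ) : ((nulls θ).card : ℝ) ≤ n := by
  have := card_nulls_add θ
  have : (0 : ℝ) ≤ (signals θ).card := Nat.cast_nonneg _
  linarith

/-- If each signal is detected with high probability, so are most signals. -/
lemma signals_detected {n : ℕ} (θ : Fin n → ℝ) {A : Set ℝ} (hA : MeasurableSet A) {ε S : ℝ}
    (hε : 0 < ε) (hS : 0 < S) (hcard : ((signals θ).card : ℝ) = S)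
    (hp : ∀ i ∈ signals θ, (gaussianReal (θ i) 1).real Aᶜ ≤ ε / 16) :
    (law θ).real {X | exceed (signals θ) A X < (1 - ε / 8) * S} ≤ 16 / (ε * S) := by
  have hmean : ∑ i ∈ signals θ, (gaussianReal (θ i) 1).real Aᶜ ≤ ε / 16 * S := by
    refine (Finset.sum_le_sum hp).trans (le_of_eq ?_)
    rw [Finset.sum_const, nsmul_eq_mul, hcard]; ring
  have hsub : {X | exceed (signals θ) A X < (1 - ε / 8) * S} ⊆
      {X | ε / 16 * S ≤ |exceed (signals θ) Aᶜ X -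
        ∑ i ∈ signals θ, (gaussianReal (θ i) 1).real Aᶜ|} := by
    intro X hX
    rw [mem_ofPred_eq] at hX ⊢
    refine le_trans ?_ (le_abs_self _)
    rw [exceed_compl, hcard]
    linarith
  refine (measureReal_mono hsub).trans
    ((exceed_chebyshev θ _ hA.compl (by positivity)).trans ?_)
  calc _ ≤ ε / 16 * S / (ε / 16 * S) ^ 2 := by gcongr
    _ = _ := by field_simp

namespace Slab

variable {γ : ℝ → ℝ} {Λ T : ℝ} {n : ℕ}

lemma procs_eq_one (h : Slab γ Λ T) (hn : 0 < n) {t w : ℝ} (ht : t ∈ Ioo (0 : ℝ) 1) (hw : 0 < w)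
    (X : Fin n → ℝ) (hle : w ≤ wHat γ X) {i : Fin n} (hi : 1 ≤ t * (w * lr γ (X i))) :
    ellProc γ t n X i = 1 ∧ qProc γ t n X i = 1 := by
  have hwm := h.wHat_mem hn X
  have hl := h.lr_pos (X i)
  have hŵ : 0 < wHat γ X := hw.trans_le hle
  have h1 : t * (w * lr γ (X i)) ≤ t * (wHat γ X * lr γ (X i)) :=
    mul_le_mul_of_nonneg_left (mul_le_mul_of_nonneg_right hle hl.le) ht.1.le
  have h2 : (1 - wHat γ X) * (1 - t) ≤ 1 := by nlinarith [ht.1, ht.2, hwm.2]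
  constructor
  · rw [ellProc, if_pos]
    rw [h.ellValue_le_iff hŵ hwm.2]
    linarith
  · rw [qProc, if_pos]
    rw [h.qValue_le_iff hŵ hwm.2]
    calc (1 - wHat γ X) * (1 - t) * nullTail |X i|
        ≤ t * (wHat γ X * lr γ (X i)) * nullTail |X i| :=
          mul_le_mul_of_nonneg_right (by linarith) (nullTail_pos _).le
      _ = t * (wHat γ X * (lr γ (X i) * nullTail |X i|)) := by ring
      _ ≤ _ := mul_le_mul_of_nonneg_left
          (mul_le_mul_of_nonneg_left (h.lr_mul_nullTail_le _) hŵ.le) ht.1.le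

/-- Brackets the rejections at the random ŵ between those at two deterministic weights. -/
lemma qValue_le_mono (h : Slab γ Λ T) {t w w' x : ℝ} (ht : t ∈ Ioo (0 : ℝ) 1) (hw : 0 < w)
    (hww : w ≤ w') (hw' : w' ≤ 1) (hx : qValue γ w x ≤ t) : qValue γ w' x ≤ t := by
  rw [h.qValue_le_iff hw (hww.trans hw')] at hx
  rw [h.qValue_le_iff (hw.trans_le hww) hw']
  have h1 : (1 - w') * (1 - t) * nullTail |x| ≤ (1 - w) * (1 - t) * nullTail |x| := by
    refine mul_le_mul_of_nonneg_right (mul_le_mul_of_nonneg_right (by linarith) ?_)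
      (nullTail_pos _).le
    linarith [ht.2]
  have h2 : t * (w * slabTail γ |x|) ≤ t * (w' * slabTail γ |x|) :=
    mul_le_mul_of_nonneg_left (mul_le_mul_of_nonneg_right hww (h.slabTail_pos _).le) ht.1.le
  linarith

lemma sum_integral_score_nulls (θ : Fin n → ℝ) (w : ℝ) :
    ∑ i ∈ nulls θ, ∫ x, score γ w x ∂(gaussianReal (θ i) 1) = -((nulls θ).card * drift γ w) := by
  have : ∀ i ∈ nulls θ, ∫ x, score γ w x ∂(gaussianReal (θ i) 1) = -drift γ w := by
    intro i hi
    rw [mem_nulls.1 hi, drift, neg_neg]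
  rw [Finset.sum_congr rfl this]; simp

lemma null_score_chebyshev (h : Slab γ Λ T) (θ : Fin n → ℝ) {w c : ℝ} (hw : 0 < w)
    (hw1 : w ≤ 1 / 2) (hc : 0 < c) :
    (law θ).real {X | c ≤ |∑ i ∈ nulls θ, score γ w (X i) + (nulls θ).card * drift γ w|} ≤
      2 * (n * drift γ w) / w / c ^ 2 := by
  have h1 := law_chebyshev θ (nulls θ) (h.continuous_score hw.le (by linarith)).measurable
    (h.abs_score_le hw hw1) hc
  simp only [sum_integral_score_nulls, sub_neg_eq_add] at h1
  refine h1.trans ?_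
  have hd := h.drift_pos hw hw1
  have : ∑ i ∈ nulls θ, ∫ x, score γ w x ^ 2 ∂(gaussianReal (θ i) 1) ≤
      2 * (n * drift γ w) / w := by
    calc ∑ i ∈ nulls θ, ∫ x, score γ w x ^ 2 ∂(gaussianReal (θ i) 1)
        ≤ ∑ i ∈ nulls θ, 2 * drift γ w / w := by
          refine Finset.sum_le_sum fun i hi => ?_
          rw [mem_nulls.1 hi]; exact h.integral_score_sq_le hw hw1
      _ = (nulls θ).card * (2 * drift γ w / w) := by simp
      _ ≤ n * (2 * drift γ w / w) := mul_le_mul_of_nonneg_right (card_nulls_le θ) (by positivity)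
      _ = _ := by ring
  gcongr

/-- With `n w drift(w)` slightly above the number of signals, the estimator is below `w`. -/
lemma wHat_lt_prob (h : Slab γ Λ T) (hn : 0 < n) (θ : Fin n → ℝ) {w ε S : ℝ} (hw : 1 / (n : ℝ) < w)
    (hw1 : w ≤ 1 / 2) (hε : 0 < ε) (hε1 : ε ≤ 1) (hS : 0 < S)
    (hcard : ((signals θ).card : ℝ) = S) (hSn : 4 * S ≤ ε * n)
    (hwd : n * (w * drift γ w) = (1 + ε) * S) :
    (law θ).real {X | w ≤ wHat γ X} ≤ 16 / (ε ^ 2 * S) := by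
  have hw0 : 0 < w := (one_div_natCast_mem hn).1.trans hw
  have hn0 : (0 : ℝ) < n := by exact_mod_cast hn
  have hd := h.drift_pos hw0 hw1
  have hsub : {X | w ≤ wHat γ X} ⊆
      {X | ε / 2 * S / w ≤ |∑ i ∈ nulls θ, score γ w (X i) + (nulls θ).card * drift γ w|} := by
    intro X hX
    have h1 := (h.le_wHat_iff hn X hw (by linarith)).1 hX
    rw [likScore, ← sum_nulls_add_sum_signals θ] at h1
    -- The signals offer at most S/w, while the mean null loss is at least (1 + ε/2) S/w; a
    -- nonnegative total needs a null deviation of (ε/2) S/w.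
    have h2 : ∑ i ∈ signals θ, score γ w (X i) ≤ S / w := by
      calc _ ≤ ∑ i ∈ signals θ, 1 / w :=
            Finset.sum_le_sum fun i _ => h.score_le_inv hw0 (by linarith) _
        _ = _ := by rw [Finset.sum_const, nsmul_eq_mul, hcard]; ring
    have h3 : (1 + ε / 2) * S / w ≤ (nulls θ).card * drift γ w := by
      have e1 : ((nulls θ).card : ℝ) = n - S := by rw [← hcard]; linarith [card_nulls_add θ]
      rw [div_le_iff₀ hw0, e1]
      have e2 : (n - S) * drift γ w * w = (1 + ε) * S - S * (w * drift γ w) := by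
        rw [← hwd]; ring
      have e3 : w * drift γ w ≤ (1 + ε) * (ε / 4) := by
        have : n * (w * drift γ w) ≤ n * ((1 + ε) * (ε / 4)) := by
          rw [hwd]; linarith [mul_le_mul_of_nonneg_left hSn (by linarith : 0 ≤ 1 + ε)]
        exact le_of_mul_le_mul_left this hn0
      rw [e2]
      have e4 : S * (w * drift γ w) ≤ S * (ε / 2) := by
        refine mul_le_mul_of_nonneg_left (e3.trans ?_) hS.le
        linarith [mul_le_mul_of_nonneg_left hε1 hε.le]
      linarith
    rw [mem_ofPred_eq]
    refine le_trans ?_ (le_abs_self _)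
    have e5 : (1 + ε / 2) * S / w = S / w + ε / 2 * S / w := by ring
    linarith
  refine (measureReal_mono hsub).trans
    ((h.null_score_chebyshev θ hw0 hw1 (by positivity)).trans ?_)
  have e : 2 * (n * drift γ w) / w = 2 * ((1 + ε) * S) / w ^ 2 := by
    rw [← hwd]; field_simp
  rw [e]
  calc 2 * ((1 + ε) * S) / w ^ 2 / (ε / 2 * S / w) ^ 2 = 8 * (1 + ε) / (ε ^ 2 * S) := by
        field_simp; norm_num
    _ ≤ _ := by gcongr; linarith

/-- With `n w drift(w)` slightly below the number of clearly visible signals, the estimator is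
above `w`. -/
lemma lt_wHat_prob (h : Slab γ Λ T) (hn : 0 < n) (θ : Fin n → ℝ) {w ε S κ : ℝ}
    (hw : 1 / (n : ℝ) < w) (hw1 : w ≤ 1 / 2) (hε : 0 < ε) (hε1 : ε ≤ 1) (hS : 0 < S)
    (hκ : 4 / ε ≤ κ) (hcard : ((signals θ).card : ℝ) = S)
    (hwd : n * (w * drift γ w) = (1 - ε) * S) :
    (law θ).real {X | wHat γ X < w ∧
      (1 - ε / 8) * S ≤ exceed (signals θ) {x | κ ≤ w * beta γ x} X} ≤ 32 / (ε ^ 2 * S) := by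
  have hw0 : 0 < w := (one_div_natCast_mem hn).1.trans hw
  have hn0 : (0 : ℝ) < n := by exact_mod_cast hn
  have hd := h.drift_pos hw0 hw1
  set A := {x | κ ≤ w * beta γ x} with hA
  have hsub : {X | wHat γ X < w ∧ (1 - ε / 8) * S ≤ exceed (signals θ) A X} ⊆
      {X | ε / 4 * S / w ≤ |∑ i ∈ nulls θ, score γ w (X i) + (nulls θ).card * drift γ w|} := by
    rintro X ⟨hX, hR⟩
    have h1 : likScore γ X w < 0 := by
      by_contra hcon
      exact absurd ((h.le_wHat_iff hn X hw (by linarith)).2 (not_lt.1 hcon)) (not_le.2 hX)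
    rw [likScore, ← sum_nulls_add_sum_signals θ] at h1
    have h2 : (1 - ε / 2) * S / w ≤ ∑ i ∈ signals θ, score γ w (X i) := by
      -- On `A`, wβ ≥ 4/ε gives score ≥ (1 - ε/4)/w; elsewhere score ≥ -1/w. One affine function of
      -- the indicator covers both cases.
      have e1 : ∀ x, ((2 - ε / 4) * A.indicator (fun _ => (1 : ℝ)) x - 1) / w ≤ score γ w x := by
        intro x
        have hp := h.one_add_pos hw0.le (by linarith) x
        by_cases hx : x ∈ A
        · rw [indicator_of_mem hx, score, div_le_div_iff₀ hw0 hp]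
          have hxA : 4 / ε ≤ w * beta γ x := hκ.trans hx
          rw [div_le_iff₀ hε] at hxA
          linarith
        · rw [indicator_of_notMem hx]
          have := (abs_le.1 (h.abs_score_le hw0 hw1 x)).1
          have e : ((2 - ε / 4) * 0 - 1) / w = -(1 / w) := by ring
          linarith
      have e2 : ((2 - ε / 4) * exceed (signals θ) A X - S) / w ≤
          ∑ i ∈ signals θ, score γ w (X i) := by
        refine le_trans (le_of_eq ?_) (Finset.sum_le_sum fun i _ => e1 (X i))
        rw [← Finset.sum_div, Finset.sum_sub_distrib, ← Finset.mul_sum, exceed, ← hcard]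
        simp
      refine le_trans ?_ e2
      refine div_le_div_of_nonneg_right ?_ hw0.le
      linarith [mul_le_mul_of_nonneg_left hR (by linarith : 0 ≤ 2 - ε / 4), mul_pos hε hS,
        mul_pos (mul_pos hε hε) hS]
    have h3 : (nulls θ).card * drift γ w ≤ (1 - ε) * S / w := by
      rw [le_div_iff₀ hw0, ← hwd]
      have := mul_le_mul_of_nonneg_right (card_nulls_le θ) (mul_pos hw0 hd).le
      linarith
    rw [mem_ofPred_eq]
    refine le_trans ?_ (neg_le_abs _)
    have e5 : (1 - ε / 2) * S / w = (1 - ε) * S / w + 2 * (ε / 4 * S / w) := by ring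
    have e6 : 0 < ε / 4 * S / w := by positivity
    linarith
  refine (measureReal_mono hsub).trans
    ((h.null_score_chebyshev θ hw0 hw1 (by positivity)).trans ?_)
  have e : 2 * (n * drift γ w) / w = 2 * ((1 - ε) * S) / w ^ 2 := by
    rw [← hwd]; field_simp
  rw [e]
  calc 2 * ((1 - ε) * S) / w ^ 2 / (ε / 4 * S / w) ^ 2 = 32 * (1 - ε) / (ε ^ 2 * S) := by
        field_simp; ring
    _ ≤ _ := by gcongr; linarith

/-- Signals above the detection boundary are visible at every relevant level. -/
lemma signal_visible (h : Slab γ Λ T) {a D κ : ℝ} (ha : 1 < a) (hD : 0 < D) (hκ : 0 < κ) :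
    ∃ ρ₀, 0 ≤ ρ₀ ∧ ∀ ρ θ w : ℝ, ρ₀ ≤ ρ → a * ρ ≤ |θ| → 0 < w → w ≤ 1 →
      1 / w ≤ 4 * Real.exp (ρ ^ 2 / 2) →
      (gaussianReal θ 1).real {x | κ ≤ w * beta γ x}ᶜ ≤ 2 / D := by
  have hg0 := h.g_pos 0
  have hΛ := h.one_le
  have ht : Tendsto (fun ρ : ℝ => ρ * ((a ^ 2 - 1) / 2 * ρ - a * (D + Λ))) atTop atTop := by
    refine tendsto_id.atTop_mul_atTop₀ ?_
    simp_rw [sub_eq_add_neg]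
    exact tendsto_atTop_add_const_right _ _ (Tendsto.const_mul_atTop (by nlinarith) tendsto_id)
  obtain ⟨ρ₀, hρ₀⟩ := eventually_atTop.1
    (ht.eventually_ge_atTop (Real.log (4 * (κ + 1) / slabMarginal γ 0)))
  refine ⟨max (max ρ₀ D) 0, le_max_right _ _, fun ρ θ w hρ hθ hw hw1 hwρ => ?_⟩
  have hρ1 : ρ₀ ≤ ρ := ((le_max_left _ _).trans (le_max_left _ _)).trans hρ
  have hρD : D ≤ ρ := ((le_max_right _ _).trans (le_max_left _ _)).trans hρ
  have hρ0 : 0 < ρ := hD.trans_le hρD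
  -- An observation within D of θ has |x| ≥ y. Since a > 1, lr(y), which is at least of order
  -- exp(y²/2 - Λy), outgrows exp(ρ²/2) and hence 1/w.
  set y := a * ρ - D with hy
  have hy0 : 0 ≤ y := by linarith [mul_le_mul_of_nonneg_right ha.le hρ0.le]
  have h1 : 4 * (κ + 1) / slabMarginal γ 0 * Real.exp (ρ ^ 2 / 2) ≤
      Real.exp (y ^ 2 / 2 - Λ * y) := by
    rw [← Real.exp_log (by positivity : 0 < 4 * (κ + 1) / slabMarginal γ 0), ← Real.exp_add]
    refine Real.exp_le_exp.2 ?_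
    have := hρ₀ ρ hρ1
    have e : y ^ 2 / 2 - Λ * y = ρ * ((a ^ 2 - 1) / 2 * ρ - a * (D + Λ)) + ρ ^ 2 / 2 +
        (D ^ 2 / 2 + Λ * D) := by rw [hy]; ring
    have : 0 ≤ D ^ 2 / 2 + Λ * D := by positivity
    linarith
  have h2 : (κ + 1) / w ≤ lr γ y := by
    have e1 := h.le_lr y
    rw [abs_of_nonneg hy0] at e1
    calc (κ + 1) / w = (κ + 1) * (1 / w) := by ring
      _ ≤ (κ + 1) * (4 * Real.exp (ρ ^ 2 / 2)) := mul_le_mul_of_nonneg_left hwρ (by linarith)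
      _ = slabMarginal γ 0 * (4 * (κ + 1) / slabMarginal γ 0 * Real.exp (ρ ^ 2 / 2)) := by
          field_simp
      _ ≤ slabMarginal γ 0 * Real.exp (y ^ 2 / 2 - Λ * y) := mul_le_mul_of_nonneg_left h1 hg0.le
      _ ≤ _ := e1
  have hsub : {x | κ ≤ w * beta γ x}ᶜ ⊆ (fun x => -θ + x) ⁻¹' {u | D ≤ |u|} := by
    intro x hx
    by_contra hcon
    apply hx
    have hlt : |-θ + x| < D := not_le.1 hcon
    have e1 : |θ| - |x| ≤ |-θ + x| := by
      rw [neg_add_eq_sub, abs_sub_comm]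
      exact abs_sub_abs_le_abs_sub θ x
    have e2 : |y| ≤ |x| := by rw [abs_of_nonneg hy0]; linarith
    have e3 := h2.trans (h.lr_le_lr e2)
    rw [div_le_iff₀ hw] at e3
    show κ ≤ w * beta γ x
    rw [beta_eq]
    linarith
  refine (measureReal_mono hsub).trans ?_
  rw [← map_measureReal_apply (by fun_prop) (measurableSet_tail D), gaussianReal_map_const_add,
    add_neg_cancel, ← nullTail_eq]
  refine (nullTail_le hD).trans ?_
  rw [mul_div_assoc']
  have := phi_le_one D
  gcongr
  linarith

/-- A weight at which the null drift balances a given multiple of the number of signals. -/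
lemma exists_weight (h : Slab γ Λ T) {υ : ℝ} (hυ : υ ∈ Ioo (0 : ℝ) 1) {s : ℕ → ℕ}
    (hs : Tendsto s atTop atTop) (hsn : ∀ n : ℕ, 1 ≤ n → (s n : ℝ) ≤ (n : ℝ) ^ υ) {w₀ c : ℝ}
    (hw₀ : 0 < w₀) (hw₀1 : w₀ ≤ 1 / 2) (hc : 0 < c) :
    ∀ᶠ n : ℕ in atTop, ∃ w, 1 / (n : ℝ) < w ∧ w ≤ w₀ ∧ n * (w * drift γ w) = c * s n := by
  have hd₀ := h.drift_pos hw₀ hw₀1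
  have hs' : Tendsto (fun n => (s n : ℝ)) atTop atTop := tendsto_natCast_atTop_atTop.comp hs
  filter_upwards [eventually_gt_atTop 0, hs'.eventually_gt_atTop (2 / c),
    eventually_rpow_le_mul hυ.2 (by positivity : 0 < w₀ * drift γ w₀ / c),
    tendsto_natCast_atTop_atTop.eventually_ge_atTop (1 / w₀)] with n hn hsc hns hnw
  have hn0 : (0 : ℝ) < n := by exact_mod_cast hn
  have h1n : 1 / (n : ℝ) ≤ w₀ := by
    rw [div_le_iff₀ hw₀] at hnw
    rw [div_le_iff₀ hn0]; linarith
  rw [div_lt_iff₀ hc] at hsc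
  have hcont : ContinuousOn (fun w => n * (w * drift γ w)) (Icc (1 / (n : ℝ)) w₀) :=
    continuousOn_const.mul (continuousOn_id.mul
      ((h.continuousOn_drift (one_div_pos.2 hn0)).mono (Icc_subset_Icc_right hw₀1)))
  -- At w = 1/n the quantity is just the drift, at most 2, while c s tends to infinity; at w₀ it is
  -- linear in n and beats n^υ. The intermediate value theorem does the rest.
  have hlow : n * (1 / (n : ℝ) * drift γ (1 / (n : ℝ))) < c * s n := by
    have e : n * (1 / (n : ℝ) * drift γ (1 / (n : ℝ))) = drift γ (1 / (n : ℝ)) := by field_simp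
    rw [e]
    linarith [h.drift_le_two (one_div_pos.2 hn0) (h1n.trans hw₀1)]
  have hhigh : c * s n ≤ n * (w₀ * drift γ w₀) := by
    calc c * s n ≤ c * (w₀ * drift γ w₀ / c * n) :=
          mul_le_mul_of_nonneg_left ((hsn n hn).trans hns) hc.le
      _ = _ := by field_simp
  obtain ⟨w, hw, hwe⟩ := intermediate_value_Icc h1n hcont ⟨hlow.le, hhigh⟩
  refine ⟨w, lt_of_le_of_ne hw.1 fun hne => ?_, hw.2, hwe⟩
  rw [← hne] at hwe
  exact hlow.ne hwe

/-- Concentration of the number of nulls rejected by the `q`-value procedure at a fixed weight. -/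
lemma null_qValue_count (θ : Fin n → ℝ) {A : Set ℝ} (hA : MeasurableSet A) {c ε S f B : ℝ}
    (hε : 0 < ε) (hε1 : ε ≤ 1 / 2) (hc : 0 < c) (hS : 0 < S)
    (hcard : ((signals θ).card : ℝ) = S) (hSn : 4 * S ≤ ε * n)
    (hN : |(gaussianReal 0 1).real A - c * f| ≤ ε * f)
    (hlow : (1 - ε) * S ≤ n * f) (hhigh : n * f ≤ (1 + ε) * S) (hB : B = 4 + 3 * c) :
    (law θ).real {X | ε * B * S < |exceed (nulls θ) A X - c * S|} ≤
      2 * (c + 1) / (ε ^ 2 * S) := by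
  set p := (gaussianReal 0 1).real A with hp
  have hp0 : 0 ≤ p := measureReal_nonneg
  have hsum : ∑ i ∈ nulls θ, (gaussianReal (θ i) 1).real A = (nulls θ).card * p := by
    rw [← nsmul_eq_mul, ← Finset.sum_const]
    exact Finset.sum_congr rfl fun i hi => by rw [mem_nulls.1 hi]
  have hnull : ((nulls θ).card : ℝ) = n - S := by rw [← hcard]; linarith [card_nulls_add θ]
  have hn0 : (0 : ℝ) < n := by
    by_contra hcon
    have := mul_nonpos_of_nonneg_of_nonpos hε.le (not_lt.1 hcon)
    linarith
  obtain ⟨hN1, hN2⟩ := abs_le.1 hN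
  have hnp : n * p ≤ (c + ε) * (1 + ε) * S := by
    have : n * p ≤ n * ((c + ε) * f) := mul_le_mul_of_nonneg_left (by linarith) hn0.le
    have e2 : (c + ε) * (n * f) ≤ (c + ε) * ((1 + ε) * S) :=
      mul_le_mul_of_nonneg_left hhigh (by linarith)
    linarith
  have hnp' : (c - 2 * ε - c * ε) * S ≤ n * p := by
    have e1 : n * ((c - ε) * f) ≤ n * p := mul_le_mul_of_nonneg_left (by linarith) hn0.le
    have e2 : c * ((1 - ε) * S) ≤ c * (n * f) := mul_le_mul_of_nonneg_left hlow hc.le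
    have e3 : ε * (n * f) ≤ ε * ((1 + ε) * S) := mul_le_mul_of_nonneg_left hhigh hε.le
    have e4 : ε * ((1 + ε) * S) ≤ ε * (2 * S) := by
      refine mul_le_mul_of_nonneg_left (mul_le_mul_of_nonneg_right ?_ hS.le) hε.le
      linarith
    linarith
  have hεS : 0 < ε * S := mul_pos hε hS
  have hup : (c + ε) * (1 + ε) * S ≤ c * S + ε * (2 + c) * S := by
    linarith [mul_pos hc hεS, mul_le_mul_of_nonneg_right hε1 hεS.le]
  have hSp : S * p ≤ ε * (1 + c) * S := by
    have e1 : 4 * (S * p) ≤ ε * (n * p) := by linarith [mul_le_mul_of_nonneg_right hSn hp0]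
    have e2 : ε * (n * p) ≤ ε * (c * S + ε * (2 + c) * S) :=
      mul_le_mul_of_nonneg_left (hnp.trans hup) hε.le
    have e3 : ε * (ε * (2 + c) * S) ≤ ε * (1 * (2 + c) * S) := by
      gcongr; linarith
    linarith [mul_pos hc hεS]
  have hmeanup : ((nulls θ).card : ℝ) * p ≤ c * S + ε * (2 + c) * S := by
    rw [hnull]
    linarith [mul_nonneg hS.le hp0]
  have hmeanlow : c * S - ε * (3 + 2 * c) * S ≤ (nulls θ).card * p := by
    rw [hnull]
    linarith
  have hcε : 0 < c * (ε * S) := mul_pos hc hεS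
  -- The mean is within ε(3 + 2c)S of cS, so B = 4 + 3c leaves a deviation of at least εS for
  -- Chebyshev.
  have hsub : {X | ε * B * S < |exceed (nulls θ) A X - c * S|} ⊆
      {X | ε * S ≤ |exceed (nulls θ) A X - ∑ i ∈ nulls θ, (gaussianReal (θ i) 1).real A|} := by
    intro X hX
    rw [mem_ofPred_eq, hB] at hX
    rw [mem_ofPred_eq, hsum]
    rcases lt_abs.1 hX with h1 | h1
    · refine le_trans ?_ (le_abs_self _)
      linarith
    · refine le_trans ?_ (neg_le_abs _)
      linarith
  refine (measureReal_mono hsub).trans ((exceed_chebyshev θ _ hA hεS).trans ?_)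
  rw [hsum]
  have hle : ((nulls θ).card : ℝ) * p ≤ 2 * (c + 1) * S := by
    have : ε * (2 + c) * S ≤ 1 / 2 * (2 + c) * S := by gcongr
    linarith [mul_pos hc hS]
  calc ((nulls θ).card : ℝ) * p / (ε * S) ^ 2 ≤ 2 * (c + 1) * S / (ε * S) ^ 2 := by gcongr
    _ = _ := by field_simp

/-- With V false and R true discoveries, V/(V + R) - t is ((1 - t)(V - tS/(1 - t)) + t(S - R))/(V +
R), and V + R ≥ S/2. -/
lemma abs_fdp_sub_le {θ ψ : Fin n → ℝ} {t ε S B : ℝ} (ht : t ∈ Ioo (0 : ℝ) 1) (hε : 0 < ε)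
    (hε1 : ε ≤ 1 / 2) (hS : 2 ≤ S) (hψ0 : ∀ i, 0 ≤ ψ i)
    (hV : |∑ i ∈ nulls θ, ψ i - t / (1 - t) * S| ≤ ε * B * S)
    (hR : (1 - ε) * S ≤ ∑ i ∈ signals θ, ψ i) (hR' : ∑ i ∈ signals θ, ψ i ≤ S) :
    |fdp θ ψ - t| ≤ 2 * ε * (B + 1) := by
  obtain ⟨ht0, ht1⟩ := ht
  set V := ∑ i ∈ nulls θ, ψ i with hVdef
  set R := ∑ i ∈ signals θ, ψ i
  have hV0 : 0 ≤ V := Finset.sum_nonneg fun i _ => hψ0 i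
  have hSR : S / 2 ≤ V + R := by
    linarith [mul_le_mul_of_nonneg_right hε1 (by linarith : 0 ≤ S)]
  have hpos : 0 < V + R := by linarith
  have hB0 : 0 ≤ ε * B * S := (abs_nonneg _).trans hV
  rw [fdp, ← sum_nulls_add_sum_signals θ, ← hVdef, max_eq_right (by linarith)]
  have e1 : V / (V + R) - t = ((1 - t) * (V - t / (1 - t) * S) + t * (S - R)) / (V + R) := by
    have : 1 - t ≠ 0 := by linarith
    field_simp
    ring
  rw [e1, abs_div, abs_of_pos hpos, div_le_iff₀ hpos]
  have e2 : |(1 - t) * (V - t / (1 - t) * S) + t * (S - R)| ≤ ε * B * S + ε * S := by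
    refine (abs_add_le _ _).trans (add_le_add ?_ ?_)
    · rw [abs_mul, abs_of_pos (by linarith : 0 < 1 - t)]
      exact (mul_le_of_le_one_left (abs_nonneg _) (by linarith)).trans hV
    · rw [abs_mul, abs_of_pos ht0, abs_of_nonneg (by linarith)]
      exact (mul_le_of_le_one_left (by linarith) ht1.le).trans (by linarith)
  refine e2.trans ?_
  have hB1 : 0 ≤ ε * (B + 1) := by
    have : 0 ≤ ε * B := nonneg_of_mul_nonneg_left hB0 (by linarith)
    linarith
  linarith [mul_le_mul_of_nonneg_left hSR hB1]

lemma fnp_le {θ ψ : Fin n → ℝ} {ε S : ℝ} (hS : 1 ≤ S) (hcard : ((signals θ).card : ℝ) = S)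
    (hR : (1 - ε) * S ≤ ∑ i ∈ signals θ, ψ i) : fnp θ ψ ≤ ε := by
  rw [fnp, hcard, max_eq_right hS, div_le_iff₀ (by linarith), Finset.sum_sub_distrib]
  simp only [Finset.sum_const, nsmul_eq_mul, mul_one, hcard]
  linarith

set_option maxHeartbeats 1000000 in
/-- On the class of large signals, outside an event of small probability both procedures detect
nearly all signals, and the `q`-value procedure makes about `t / (1 - t) · s` false discoveries. -/
lemma large_class_event (h : Slab γ Λ T) {t υ a : ℝ} (ht : t ∈ Ioo (0 : ℝ) 1)
    (hυ : υ ∈ Ioo (0 : ℝ) 1) (ha : 1 < a) {s : ℕ → ℕ} (hs : Tendsto s atTop atTop)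
    (hsn : ∀ n : ℕ, 1 ≤ n → (s n : ℝ) ≤ (n : ℝ) ^ υ) {ε : ℝ} (hε : 0 < ε) (hε1 : ε ≤ 1 / 2) :
    ∀ᶠ n : ℕ in atTop, 2 ≤ (s n : ℝ) ∧ ∀ θ ∈ large n (s n) a, ∃ bad : Set (Fin n → ℝ),
      (law θ).real bad ≤ ε ∧ ∀ X ∉ bad,
        (1 - ε) * s n ≤ ∑ i ∈ signals θ, ellProc γ t n X i ∧
        (1 - ε) * s n ≤ ∑ i ∈ signals θ, qProc γ t n X i ∧
        |∑ i ∈ nulls θ, qProc γ t n X i - t / (1 - t) * s n| ≤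
          ε * (4 + 3 * (t / (1 - t))) * s n := by
  have h1t : 0 < 1 - t := by linarith [ht.2]
  set c := t / (1 - t) with hc
  have hc0 : 0 < c := div_pos ht.1 h1t
  obtain ⟨w₀, hw₀, hw₀1, hq⟩ := h.null_qValue_prob ht hε
  -- The first entry makes a visible signal contribute nearly 1/w to the score, the second makes
  -- both procedures reject it.
  set κ := max (4 / ε) (1 / t) with hκ
  have hκ0 : 0 < κ := lt_max_of_lt_left (by positivity)
  obtain ⟨ρ₀, hρ₀, hvis⟩ := h.signal_visible ha (by positivity : 0 < 32 / ε) hκ0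
  have hs' : Tendsto (fun n => (s n : ℝ)) atTop atTop := tendsto_natCast_atTop_atTop.comp hs
  -- The sum of the five Chebyshev constants 16, 32, 16, 2(c + 1) and 2(c + 1).
  set E := 64 + 4 * (c + 1) with hE
  filter_upwards [eventually_gt_atTop 0,
    h.exists_weight hυ hs hsn hw₀ hw₀1 (by linarith : 0 < 1 - ε),
    h.exists_weight hυ hs hsn hw₀ hw₀1 (by linarith : 0 < 1 + ε),
    eventually_rpow_le_mul hυ.2 (by positivity : 0 < ε / 4),
    eventually_rpow_le_mul hυ.2 (Real.exp_pos (-(ρ₀ ^ 2 / 2))),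
    hs'.eventually_ge_atTop (max 2 (E / ε ^ 3))]
    with n hn ⟨wm, hwm0, hwm1, hwmd⟩ ⟨wp, hwp0, hwp1, hwpd⟩ hn4 hnρ hsE
  have hn0 : (0 : ℝ) < n := by exact_mod_cast hn
  set S : ℝ := (s n : ℝ) with hS
  have hS2 : 2 ≤ S := (le_max_left _ _).trans hsE
  have hS0 : 0 < S := by linarith
  have hSE : E / (ε ^ 2 * S) ≤ ε := by
    have := (le_max_right _ _).trans hsE
    rw [div_le_iff₀ (by positivity)] at this
    rw [div_le_iff₀ (by positivity)]
    linarith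
  have hSn : 4 * S ≤ ε * n := by linarith [hsn n hn]
  have hSρ : S ≤ Real.exp (-(ρ₀ ^ 2 / 2)) * n := (hsn n hn).trans hnρ
  refine ⟨hS2, fun θ hθ => ?_⟩
  obtain ⟨-, hθa, hθs⟩ := hθ
  have hcard : ((signals θ).card : ℝ) = S := by rw [card_signals, hθs]
  have hmpos : 0 < wm := (one_div_natCast_mem hn).1.trans hwm0
  have hppos : 0 < wp := (one_div_natCast_mem hn).1.trans hwp0
  obtain ⟨hmeasm, hqm⟩ := hq wm hmpos hwm1
  obtain ⟨hmeasp, hqp⟩ := hq wp hppos hwp1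
  have hdm := h.drift_pos hmpos (hwm1.trans hw₀1)
  have hdp := h.drift_pos hppos (hwp1.trans hw₀1)
  set A := {x | κ ≤ wm * beta γ x} with hA
  have hAm : MeasurableSet A :=
    measurableSet_le measurable_const (measurable_const.mul h.continuous_beta.measurable)
  -- visibility of the signals
  set ρ := √(2 * Real.log (n / S)) with hρ
  have hnS : Real.exp (ρ₀ ^ 2 / 2) ≤ n / S := by
    rw [le_div_iff₀ hS0]
    calc Real.exp (ρ₀ ^ 2 / 2) * S ≤ Real.exp (ρ₀ ^ 2 / 2) * (Real.exp (-(ρ₀ ^ 2 / 2)) * n) :=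
          mul_le_mul_of_nonneg_left hSρ (Real.exp_pos _).le
      _ = n := by rw [← mul_assoc, ← Real.exp_add]; simp
  have hlog : ρ₀ ^ 2 / 2 ≤ Real.log (n / S) := by
    rw [Real.le_log_iff_exp_le (by positivity)]; exact hnS
  have hρle : ρ₀ ≤ ρ := Real.le_sqrt_of_sq_le (by linarith)
  have hρsq : Real.exp (ρ ^ 2 / 2) = n / S := by
    rw [hρ, Real.sq_sqrt (by linarith [sq_nonneg ρ₀]), mul_div_cancel_left₀ _ (two_ne_zero),
      Real.exp_log (by positivity)]
  -- Since n wm drift(wm) ≥ S/2 and drift ≤ 2, the weight wm is at least S/(4n).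
  have hwmρ : 1 / wm ≤ 4 * Real.exp (ρ ^ 2 / 2) := by
    rw [hρsq, div_le_iff₀ hmpos]
    have e1 := h.drift_le_two hmpos (hwm1.trans hw₀1)
    have e2 : S / 2 ≤ n * (wm * drift γ wm) := by rw [hwmd]; linarith [mul_le_mul_of_nonneg_right hε1 hS0.le]
    have e3 : n * (wm * drift γ wm) ≤ n * (wm * 2) := by gcongr
    have e4 : 4 * (n / S) * wm = (4 * n * wm) / S := by ring
    rw [e4, le_div_iff₀ hS0]
    linarith
  have hpsig : ∀ i ∈ signals θ, (gaussianReal (θ i) 1).real Aᶜ ≤ ε / 16 := by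
    intro i hi
    refine (hvis ρ (θ i) wm hρle (hθa i (mem_signals.1 hi)) hmpos (by linarith) hwmρ).trans
      (le_of_eq ?_)
    field_simp; norm_num
  -- the exceptional event
  set b1 := {X : Fin n → ℝ | wp ≤ wHat γ X}
  set b2 := {X : Fin n → ℝ | wHat γ X < wm ∧ (1 - ε / 8) * S ≤ exceed (signals θ) A X}
  set b3 := {X : Fin n → ℝ | exceed (signals θ) A X < (1 - ε / 8) * S}
  set b4 := {X : Fin n → ℝ | ε * (4 + 3 * c) * S <
    |exceed (nulls θ) {x | qValue γ wm x ≤ t} X - c * S|}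
  set b5 := {X : Fin n → ℝ | ε * (4 + 3 * c) * S <
    |exceed (nulls θ) {x | qValue γ wp x ≤ t} X - c * S|}
  have p1 : (law θ).real b1 ≤ 16 / (ε ^ 2 * S) :=
    h.wHat_lt_prob hn θ hwp0 (hwp1.trans hw₀1) hε (by linarith) hS0 hcard hSn hwpd
  have p2 : (law θ).real b2 ≤ 32 / (ε ^ 2 * S) :=
    h.lt_wHat_prob hn θ hwm0 (hwm1.trans hw₀1) hε (by linarith) hS0 (le_max_left _ _) hcard hwmd
  have p3 : (law θ).real b3 ≤ 16 / (ε ^ 2 * S) := by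
    refine (signals_detected θ hAm hε hS0 hcard hpsig).trans ?_
    gcongr
    rw [sq]; exact mul_le_of_le_one_right hε.le (by linarith)
  have hεS : 0 < ε * S := mul_pos hε hS0
  have p4 : (law θ).real b4 ≤ 2 * (c + 1) / (ε ^ 2 * S) :=
    null_qValue_count θ hmeasm hε hε1 hc0 hS0 hcard hSn hqm hwmd.ge
      (by rw [hwmd]; linarith) rfl
  have p5 : (law θ).real b5 ≤ 2 * (c + 1) / (ε ^ 2 * S) :=
    null_qValue_count θ hmeasp hε hε1 hc0 hS0 hcard hSn hqp
      (by rw [hwpd]; linarith) hwpd.le rfl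
  refine ⟨b1 ∪ b2 ∪ b3 ∪ b4 ∪ b5, ?_, fun X hX => ?_⟩
  · have u1 := measureReal_union_le (μ := law θ) (b1 ∪ b2 ∪ b3 ∪ b4) b5
    have u2 := measureReal_union_le (μ := law θ) (b1 ∪ b2 ∪ b3) b4
    have u3 := measureReal_union_le (μ := law θ) (b1 ∪ b2) b3
    have u4 := measureReal_union_le (μ := law θ) b1 b2
    have e : E / (ε ^ 2 * S) = 16 / (ε ^ 2 * S) + 32 / (ε ^ 2 * S) + 16 / (ε ^ 2 * S) +
        2 * (c + 1) / (ε ^ 2 * S) + 2 * (c + 1) / (ε ^ 2 * S) := by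
      rw [hE]; ring
    linarith
  · simp only [mem_union, not_or] at hX
    obtain ⟨⟨⟨⟨hX1, hX2⟩, hX3⟩, hX4⟩, hX5⟩ := hX
    have hwlt : wHat γ X < wp := not_le.1 hX1
    have hR : (1 - ε / 8) * S ≤ exceed (signals θ) A X := not_lt.1 hX3
    have hwle : wm ≤ wHat γ X := by
      by_contra hcon
      exact hX2 ⟨not_le.1 hcon, hR⟩
    have hŵ := h.wHat_mem hn X
    have hRε : (1 - ε) * S ≤ exceed (signals θ) A X := by linarith
    have hproc : ∀ i, X i ∈ A → ellProc γ t n X i = 1 ∧ qProc γ t n X i = 1 := by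
      intro i hi
      refine h.procs_eq_one hn ht hmpos X hwle ?_
      have e1 : 1 / t ≤ wm * beta γ (X i) := (le_max_right _ _).trans hi
      rw [div_le_iff₀ ht.1, beta_eq] at e1
      linarith [mul_pos hmpos ht.1]
    refine ⟨hRε.trans ?_, hRε.trans ?_, ?_⟩
    · refine Finset.sum_le_sum fun i _ => ?_
      by_cases hi : X i ∈ A
      · rw [(hproc i hi).1, indicator_of_mem hi]
      · rw [indicator_of_notMem hi]; exact ellProc_nonneg γ t X i
    · refine Finset.sum_le_sum fun i _ => ?_
      by_cases hi : X i ∈ A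
      · rw [(hproc i hi).2, indicator_of_mem hi]
      · rw [indicator_of_notMem hi]; exact qProc_nonneg γ t X i
    · have hlow : exceed (nulls θ) {x | qValue γ wm x ≤ t} X ≤
          ∑ i ∈ nulls θ, qProc γ t n X i := by
        refine Finset.sum_le_sum fun i _ => ?_
        by_cases hi : qValue γ wm (X i) ≤ t
        · have := h.qValue_le_mono ht hmpos hwle hŵ.2 hi
          rw [qProc, if_pos this]
          exact indicator_le_self' (fun _ _ => zero_le_one) _
        · rw [indicator_of_notMem (show X i ∉ {x | qValue γ wm x ≤ t} from hi)]
          exact qProc_nonneg γ t X i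
      have hup : ∑ i ∈ nulls θ, qProc γ t n X i ≤
          exceed (nulls θ) {x | qValue γ wp x ≤ t} X := by
        refine Finset.sum_le_sum fun i _ => ?_
        by_cases hi : qValue γ (wHat γ X) (X i) ≤ t
        · have := h.qValue_le_mono ht (hmpos.trans_le hwle) hwlt.le (by linarith) hi
          rw [indicator_of_mem (show X i ∈ {x | qValue γ wp x ≤ t} from this)]
          exact qProc_le_one γ t X i
        · rw [qProc, if_neg hi]
          exact indicator_nonneg (fun _ _ => zero_le_one) _
      rw [mem_ofPred_eq, not_lt] at hX4 hX5
      have a4 := abs_le.1 hX4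
      have a5 := abs_le.1 hX5
      rw [abs_le]
      constructor <;> linarith [a4.1, a5.2]

end Slab

lemma FDR_nonneg {n : ℕ} (θ : Fin n → ℝ) {ψ : (Fin n → ℝ) → Fin n → ℝ} (h0 : ∀ X i, 0 ≤ ψ X i) :
    0 ≤ FDR θ ψ := by
  rw [FDR_eq]; exact integral_nonneg fun X => fdp_nonneg θ (h0 X)

lemma FNR_nonneg {n : ℕ} (θ : Fin n → ℝ) {ψ : (Fin n → ℝ) → Fin n → ℝ} (h1 : ∀ X i, ψ X i ≤ 1) :
    0 ≤ FNR θ ψ := by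
  rw [FNR_eq]; exact integral_nonneg fun X => fnp_nonneg θ (h1 X)

lemma measurable_fdp {n : ℕ} (θ : Fin n → ℝ) {ψ : (Fin n → ℝ) → Fin n → ℝ} (hψ : Measurable ψ) :
    Measurable fun X => fdp θ (ψ X) := by
  have hi : ∀ i, Measurable fun X => ψ X i := fun i => (measurable_pi_apply i).comp hψ
  exact (Finset.measurable_fun_sum _ fun i _ => hi i).div
    (measurable_const.max (Finset.measurable_fun_sum _ fun i _ => hi i))

/-- A real supremum over an empty class would be 0 and spoil the limit t. The maximum with 1 keeps
the chosen coordinates nonzero even when the logarithm vanishes. -/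
lemma large_nonempty {n s : ℕ} (hsn : s ≤ n) (a : ℝ) : (large n s a).Nonempty := by
  classical
  set b : ℝ := max 1 (a * √(2 * Real.log ((n : ℝ) / s)))
  have hb : 0 < b := lt_max_of_lt_left one_pos
  set θ : Fin n → ℝ := fun i => if (i : ℕ) < s then b else 0
  have hne : ∀ i, θ i ≠ 0 ↔ (i : ℕ) < s := by
    intro i
    by_cases hi : (i : ℕ) < s <;> simp [θ, hi, hb.ne']
  have hnum : numNonzero θ = s := by
    rw [numNonzero]
    have : {i | θ i ≠ 0} = Set.range (Fin.castLE hsn) := by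
      ext i
      rw [mem_ofPred_eq, hne]
      constructor
      · intro hi; exact ⟨⟨i, hi⟩, by ext; simp⟩
      · rintro ⟨j, rfl⟩; simp
    rw [this, ← image_univ, ncard_image_of_injective _ (Fin.castLE_injective hsn), ncard_univ]
    simp
  refine ⟨θ, hnum.le, fun i hi => ?_, hnum⟩
  have : θ i = b := by simp [θ, (hne i).1 hi]
  rw [this, abs_of_pos hb]
  exact le_max_right _ _

/-- Uniform closeness to l also supplies the upper bound without which a real supremum is
meaningless. -/
lemma tendsto_iSup_of_eventually_close {α : ℕ → Type*} {F : ∀ n, α n → ℝ} {l : ℝ}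
    (hne : ∀ᶠ n in atTop, Nonempty (α n))
    (h : ∀ ρ > 0, ∀ᶠ n in atTop, ∀ x : α n, |F n x - l| ≤ ρ) :
    Tendsto (fun n => ⨆ x, F n x) atTop (𝓝 l) := by
  rw [Metric.tendsto_atTop']
  intro ρ hρ
  obtain ⟨N, hN⟩ := eventually_atTop.1 (hne.and (h (ρ / 2) (half_pos hρ)))
  refine ⟨N, fun n hn => ?_⟩
  obtain ⟨⟨x₀⟩, hx⟩ := hN n hn.le
  have : Nonempty (α n) := ⟨x₀⟩
  have hub : ∀ x, F n x ≤ l + ρ / 2 := fun x => by linarith [(abs_le.1 (hx x)).2]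
  have h1 : ⨆ x, F n x ≤ l + ρ / 2 := ciSup_le hub
  have h2 : F n x₀ ≤ ⨆ x, F n x := le_ciSup ⟨l + ρ / 2, by rintro _ ⟨x, rfl⟩; exact hub x⟩ x₀
  have h3 := (abs_le.1 (hx x₀)).1
  rw [Real.dist_eq, abs_lt]
  constructor <;> linarith

end SpikeSlab

open SpikeSlab in
theorem corollary1 (γ : ℝ → ℝ) (κ : ℝ) (hγ : SpikeSlab.IsSlab γ κ)
    (υ : ℝ) (hυ : υ ∈ Set.Ioo (0 : ℝ) 1) (a : ℝ) (ha : 1 < a)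
    (s : ℕ → ℕ) (hs : Filter.Tendsto s Filter.atTop Filter.atTop)
    (hsn : ∀ n : ℕ, 1 ≤ n → (s n : ℝ) ≤ (n : ℝ) ^ υ)
    (t : ℝ) (ht : t ∈ Set.Ioo (0 : ℝ) 1) :
    (∀ n : ℕ, Measurable (SpikeSlab.ellProc γ t n) ∧ Measurable (SpikeSlab.qProc γ t n)) ∧
    Filter.Tendsto
      (fun n : ℕ =>
        (⨆ θ : SpikeSlab.sparse n (s n), SpikeSlab.FDR θ.1 (SpikeSlab.ellProc γ t n)) +
          ⨆ θ : SpikeSlab.large n (s n) a, SpikeSlab.FNR θ.1 (SpikeSlab.ellProc γ t n))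
      Filter.atTop (nhds 0) ∧
    Filter.Tendsto
      (fun n : ℕ => ⨆ θ : SpikeSlab.large n (s n) a, SpikeSlab.FDR θ.1 (SpikeSlab.qProc γ t n))
      Filter.atTop (nhds t) ∧
    Filter.Tendsto
      (fun n : ℕ => ⨆ θ : SpikeSlab.large n (s n) a, SpikeSlab.FNR θ.1 (SpikeSlab.qProc γ t n))
      Filter.atTop (nhds 0) := by
  obtain ⟨Λ, T, h⟩ := hγ.exists_slab
  have hlarge : ∀ᶠ n : ℕ in atTop, Nonempty (large n (s n) a) := by
    filter_upwards [eventually_gt_atTop 0] with n hn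
    refine (large_nonempty ?_ a).to_subtype
    have h1 : (n : ℝ) ^ υ ≤ n := by
      calc (n : ℝ) ^ υ ≤ (n : ℝ) ^ (1 : ℝ) :=
            Real.rpow_le_rpow_of_exponent_le (by exact_mod_cast hn) hυ.2.le
        _ = n := Real.rpow_one _
    exact_mod_cast (hsn n hn).trans h1
  have hsparse : ∀ᶠ n : ℕ in atTop, Nonempty (sparse n (s n)) :=
    hlarge.mono fun n ⟨θ⟩ => ⟨⟨θ.1, θ.2.1⟩⟩
  have hFNR : ∀ ρ > 0, ∀ᶠ n : ℕ in atTop, ∀ θ : large n (s n) a,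
      |FNR θ.1 (ellProc γ t n) - 0| ≤ ρ ∧ |FNR θ.1 (qProc γ t n) - 0| ≤ ρ := by
    intro ρ hρ
    filter_upwards [h.large_class_event ht hυ ha hs hsn (ε := min (1 / 2) (ρ / 2)) (by positivity)
      (min_le_left _ _)] with n ⟨hS, hn⟩ θ
    obtain ⟨bad, hbad, hgood⟩ := hn θ.1 θ.2
    have hε : min (1 / 2) (ρ / 2) ≤ ρ / 2 := min_le_right _ _
    have hε0 : 0 ≤ min (1 / 2) (ρ / 2) := by positivity
    have hcard : ((signals θ.1).card : ℝ) = s n := by rw [card_signals, θ.2.2.2]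
    rw [sub_zero, sub_zero, abs_of_nonneg (FNR_nonneg _ (ellProc_le_one γ t)),
      abs_of_nonneg (FNR_nonneg _ (qProc_le_one γ t)), FNR_eq, FNR_eq]
    constructor
    · refine (integral_le_add_real hε0 bad (fun X => fnp_nonneg _ (ellProc_le_one γ t X))
        (fun X => fnp_le_one _ (ellProc_nonneg γ t X)) fun X hX => ?_).trans (by linarith)
      exact Slab.fnp_le (by linarith) hcard (hgood X hX).1
    · refine (integral_le_add_real hε0 bad (fun X => fnp_nonneg _ (qProc_le_one γ t X))
        (fun X => fnp_le_one _ (qProc_nonneg γ t X)) fun X hX => ?_).trans (by linarith)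
      exact Slab.fnp_le (by linarith) hcard (hgood X hX).2.1
  refine ⟨fun n => ⟨h.measurable_ellProc t n, h.measurable_qProc t n⟩, ?_, ?_, ?_⟩
  · rw [← add_zero (0 : ℝ)]
    refine Tendsto.add (tendsto_iSup_of_eventually_close hsparse fun ρ hρ => ?_)
      (tendsto_iSup_of_eventually_close hlarge fun ρ hρ => (hFNR ρ hρ).mono fun n hn θ => (hn θ).1)
    filter_upwards [h.eventually_FDR_ellProc_le ht hυ hsn hρ] with n hn θ
    rw [sub_zero, abs_of_nonneg (FDR_nonneg _ (ellProc_nonneg γ t))]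
    exact hn θ.1 θ.2
  · refine tendsto_iSup_of_eventually_close hlarge fun ρ hρ => ?_
    have h1t : 0 < 1 - t := by linarith [ht.2]
    have ht0 := ht.1
    set B := 4 + 3 * (t / (1 - t))
    have hB : 0 < B := by positivity
    -- The total error is 2ε(B + 1) off the exceptional event plus its probability ε.
    set ε := min (1 / 2) (ρ / (2 * B + 3)) with hεdef
    have hε0 : 0 < ε := by positivity
    have hερ : ε * (2 * B + 3) ≤ ρ := by
      have : ε ≤ ρ / (2 * B + 3) := min_le_right _ _
      rwa [le_div_iff₀ (by positivity)] at this
    filter_upwards [h.large_class_event ht hυ ha hs hsn hε0 (min_le_left _ _)] with n ⟨hS, hn⟩ θ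
    obtain ⟨bad, hbad, hgood⟩ := hn θ.1 θ.2
    have hcard : ((signals θ.1).card : ℝ) = s n := by rw [card_signals, θ.2.2.2]
    have hclose : ∀ X ∉ bad, |fdp θ.1 (qProc γ t n X) - t| ≤ 2 * ε * (B + 1) := by
      intro X hX
      obtain ⟨-, hR, hV⟩ := hgood X hX
      refine Slab.abs_fdp_sub_le ht hε0 (min_le_left _ _) hS (qProc_nonneg γ t X) hV hR ?_
      rw [← hcard, ← nsmul_one, ← Finset.sum_const]
      exact Finset.sum_le_sum fun i _ => qProc_le_one γ t X i
    have h0 : ∀ X, 0 ≤ fdp θ.1 (qProc γ t n X) := fun X => fdp_nonneg _ (qProc_nonneg γ t X)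
    have h1 : ∀ X, fdp θ.1 (qProc γ t n X) ≤ 1 := fun X => fdp_le_one _ (qProc_nonneg γ t X)
    have hint : Integrable (fun X => fdp θ.1 (qProc γ t n X)) (law θ.1) :=
      Integrable.of_bound (measurable_fdp _ (h.measurable_qProc t n)).aestronglyMeasurable 1
        (ae_of_all _ fun X => by rw [Real.norm_of_nonneg (h0 X)]; exact h1 X)
    have hup := integral_le_add_real (μ := law θ.1) (δ := t + 2 * ε * (B + 1)) (by positivity)
      bad h0 h1 fun X hX => by linarith [(abs_le.1 (hclose X hX)).2]
    -- The lower bound on the FDR is the upper bound for 1 - FDP; expanding its integral is what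
    -- requires measurability of the procedure.
    have hlow := integral_le_add_real (μ := law θ.1) (δ := 1 - t + 2 * ε * (B + 1))
      (F := fun X => 1 - fdp θ.1 (qProc γ t n X)) (by positivity) bad
      (fun X => by linarith [h1 X]) (fun X => by linarith [h0 X])
      fun X hX => by linarith [(abs_le.1 (hclose X hX)).1]
    rw [integral_sub (integrable_const 1) hint] at hlow
    simp only [integral_const, probReal_univ, smul_eq_mul, mul_one] at hlow
    rw [FDR_eq, abs_le]
    constructor <;> linarith
  · exact tendsto_iSup_of_eventually_close hlarge fun ρ hρ =>
      (hFNR ρ hρ).mono fun n hn θ => (hn θ).2
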